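/- Let $n\ge 3$ and let $(M,g,k)$ be an $n$-dimensional initial data set: $(M,g)$ is a smooth $n$-dimensional Riemannian manifold (completeness is not needed) and $k$ is a smooth symmetric $2$-tensor on $M$. Put $\mu=\tfrac12\big(\mathrm{Sc}^M+(\operatorname{tr}k)^2-|k|^2\big)$ and $J=\operatorname{div}\big(k-(\operatorname{tr}k)g\big)$, and assume the dominant energy condition $\mu\ge|J|$ on $M$. Let $\Sigma$ be a nonempty, compact, smooth hypersurface without boundary, immersed (for instance embedded) in $M$, with a smooth unit normal field $\nu$. Write $d\mu$ for its Riemannian measure, $|\Sigma|$ for its area, $\mathrm{Sc}^\Sigma$ for its scalar curvature, $B(X,Y)=g(\nabla_X\nu,Y)$ for its second fundamental form, $H=\operatorname{tr}_\Sigma B$, $\mathring B=B-\frac{H}{n-1}g_\Sigma$, and $P=\operatorname{tr}_\Sigma k$. Suppose that $H>0$ and that $\Sigma$ is a Hawking hypersurface with Lagrange parameter $\lambda\in\mathbb R$, that is, $$0=\lambda H+\Delta^\Sigma H-\tfrac{n-3}{2(n-1)}H^3+H|\mathring B|^2+H\,\mathrm{Ric}^M(\nu,\nu)+P\big(\nabla_\nu\operatorname{tr}k-\nabla_\nu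 k(\nu,\nu)\big)-2P\operatorname{div}_\Sigma\big(k(\cdot,\nu)\big)+\tfrac12HP^2-2k(\nabla^\Sigma P,\nu)$$ on $\Sigma$, where $\operatorname{div}_\Sigma(k(\cdot,\nu))$ is the divergence on $\Sigma$ of the $1$-form $X\mapsto k(X,\nu)$ on $\Sigma$. Let $$f=\Big(\frac PH\Big)^2|k|^2+\tfrac12(\operatorname{tr}k)^2-\tfrac12|k|^2-|J|-\tfrac{n}{2(n-1)}P^2-\frac PH\big(\nabla_\nu\operatorname{tr}k-\nabla_\nu k(\nu,\nu)\big)-\tfrac12|\mathring B|^2,$$ let $\omega_{n-1}$ be the volume of the unit round sphere $S^{n-1}$, and set $$\mathcal E_{n,1}(\Sigma)=\frac{1}{2(n-1)(n-2)\omega_{n-1}}\Big(\frac{|\Sigma|}{\omega_{n-1}}\Big)^{\frac1{n-1}}\int_\Sigma\Big(\mathrm{Sc}^\Sigma-\frac{n-2}{n-1}(H^2-P^2)\Big)d\mu,$$ $$\mathcal E_{n,2}(\Sigma)=\frac12\Big(\frac{|\Sigma|}{\omega_{n-1}}\Big)^{\frac{n-2}{n-1}}\Big(1-\frac{1}{(n-1)^2\omega_{n-1}}\Big(\frac{\omega_{n-1}}{|\Sigma|}\Big)^{\frac{n-3}{n-1}}\int_\Sigma(H^2-P^2)\,d\mu\Big).$$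 If $$\lambda\ \ge\ \frac1{|\Sigma|}\int_\Sigma\Big(f+\frac{n-3}{2(n-2)}\mathrm{Sc}^\Sigma\Big)d\mu,$$ then $\mathcal E_{n,1}(\Sigma)\ge0$, and if this inequality is strict then $\mathcal E_{n,1}(\Sigma)>0$. If $$\lambda\ \ge\ \frac1{|\Sigma|}\int_\Sigma\Big(f+\tfrac12\mathrm{Sc}^\Sigma\Big)d\mu-\frac{n-1}2\Big(\frac{\omega_{n-1}}{|\Sigma|}\Big)^{\frac2{n-1}},$$ then $\mathcal E_{n,2}(\Sigma)\ge0$, and if this inequality is strict then $\mathcal E_{n,2}(\Sigma)>0$. -/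

import Mathlib

open scoped Manifold ContDiff Matrix

noncomputable section

namespace Hawking

/-! ### Tensor calculus in local coordinates

Every manifold below is modelled on a Euclidean space, without boundary. A point `p` selects the
preferred chart around `p`; coordinate expressions are functions of `p` and of a point `y` of the
model space. -/

/-- The model space `ℝᵐ`. -/
abbrev E (m : ℕ) : Type := EuclideanSpace ℝ (Fin m)

/-- The standard basis vector `eᵢ` of `ℝᵐ`. -/
def stdVec {m : ℕ} (i : Fin m) : E m := EuclideanSpace.single i (1 : ℝ)

/-- The partial derivative `∂ᵢ u` at `y`. -/
def pd {m : ℕ} (i : Fin m) (u : E m → ℝ) (y : E m) : ℝ := fderiv ℝ u y (stdVec i)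

/-! The following definitions take a matrix-valued function `G`, to be thought of as the coefficients
`g_{ij}` of a metric on an open subset of `ℝᵐ`; `(G y)⁻¹` has the entries `g^{ij}`. -/

/-- The Christoffel symbols
`Γᵏᵢⱼ = ½ g^{kl} (∂ᵢ g_{jl} + ∂ⱼ g_{il} - ∂ₗ g_{ij})`. -/
def christoffel {m : ℕ} (G : E m → Matrix (Fin m) (Fin m) ℝ) (k i j : Fin m) (y : E m) : ℝ :=
  (1 / 2) * ∑ l, (G y)⁻¹ k l *
    (pd i (fun z => G z j l) y + pd j (fun z => G z i l) y - pd l (fun z => G z i j) y)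

/-- The components `Rˡₖᵢⱼ` of the curvature tensor, `R(∂ᵢ, ∂ⱼ) ∂ₖ = Rˡₖᵢⱼ ∂ₗ`, where
`R(X, Y) = ∇_X ∇_Y - ∇_Y ∇_X - ∇_[X,Y]`. -/
def riemannCoord {m : ℕ} (G : E m → Matrix (Fin m) (Fin m) ℝ) (l k i j : Fin m) (y : E m) : ℝ :=
  pd i (christoffel G l j k) y - pd j (christoffel G l i k) y
    + ∑ r, (christoffel G l i r y * christoffel G r j k y
        - christoffel G l j r y * christoffel G r i k y)

/-- The Ricci tensor `Ric_{jk} = Rⁱₖᵢⱼ` (positive on round spheres). -/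
def ricciCoord {m : ℕ} (G : E m → Matrix (Fin m) (Fin m) ℝ) (y : E m) :
    Matrix (Fin m) (Fin m) ℝ :=
  Matrix.of fun j k => ∑ i, riemannCoord G i k i j y

/-- The trace `g^{ij} T_{ij}` of a bilinear form `T` with respect to an inner product. -/
def traceOf {m : ℕ} (G T : Matrix (Fin m) (Fin m) ℝ) : ℝ := ∑ i, ∑ j, G⁻¹ i j * T i j

/-- The squared norm `g^{ip} g^{jq} T_{ij} T_{pq}` of a bilinear form `T`. -/
def normSqOf {m : ℕ} (G T : Matrix (Fin m) (Fin m) ℝ) : ℝ :=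
  ∑ i, ∑ j, ∑ p, ∑ q, G⁻¹ i p * G⁻¹ j q * T i j * T p q

/-- The inner product `g^{ij} aᵢ bⱼ` of two covectors. -/
def coinner {m : ℕ} (G : Matrix (Fin m) (Fin m) ℝ) (a b : Fin m → ℝ) : ℝ :=
  ∑ i, ∑ j, G⁻¹ i j * a i * b j

/-- The covariant derivative `∇ₗ T_{ij} = ∂ₗ T_{ij} - Γʳₗᵢ T_{rj} - Γʳₗⱼ T_{ir}`
of a field of bilinear forms. -/
def covDerivCoord {m : ℕ} (G T : E m → Matrix (Fin m) (Fin m) ℝ) (l i j : Fin m) (y : E m) : ℝ :=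
  pd l (fun z => T z i j) y
    - ∑ r, (christoffel G r l i y * T y r j + christoffel G r l j y * T y i r)

section Manifold

variable {m : ℕ} {N : Type*} [TopologicalSpace N] [ChartedSpace (E m) N]

/-- A field of bilinear forms, given by the values `T x v w` on tangent vectors at `x`. -/
abbrev BilinField (m : ℕ) (N : Type*) [TopologicalSpace N] [ChartedSpace (E m) N] : Type _ :=
  ∀ x : N, TangentSpace (𝓡 m) x → TangentSpace (𝓡 m) x → ℝ

/-- A field of covectors, given by the values `α x v` on tangent vectors at `x`. -/
abbrev CovectorField (m : ℕ) (N : Type*) [TopologicalSpace N] [ChartedSpace (E m) N] : Type _ :=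
  ∀ x : N, TangentSpace (𝓡 m) x → ℝ

/-- The coordinates of `p` in the preferred chart around `p`. -/
def center (p : N) : E m := extChartAt (𝓡 m) p p

/-- The coordinate vector `∂ᵢ` of the chart around `p`, at the point with coordinates `y`. -/
def coordVec (p : N) (y : E m) (i : Fin m) :
    TangentSpace (𝓡 m) ((extChartAt (𝓡 m) p).symm y) :=
  mfderiv (𝓡 m) (𝓡 m) (extChartAt (𝓡 m) p).symm y (stdVec i)

/-- The coefficients `T_{ij} = T(∂ᵢ, ∂ⱼ)` in the chart around `p`. -/
def coeff (T : BilinField m N) (p : N) (y : E m) : Matrix (Fin m) (Fin m) ℝ :=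
  Matrix.of fun i j => T _ (coordVec p y i) (coordVec p y j)

/-- The coefficients `αᵢ = α(∂ᵢ)` in the chart around `p`. -/
def coeffCov (α : CovectorField m N) (p : N) (y : E m) : Fin m → ℝ :=
  fun i => α _ (coordVec p y i)

/-- The trace `tr_g T`, as a function on the manifold. -/
def metricTrace (g T : BilinField m N) (p : N) : ℝ :=
  traceOf (coeff g p (center p)) (coeff T p (center p))

/-- The squared norm `|T|²_g`. -/
def metricNormSq (g T : BilinField m N) (p : N) : ℝ :=
  normSqOf (coeff g p (center p)) (coeff T p (center p))

/-- The inner product `⟨α, β⟩_g` of two covector fields. -/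
def metricCoinner (g : BilinField m N) (α β : CovectorField m N) (p : N) : ℝ :=
  coinner (coeff g p (center p)) (coeffCov α p (center p)) (coeffCov β p (center p))

/-- The scalar curvature `Sc = g^{ij} Ric_{ij}`. -/
def scalarCurvature (g : BilinField m N) (p : N) : ℝ :=
  traceOf (coeff g p (center p)) (ricciCoord (coeff g p) (center p))

/-- The components `(div T)ⱼ = g^{li} ∇ₗ T_{ij}` at `p` of the divergence of a field of bilinear
forms, in the chart around `p`. -/
def divTensor (g T : BilinField m N) (p : N) (j : Fin m) : ℝ :=
  ∑ l, ∑ i, (coeff g p (center p))⁻¹ l i * covDerivCoord (coeff g p) (coeff T p) l i j (center p)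

/-- The Riemannian volume density `√det(g_{ij})` in the chart around `p`. -/
def density (g : BilinField m N) (p : N) (y : E m) : ℝ := √(coeff g p y).det

/-- The divergence of (the vector field dual to) a covector field,
`div α = (det g)^{-1/2} ∂ᵢ ((det g)^{1/2} g^{ij} αⱼ)`. -/
def divergence (g : BilinField m N) (α : CovectorField m N) (p : N) : ℝ :=
  (density g p (center p))⁻¹ *
    ∑ i, pd i (fun y => density g p y * ∑ j, (coeff g p y)⁻¹ i j * coeffCov α p y j) (center p)

/-- The differential `du` of a function. -/
def differential (u : N → ℝ) : CovectorField m N := fun x v => mvfderiv (𝓡 m) u x v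

/-- The Laplace-Beltrami operator `Δ u = div (∇ u)`. -/
def laplaceBeltrami (g : BilinField m N) (u : N → ℝ) (p : N) : ℝ :=
  divergence g (differential u) p

/-- A smooth partition of unity subordinate to the cover by the preferred chart domains. -/
def chartPartition (m : ℕ) (N : Type*) [TopologicalSpace N] [ChartedSpace (E m) N]
    [IsManifold (𝓡 m) ∞ N] [T2Space N] [CompactSpace N] :
    SmoothPartitionOfUnity N (𝓡 m) N Set.univ :=
  (SmoothPartitionOfUnity.exists_isSubordinate (𝓡 m) (s := Set.univ) isClosed_univ
    (fun p : N => (chartAt (E m) p).source) (fun p => (chartAt (E m) p).open_source)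
    (fun x _ => Set.mem_iUnion.2 ⟨x, mem_chart_source (E m) x⟩)).choose

lemma chartPartition_isSubordinate (m : ℕ) (N : Type*) [TopologicalSpace N]
    [ChartedSpace (E m) N] [IsManifold (𝓡 m) ∞ N] [T2Space N] [CompactSpace N] :
    (chartPartition m N).IsSubordinate (fun p : N => (chartAt (E m) p).source) :=
  (SmoothPartitionOfUnity.exists_isSubordinate (𝓡 m) (s := Set.univ) isClosed_univ
    (fun p : N => (chartAt (E m) p).source) (fun p => (chartAt (E m) p).open_source)
    (fun x _ => Set.mem_iUnion.2 ⟨x, mem_chart_source (E m) x⟩)).choose_spec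

/-- The Riemannian measure of a metric `g` on a compact manifold: with a partition of unity `ρ`
subordinate to the charts, `∫ u dμ = ∑ₚ ∫ (ρₚ u)(y) √det(g_{ij}(y)) dy`, the `p`-th integral being
taken over the image of the chart around `p` (only finitely many `ρₚ` are not identically zero,
and the result does not depend on `ρ`). -/
def riemannianMeasure [IsManifold (𝓡 m) ∞ N] [T2Space N] [CompactSpace N] [MeasurableSpace N]
    (g : BilinField m N) : MeasureTheory.Measure N :=
  MeasureTheory.Measure.sum fun p : N =>
    ((MeasureTheory.volume.restrict (extChartAt (𝓡 m) p).target).withDensity fun y =>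
      ENNReal.ofReal (chartPartition m N p ((extChartAt (𝓡 m) p).symm y) * density g p y)).map
      (extChartAt (𝓡 m) p).symm

end Manifold

/-! ### Initial data sets -/

/-- An `n`-dimensional initial data set `(M, g, k)`: a smooth Riemannian metric `g` and a smooth
field `k` of symmetric bilinear forms on a smooth manifold `M`. -/
structure InitialDataSet (n : ℕ) (M : Type*) [TopologicalSpace M] [ChartedSpace (E n) M]
    [IsManifold (𝓡 n) ∞ M] where
  /-- the Riemannian metric -/
  metric : Bundle.ContMDiffRiemannianMetric (𝓡 n) ∞ (E n) (fun x : M => TangentSpace (𝓡 n) x)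
  /-- the symmetric 2-tensor -/
  tensor : ∀ x : M, TangentSpace (𝓡 n) x →L[ℝ] TangentSpace (𝓡 n) x →L[ℝ] ℝ
  tensor_symm : ∀ (x : M) (v w : TangentSpace (𝓡 n) x), tensor x v w = tensor x w v
  tensor_smooth : ContMDiff (𝓡 n) ((𝓡 n).prod 𝓘(ℝ, E n →L[ℝ] E n →L[ℝ] ℝ)) ∞
    (fun x : M => Bundle.TotalSpace.mk' (E n →L[ℝ] E n →L[ℝ] ℝ)
      (E := fun x : M => TangentSpace (𝓡 n) x →L[ℝ] TangentSpace (𝓡 n) x →L[ℝ] ℝ) x (tensor x))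

namespace InitialDataSet

variable {n : ℕ} {M : Type*} [TopologicalSpace M] [ChartedSpace (E n) M] [IsManifold (𝓡 n) ∞ M]

/-- The metric as a field of bilinear forms. -/
def g (D : InitialDataSet n M) : BilinField n M := fun x v w => D.metric.inner x v w

/-- The tensor `k` as a field of bilinear forms. -/
def k (D : InitialDataSet n M) : BilinField n M := fun x v w => D.tensor x v w

/-- The function `tr k`. -/
def trK (D : InitialDataSet n M) : M → ℝ := metricTrace D.g D.k

/-- The function `|k|²`. -/
def normSqK (D : InitialDataSet n M) : M → ℝ := metricNormSq D.g D.k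

/-- The energy density, `2 μ = Sc + (tr k)² - |k|²`. -/
def energyDensity (D : InitialDataSet n M) (p : M) : ℝ :=
  (1 / 2) * (scalarCurvature D.g p + D.trK p ^ 2 - D.normSqK p)

/-- The components of the momentum density `J = div (k - (tr k) g)` at `p`. -/
def momentumDensity (D : InitialDataSet n M) (p : M) : Fin n → ℝ :=
  divTensor D.g (fun x v w => D.k x v w - D.trK x * D.g x v w) p

/-- The norm `|J|`. -/
def normJ (D : InitialDataSet n M) (p : M) : ℝ :=
  √(coinner (coeff D.g p (center p)) (D.momentumDensity p) (D.momentumDensity p))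

/-- The dominant energy condition `μ ≥ |J|`. -/
def DominantEnergyCondition (D : InitialDataSet n M) : Prop :=
  ∀ p : M, D.normJ p ≤ D.energyDensity p

end InitialDataSet

/-! ### Hypersurfaces -/

/-- An immersed smooth hypersurface `F : S → M` in an initial data set, with a smooth unit
normal field `ν` along `F`. -/
structure Hypersurface {n : ℕ} {M : Type*} [TopologicalSpace M] [ChartedSpace (E n) M]
    [IsManifold (𝓡 n) ∞ M] (D : InitialDataSet n M)
    (S : Type*) [TopologicalSpace S] [ChartedSpace (E (n - 1)) S] where
  /-- the immersion -/
  F : S → M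
  smooth : ContMDiff (𝓡 (n - 1)) (𝓡 n) ∞ F
  immersion : ∀ x : S, Function.Injective (mfderiv (𝓡 (n - 1)) (𝓡 n) F x)
  /-- the unit normal -/
  ν : ∀ x : S, TangentSpace (𝓡 n) (F x)
  ν_smooth : ContMDiff (𝓡 (n - 1)) (𝓡 n).tangent ∞
    (fun x : S => (⟨F x, ν x⟩ : TangentBundle (𝓡 n) M))
  ν_unit : ∀ x : S, D.g (F x) (ν x) (ν x) = 1
  ν_normal : ∀ (x : S) (v : TangentSpace (𝓡 (n - 1)) x),
    D.g (F x) (ν x) (mfderiv (𝓡 (n - 1)) (𝓡 n) F x v) = 0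

namespace Hypersurface

variable {n : ℕ} {M : Type*} [TopologicalSpace M] [ChartedSpace (E n) M] [IsManifold (𝓡 n) ∞ M]
  {D : InitialDataSet n M} {S : Type*} [TopologicalSpace S] [ChartedSpace (E (n - 1)) S]

/-- The differential of the immersion. -/
def dF (s : Hypersurface D S) (x : S) :
    TangentSpace (𝓡 (n - 1)) x →L[ℝ] TangentSpace (𝓡 n) (s.F x) :=
  mfderiv (𝓡 (n - 1)) (𝓡 n) s.F x

/-- The pull-back to `S` of a field of bilinear forms on `M`. -/
def pullback (s : Hypersurface D S) (T : BilinField n M) : BilinField (n - 1) S :=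
  fun x v w => T (s.F x) (s.dF x v) (s.dF x w)

/-- The induced metric `g_Σ`. -/
def inducedMetric (s : Hypersurface D S) : BilinField (n - 1) S := s.pullback D.g

/-- The local representation of the immersion in the charts around `x` and `F x`. -/
def localRep (s : Hypersurface D S) (x : S) (y : E (n - 1)) : E n :=
  extChartAt (𝓡 n) (s.F x) (s.F ((extChartAt (𝓡 (n - 1)) x).symm y))

/-- The components `νⁱ` of the unit normal at `x` in the chart around `F x`. -/
def normalCoord (s : Hypersurface D S) (x : S) (i : Fin n) : ℝ :=
  let v : E n := mfderiv (𝓡 n) (𝓡 n) (extChartAt (𝓡 n) (s.F x)) (s.F x) (s.ν x)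
  v i

/-- The second fundamental form `B(X, Y) = ⟨∇_X ν, Y⟩ = -⟨ν, ∇_X Y⟩` at `x`, in the charts around
`x` and `F x`: `B_{ab} = - g_{ij} νⁱ (∂ₐ∂_b Fʲ + Γʲₖₗ ∂ₐFᵏ ∂_bFˡ)`. For the outward normal
of a round sphere in Euclidean space it is positive definite. -/
def secondForm (s : Hypersurface D S) (x : S) : Matrix (Fin (n - 1)) (Fin (n - 1)) ℝ :=
  Matrix.of fun a b =>
    - ∑ i, ∑ j, coeff D.g (s.F x) (center (s.F x)) i j * s.normalCoord x i *
      (pd a (pd b fun y => s.localRep x y j) (center x)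
        + ∑ k, ∑ l, christoffel (coeff D.g (s.F x)) j k l (center (s.F x)) *
            pd a (fun y => s.localRep x y k) (center x) *
            pd b (fun y => s.localRep x y l) (center x))

/-- The mean curvature `H = tr_Σ B`. -/
def meanCurvature (s : Hypersurface D S) (x : S) : ℝ :=
  traceOf (coeff s.inducedMetric x (center x)) (s.secondForm x)

/-- `|B̊|²`, where `B̊ = B - H / (n - 1) g_Σ` is the traceless part of `B`. -/
def normSqTraceless (s : Hypersurface D S) (x : S) : ℝ :=
  normSqOf (coeff s.inducedMetric x (center x))
    (s.secondForm x
      - (s.meanCurvature x / ((n : ℝ) - 1)) • coeff s.inducedMetric x (center x))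

/-- `P = tr_Σ k`, the trace of the restriction of `k` with respect to the induced metric. -/
def P (s : Hypersurface D S) (x : S) : ℝ :=
  metricTrace s.inducedMetric (s.pullback D.k) x

/-- The scalar curvature `Sc^Σ` of the induced metric. -/
def scal (s : Hypersurface D S) (x : S) : ℝ := scalarCurvature s.inducedMetric x

/-- `Ric^M(ν, ν)`. -/
def ricNormal (s : Hypersurface D S) (x : S) : ℝ :=
  ∑ i, ∑ j, ricciCoord (coeff D.g (s.F x)) (center (s.F x)) i j *
    s.normalCoord x i * s.normalCoord x j

/-- `∇_ν tr k`. -/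
def normalDerivTrK (s : Hypersurface D S) (x : S) : ℝ :=
  mvfderiv (𝓡 n) D.trK (s.F x) (s.ν x)

/-- `∇_ν k (ν, ν)`, the covariant derivative of the tensor `k`. -/
def normalDerivK (s : Hypersurface D S) (x : S) : ℝ :=
  ∑ l, ∑ i, ∑ j, covDerivCoord (coeff D.g (s.F x)) (coeff D.k (s.F x)) l i j (center (s.F x)) *
    s.normalCoord x l * s.normalCoord x i * s.normalCoord x j

/-- The covector field `k(·, ν)` on `S`. -/
def kNormal (s : Hypersurface D S) : CovectorField (n - 1) S :=
  fun x v => D.k (s.F x) (s.dF x v) (s.ν x)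

/-- `k(∇^Σ u, ν) = ⟨du, k(·, ν)⟩` for a function `u` on `S`. -/
def kGradNormal (s : Hypersurface D S) (u : S → ℝ) (x : S) : ℝ :=
  metricCoinner s.inducedMetric (differential u) s.kNormal x

/-- Hawking hypersurfaces with Lagrange parameter `lam`: the solutions of the Euler-Lagrange
equation of the Hawking functional `∫ H² - P²` under the area constraint. -/
def IsHawking (s : Hypersurface D S) (lam : ℝ) : Prop :=
  ∀ x : S,
    0 = lam * s.meanCurvature x
      + laplaceBeltrami s.inducedMetric s.meanCurvature x
      - ((n : ℝ) - 3) / (2 * ((n : ℝ) - 1)) * s.meanCurvature x ^ 3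
      + s.meanCurvature x * s.normSqTraceless x
      + s.meanCurvature x * s.ricNormal x
      + s.P x * (s.normalDerivTrK x - s.normalDerivK x)
      - 2 * s.P x * divergence s.inducedMetric s.kNormal x
      + (1 / 2) * s.meanCurvature x * s.P x ^ 2
      - 2 * s.kGradNormal s.P x

/-- The function
`f = (P/H)² |k|² + ½ (tr k)² - ½ |k|² - |J| - n/(2(n-1)) P² - (P/H)(∇_ν tr k - ∇_ν k(ν, ν)) - ½ |B̊|²`.
-/
def f (s : Hypersurface D S) (x : S) : ℝ :=
  (s.P x / s.meanCurvature x) ^ 2 * D.normSqK (s.F x)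
    + (1 / 2) * D.trK (s.F x) ^ 2
    - (1 / 2) * D.normSqK (s.F x)
    - D.normJ (s.F x)
    - (n : ℝ) / (2 * ((n : ℝ) - 1)) * s.P x ^ 2
    - s.P x / s.meanCurvature x * (s.normalDerivTrK x - s.normalDerivK x)
    - (1 / 2) * s.normSqTraceless x

variable [IsManifold (𝓡 (n - 1)) ∞ S] [T2Space S] [CompactSpace S] [MeasurableSpace S]

/-- The measure `dμ` of the induced metric. -/
def areaMeasure (s : Hypersurface D S) : MeasureTheory.Measure S :=
  riemannianMeasure s.inducedMetric

/-- The area `|Σ|`. -/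
def area (s : Hypersurface D S) : ℝ := s.areaMeasure.real Set.univ

end Hypersurface

/-- `ω_{n-1}`, the volume of the unit round sphere `S^{n-1}` in `ℝⁿ`. -/
def sphereVolume (n : ℕ) : ℝ := (MeasureTheory.volume : MeasureTheory.Measure (E n)).toSphere.real Set.univ

namespace Hypersurface

variable {n : ℕ} {M : Type*} [TopologicalSpace M] [ChartedSpace (E n) M] [IsManifold (𝓡 n) ∞ M]
  {D : InitialDataSet n M} {S : Type*} [TopologicalSpace S] [ChartedSpace (E (n - 1)) S]
  [IsManifold (𝓡 (n - 1)) ∞ S] [T2Space S] [CompactSpace S] [MeasurableSpace S]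

/-- The generalized Hawking energy `𝓔_{n,1}`. -/
def energy₁ (s : Hypersurface D S) : ℝ :=
  1 / (2 * ((n : ℝ) - 1) * ((n : ℝ) - 2) * sphereVolume n)
    * (s.area / sphereVolume n) ^ (1 / ((n : ℝ) - 1))
    * ∫ x, (s.scal x
        - ((n : ℝ) - 2) / ((n : ℝ) - 1) * (s.meanCurvature x ^ 2 - s.P x ^ 2)) ∂s.areaMeasure

/-- The generalized Hawking energy `𝓔_{n,2}`. -/
def energy₂ (s : Hypersurface D S) : ℝ :=
  1 / 2 * (s.area / sphereVolume n) ^ (((n : ℝ) - 2) / ((n : ℝ) - 1))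
    * (1 - 1 / (((n : ℝ) - 1) ^ 2 * sphereVolume n)
        * (sphereVolume n / s.area) ^ (((n : ℝ) - 3) / ((n : ℝ) - 1))
        * ∫ x, (s.meanCurvature x ^ 2 - s.P x ^ 2) ∂s.areaMeasure)

end Hypersurface

end Hawking

end

noncomputable section

namespace Hawking

/-! ### Partial derivatives -/

section PartialDerivatives

variable {m n : ℕ}

/-! Divide the Euler-Lagrange equation by `H > 0` and consider the covector field `W = d log H - 2
(P/H) k(·, ν)` on `Σ`. Its divergence is `ΔH/H - 2 (P/H) div_Σ k(·, ν) - 2 k(∇P, ν)/H`, all of which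
occurs in the divided equation, plus the quadratic terms `-|d log H|² + 2 (P/H) ⟨d log H, k(·, ν)⟩`.
Completing the square, these equal `-|d log H - (P/H) k(·, ν)|² + (P/H)² |k(·, ν)|²`, hence are at
most `(P/H)² |k|²`.

The contracted Gauss equation gives `2 Ric(ν, ν) = Sc^M - Sc^Σ + (n-2)/(n-1) H² - |B̊|²`, and the
dominant energy condition bounds `Sc^M` below by `2|J| - (tr k)² + |k|²`. The coefficients of `H²`
coming from the equation and from Gauss add up to `(n-3)/(2(n-1)) - (n-2)/(2(n-1)) = -1/(2(n-1))`.
The function `f` is made to collect what is left, so that pointwise `(H² - P²)/(2(n-1)) ≤ f + Sc^Σ/2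
- λ - div W` (`sq_sub_sq_le`). Integration over the closed hypersurface removes `div W`
(`integral_sq_sub_sq_le`). Each energy is a positive multiple of an expression decreasing in `∫ (H²
- P²)`; inserting the upper bound for this integral turns the two assumptions on `λ` into
nonnegativity, and strict inequalities stay strict.

Most of the length goes into the classical facts used above, because all geometric quantities are
defined by coordinate formulas in the preferred chart of each point. The organising device is
`InvSplit`: the ambient inverse metric is `J g⁻¹ Jᵀ + ν νᵀ`, with `J` the Jacobian and `g` the
pulled-back metric. With a unit normal `ν` it yields the Gauss equation (`scalCoord_pull`); with `ν
= 0` it describes a change of charts and yields the invariance of traces, norms, curvature and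
divergences. Invariance lets a whole neighbourhood be described in one chart, which gives
smoothness, and, with a partition of unity and change of variables, the divergence theorem
(`SmoothMetric.integral_divergence`). -/

lemma pd_congr {i : Fin m} {u v : E m → ℝ} {y : E m} (h : u =ᶠ[nhds y] v) :
    pd i u y = pd i v y := by
  simp only [pd, h.fderiv_eq]

lemma pd_add {i : Fin m} {u v : E m → ℝ} {y : E m} (hu : DifferentiableAt ℝ u y)
    (hv : DifferentiableAt ℝ v y) : pd i (fun z => u z + v z) y = pd i u y + pd i v y := by
  simp only [pd, fderiv_fun_add hu hv, add_apply]

lemma pd_mul {i : Fin m} {u v : E m → ℝ} {y : E m} (hu : DifferentiableAt ℝ u y)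
    (hv : DifferentiableAt ℝ v y) :
    pd i (fun z => u z * v z) y = pd i u y * v y + u y * pd i v y := by
  simp only [pd, fderiv_fun_mul hu hv, add_apply,
    smul_apply, smul_eq_mul]
  ring

lemma pd_const_mul {i : Fin m} {v : E m → ℝ} {y : E m} (c : ℝ) (hv : DifferentiableAt ℝ v y) :
    pd i (fun z => c * v z) y = c * pd i v y := by
  simp only [pd, fderiv_const_mul hv, smul_apply, smul_eq_mul]

lemma pd_const {i : Fin m} {y : E m} (c : ℝ) : pd i (fun _ => c) y = 0 := by
  simp [pd]

lemma pd_sum {ι : Type*} {s : Finset ι} {i : Fin m} {u : ι → E m → ℝ} {y : E m}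
    (hu : ∀ k ∈ s, DifferentiableAt ℝ (u k) y) :
    pd i (fun z => ∑ k ∈ s, u k z) y = ∑ k ∈ s, pd i (u k) y := by
  simp only [pd, fderiv_fun_sum hu, sum_apply]

lemma sum_smul_stdVec (v : E m) : ∑ i, v i • (stdVec i : E m) = v := by
  ext j
  simp [stdVec, Finset.sum_apply, Pi.single_apply]

lemma fderiv_eq_sum_pd (u : E m → ℝ) (y v : E m) : fderiv ℝ u y v = ∑ i, v i * pd i u y := by
  conv_lhs => rw [← sum_smul_stdVec v]
  simp [pd]

lemma pd_apply_eq {L : E m → E n} {y : E m} (hL : DifferentiableAt ℝ L y) (a : Fin m) (i : Fin n) :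
    pd a (fun z => L z i) y = fderiv ℝ L y (stdVec a) i := by
  have := ((EuclideanSpace.proj i : E n →L[ℝ] ℝ).hasFDerivAt.comp y hL.hasFDerivAt).fderiv
  simp only [pd]
  erw [this]
  rfl

/-- The chain rule in coordinates. -/
lemma pd_comp {a : Fin m} {u : E n → ℝ} {L : E m → E n} {y : E m}
    (hu : DifferentiableAt ℝ u (L y)) (hL : DifferentiableAt ℝ L y) :
    pd a (fun z => u (L z)) y = ∑ i, pd i u (L y) * pd a (fun z => L z i) y := by
  have h : fderiv ℝ (fun z => u (L z)) y = (fderiv ℝ u (L y)).comp (fderiv ℝ L y) :=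
    fderiv_comp y hu hL
  rw [pd, h, ContinuousLinearMap.comp_apply, fderiv_eq_sum_pd]
  exact Finset.sum_congr rfl fun i _ => by rw [pd_apply_eq hL, mul_comm]

lemma contDiffOn_pd {i : Fin m} {u : E m → ℝ} {U : Set (E m)} (hU : IsOpen U)
    (hu : ContDiffOn ℝ ∞ u U) : ContDiffOn ℝ ∞ (pd i u) U := by
  have : ContDiffOn ℝ ∞ (fderiv ℝ u) U := hu.fderiv_of_isOpen hU (by simp)
  exact this.clm_apply contDiffOn_const

lemma differentiableAt_of_contDiffOn {F G : Type*} [NormedAddCommGroup F] [NormedSpace ℝ F]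
    [NormedAddCommGroup G] [NormedSpace ℝ G] {u : F → G} {U : Set F} (hU : IsOpen U)
    (hu : ContDiffOn ℝ ∞ u U) {y : F} (hy : y ∈ U) : DifferentiableAt ℝ u y :=
  (hu.differentiableOn (by simp)).differentiableAt (hU.mem_nhds hy)

lemma pd_comm {i j : Fin m} {u : E m → ℝ} {U : Set (E m)} (hU : IsOpen U)
    (hu : ContDiffOn ℝ ∞ u U) {y : E m} (hy : y ∈ U) :
    pd i (pd j u) y = pd j (pd i u) y := by
  have hd : DifferentiableAt ℝ (fderiv ℝ u) y :=
    differentiableAt_of_contDiffOn hU (hu.fderiv_of_isOpen (m := ∞) hU (by simp)) hy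
  have h : ∀ a b : Fin m, pd a (pd b u) y = fderiv ℝ (fderiv ℝ u) y (stdVec a) (stdVec b) := by
    intro a b
    have : pd b u = fun z => fderiv ℝ u z (stdVec b) := rfl
    rw [pd, this, fderiv_clm_apply hd (differentiableAt_const _)]
    simp
  rw [h, h]
  have hs : IsSymmSndFDerivAt ℝ u y :=
    (hu.contDiffAt (hU.mem_nhds hy)).isSymmSndFDerivAt
      (by simpa using (WithTop.coe_le_coe.2 (le_top : (2 : ℕ∞) ≤ ⊤) : ((2 : ℕ∞) : WithTop ℕ∞) ≤ ∞))
  exact hs _ _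

end PartialDerivatives

/-! ### Contractions -/

section Contractions

variable {m n : ℕ}

/-- `T(u, v) = T_{ij} uⁱ vʲ`. -/
def bil (T : Matrix (Fin n) (Fin n) ℝ) (u v : Fin n → ℝ) : ℝ := ∑ i, ∑ j, T i j * u i * v j

/-- `C(w, u, v) = C_{kij} wᵏ uⁱ vʲ`. -/
def tri (C : Fin n → Matrix (Fin n) (Fin n) ℝ) (w u v : Fin n → ℝ) : ℝ :=
  ∑ k, w k * bil (C k) u v

/-- `K^{ij} T_{ij}`. -/
def frob (K T : Matrix (Fin n) (Fin n) ℝ) : ℝ := ∑ i, ∑ j, K i j * T i j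

lemma bil_eq_dot (T : Matrix (Fin n) (Fin n) ℝ) (u v : Fin n → ℝ) :
    bil T u v = u ⬝ᵥ (T *ᵥ v) := by
  simp only [bil, dotProduct, Matrix.mulVec, Finset.mul_sum]
  exact Finset.sum_congr rfl fun i _ => Finset.sum_congr rfl fun j _ => by ring

lemma bil_add_left (T : Matrix (Fin n) (Fin n) ℝ) (u u' v : Fin n → ℝ) :
    bil T (u + u') v = bil T u v + bil T u' v := by
  simp only [bil_eq_dot, add_dotProduct]

lemma bil_add_right (T : Matrix (Fin n) (Fin n) ℝ) (u v v' : Fin n → ℝ) :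
    bil T u (v + v') = bil T u v + bil T u v' := by
  simp only [bil_eq_dot, Matrix.mulVec_add, dotProduct_add]

lemma bil_comm {T : Matrix (Fin n) (Fin n) ℝ} (hT : T.IsSymm) (u v : Fin n → ℝ) :
    bil T u v = bil T v u := by
  rw [bil, Finset.sum_comm]
  exact Finset.sum_congr rfl fun i _ => Finset.sum_congr rfl fun j _ => by
    rw [hT.apply i j]; ring

lemma bil_transpose {T : Matrix (Fin n) (Fin n) ℝ} (u v : Fin n → ℝ) :
    bil Tᵀ u v = bil T v u := by
  rw [bil, Finset.sum_comm]
  exact Finset.sum_congr rfl fun i _ => Finset.sum_congr rfl fun j _ => by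
    rw [Matrix.transpose_apply]; ring

lemma bil_mul_mul (J : Matrix (Fin n) (Fin m) ℝ) (T : Matrix (Fin n) (Fin n) ℝ)
    (u v : Fin m → ℝ) : bil (Jᵀ * T * J) u v = bil T (J *ᵥ u) (J *ᵥ v) := by
  simp only [bil_eq_dot, ← Matrix.mulVec_mulVec, Matrix.dotProduct_mulVec u Jᵀ,
    Matrix.vecMul_transpose]

lemma mul_mul_apply_eq_bil (J : Matrix (Fin n) (Fin m) ℝ) (T : Matrix (Fin n) (Fin n) ℝ)
    (a b : Fin m) : (Jᵀ * T * J) a b = bil T (fun i => J i a) (fun i => J i b) := by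
  simp only [Matrix.mul_apply, Matrix.transpose_apply, bil, Finset.sum_mul]
  rw [Finset.sum_comm]
  exact Finset.sum_congr rfl fun i _ => Finset.sum_congr rfl fun j _ => by ring

lemma frob_eq_trace (K T : Matrix (Fin n) (Fin n) ℝ) : frob K T = (K * Tᵀ).trace := by
  simp [frob, Matrix.trace, Matrix.mul_apply]

lemma frob_mul_mul (k : Matrix (Fin m) (Fin m) ℝ) (T : Matrix (Fin n) (Fin n) ℝ)
    (J : Matrix (Fin n) (Fin m) ℝ) : frob k (Jᵀ * T * J) = frob (J * k * Jᵀ) T := by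
  simp only [frob_eq_trace, Matrix.transpose_mul, Matrix.transpose_transpose]
  rw [← Matrix.mul_assoc, ← Matrix.mul_assoc, Matrix.trace_mul_comm]
  simp only [Matrix.mul_assoc]

lemma frob_add_left (K K' T : Matrix (Fin n) (Fin n) ℝ) :
    frob (K + K') T = frob K T + frob K' T := by
  simp only [frob, Matrix.add_apply, add_mul, Finset.sum_add_distrib]

lemma frob_add_right (K T T' : Matrix (Fin n) (Fin n) ℝ) :
    frob K (T + T') = frob K T + frob K T' := by
  simp only [frob, Matrix.add_apply, mul_add, Finset.sum_add_distrib]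

lemma frob_vecMulVec (u v : Fin n → ℝ) (T : Matrix (Fin n) (Fin n) ℝ) :
    frob (Matrix.vecMulVec u v) T = bil T u v := by
  simp only [frob, bil, Matrix.vecMulVec_apply]
  exact Finset.sum_congr rfl fun i _ => Finset.sum_congr rfl fun j _ => by ring

lemma traceOf_eq_frob (G T : Matrix (Fin n) (Fin n) ℝ) : traceOf G T = frob G⁻¹ T := rfl

lemma coinner_eq_bil (G : Matrix (Fin n) (Fin n) ℝ) (a b : Fin n → ℝ) :
    coinner G a b = bil G⁻¹ a b := rfl

lemma normSqOf_eq_frob (G T : Matrix (Fin n) (Fin n) ℝ) :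
    normSqOf G T = frob (G⁻¹ * T * G⁻¹ᵀ) T := by
  simp only [normSqOf, frob, Matrix.mul_apply, Matrix.transpose_apply, Finset.sum_mul]
  refine Finset.sum_congr rfl fun i _ => Finset.sum_congr rfl fun j _ => ?_
  rw [Finset.sum_comm]
  exact Finset.sum_congr rfl fun i _ => Finset.sum_congr rfl fun j _ => by ring

end Contractions

/-! ### Smooth fields of matrices on open subsets of the model space -/

section Fields

variable {m n : ℕ}

/-- `G` is a smooth field of positive definite matrices on the open set `W`. -/
structure LocalMetric (G : E n → Matrix (Fin n) (Fin n) ℝ) (W : Set (E n)) : Prop where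
  isOpen : IsOpen W
  smooth : ∀ i j, ContDiffOn ℝ ∞ (fun z => G z i j) W
  posDef : ∀ z ∈ W, (G z).PosDef

/-- `L` is a smooth map from the open set `U` to `W`. -/
structure LocalMap (L : E m → E n) (U : Set (E m)) (W : Set (E n)) : Prop where
  isOpen : IsOpen U
  smooth : ContDiffOn ℝ ∞ L U
  mapsTo : Set.MapsTo L U W

/-- The derivative of a vector-valued function along `∂ₐ`. -/
def pdv (a : Fin m) (u : E m → Fin n → ℝ) (y : E m) : Fin n → ℝ := fun i => pd a (fun z => u z i) y

/-- The vector `∂ₐ L`. -/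
def tangent (L : E m → E n) (a : Fin m) (y : E m) : Fin n → ℝ := fun i => pd a (fun z => L z i) y

/-- The vector `∂ₐ ∂_b L`. -/
def hess (L : E m → E n) (a b : Fin m) (y : E m) : Fin n → ℝ := pdv a (tangent L b) y

/-- The Jacobian matrix. -/
def jac (L : E m → E n) (y : E m) : Matrix (Fin n) (Fin m) ℝ := Matrix.of fun i a => tangent L a y i

/-- The pull-back of a field of bilinear forms. -/
def pull (L : E m → E n) (T : E n → Matrix (Fin n) (Fin n) ℝ) (y : E m) :
    Matrix (Fin m) (Fin m) ℝ := (jac L y)ᵀ * T (L y) * jac L y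

lemma pull_apply (L : E m → E n) (T : E n → Matrix (Fin n) (Fin n) ℝ) (y : E m) (a b : Fin m) :
    pull L T y a b = bil (T (L y)) (tangent L a y) (tangent L b y) :=
  mul_mul_apply_eq_bil _ _ _ _

/-- The Christoffel symbols of the first kind. -/
def chr1 (G : E n → Matrix (Fin n) (Fin n) ℝ) (y : E n) (k : Fin n) : Matrix (Fin n) (Fin n) ℝ :=
  Matrix.of fun i j => (1 / 2) *
    (pd i (fun z => G z j k) y + pd j (fun z => G z i k) y - pd k (fun z => G z i j) y)

/-- `pdm T y l` is the field `∂ₗ T_{ij}`. -/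
def pdm (T : E n → Matrix (Fin n) (Fin n) ℝ) (y : E n) (l : Fin n) : Matrix (Fin n) (Fin n) ℝ :=
  Matrix.of fun i j => pd l (fun z => T z i j) y

/-- `Γ(u, v)`. -/
def chrVec (G : E n → Matrix (Fin n) (Fin n) ℝ) (y : E n) (u v : Fin n → ℝ) : Fin n → ℝ :=
  (G y)⁻¹ *ᵥ fun l => bil (chr1 G y l) u v

/-- The covariant derivative `∂ₐ∂_b L + Γ(∂ₐL, ∂_bL)` of `∂_b L` along `∂ₐ L`. -/
def accel (G : E n → Matrix (Fin n) (Fin n) ℝ) (L : E m → E n) (a b : Fin m) (y : E m) :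
    Fin n → ℝ := hess L a b y + chrVec G (L y) (tangent L a y) (tangent L b y)

lemma christoffel_eq (G : E n → Matrix (Fin n) (Fin n) ℝ) (k i j : Fin n) (y : E n) :
    christoffel G k i j y = ∑ l, (G y)⁻¹ k l * chr1 G y l i j := by
  simp only [christoffel, chr1, Finset.mul_sum, Matrix.of_apply]
  exact Finset.sum_congr rfl fun l _ => by ring

lemma sum_christoffel (G : E n → Matrix (Fin n) (Fin n) ℝ) (y : E n) (u v : Fin n → ℝ)
    (k : Fin n) : ∑ i, ∑ j, christoffel G k i j y * u i * v j = chrVec G y u v k := by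
  simp only [christoffel_eq, chrVec, Matrix.mulVec, dotProduct, bil, Finset.mul_sum,
    Finset.sum_mul]
  rw [Finset.sum_congr rfl fun i _ => Finset.sum_comm, Finset.sum_comm]
  exact Finset.sum_congr rfl fun i _ => Finset.sum_congr rfl fun j _ =>
    Finset.sum_congr rfl fun j _ => by ring

section

variable {G T : E n → Matrix (Fin n) (Fin n) ℝ} {W : Set (E n)} {L : E m → E n} {U : Set (E m)}

lemma LocalMetric.symm (hG : LocalMetric G W) {z : E n} (hz : z ∈ W) : (G z).IsSymm := by
  have := (hG.posDef z hz).isHermitian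
  rwa [Matrix.IsHermitian, Matrix.conjTranspose_eq_transpose_of_trivial] at this

lemma LocalMetric.isUnit_det (hG : LocalMetric G W) {z : E n} (hz : z ∈ W) :
    IsUnit (G z).det := (hG.posDef z hz).det_pos.ne'.isUnit

lemma contDiffOn_det {A : E m → Matrix (Fin n) (Fin n) ℝ}
    (hA : ∀ i j, ContDiffOn ℝ ∞ (fun z => A z i j) U) : ContDiffOn ℝ ∞ (fun z => (A z).det) U := by
  simp only [Matrix.det_apply']
  exact ContDiffOn.sum fun σ _ => contDiffOn_const.mul (contDiffOn_prod fun i _ => hA _ _)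

lemma contDiffOn_inv {A : E m → Matrix (Fin n) (Fin n) ℝ}
    (hA : ∀ i j, ContDiffOn ℝ ∞ (fun z => A z i j) U) (hdet : ∀ z ∈ U, (A z).det ≠ 0)
    (i j : Fin n) : ContDiffOn ℝ ∞ (fun z => (A z)⁻¹ i j) U := by
  simp only [Matrix.inv_def, Matrix.smul_apply, Ring.inverse_eq_inv', smul_eq_mul,
    Matrix.adjugate_apply]
  refine ((contDiffOn_det hA).inv hdet).mul (contDiffOn_det fun k l => ?_)
  by_cases h : k = j
  · subst h
    simpa using contDiffOn_const
  · simpa [Matrix.updateRow_ne h] using hA k l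

lemma LocalMetric.contDiffOn_inv (hG : LocalMetric G W) (i j : Fin n) :
    ContDiffOn ℝ ∞ (fun z => (G z)⁻¹ i j) W :=
  Hawking.contDiffOn_inv hG.smooth (fun z hz => (hG.posDef z hz).det_pos.ne') i j

lemma LocalMetric.contDiffOn_chr1 (hG : LocalMetric G W) (k i j : Fin n) :
    ContDiffOn ℝ ∞ (fun z => chr1 G z k i j) W := by
  simp only [chr1, Matrix.of_apply]
  have h := fun i j k => contDiffOn_pd (i := i) hG.isOpen (hG.smooth j k)
  exact contDiffOn_const.mul (((h _ _ _).add (h _ _ _)).sub (h _ _ _))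

lemma LocalMetric.contDiffOn_christoffel (hG : LocalMetric G W) (k i j : Fin n) :
    ContDiffOn ℝ ∞ (christoffel G k i j) W := by
  have : christoffel G k i j = fun z => ∑ l, (G z)⁻¹ k l * chr1 G z l i j :=
    funext fun z => christoffel_eq G k i j z
  rw [this]
  exact ContDiffOn.sum fun l _ => (hG.contDiffOn_inv k l).mul (hG.contDiffOn_chr1 l i j)

lemma LocalMap.contDiffOn_apply (hL : LocalMap L U W) (i : Fin n) :
    ContDiffOn ℝ ∞ (fun z => L z i) U :=
  (EuclideanSpace.proj i : E n →L[ℝ] ℝ).contDiff.comp_contDiffOn hL.smooth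

lemma LocalMap.contDiffOn_tangent (hL : LocalMap L U W) (a : Fin m) (i : Fin n) :
    ContDiffOn ℝ ∞ (fun z => tangent L a z i) U :=
  contDiffOn_pd hL.isOpen (hL.contDiffOn_apply i)

lemma LocalMap.contDiffOn_hess (hL : LocalMap L U W) (a b : Fin m) (i : Fin n) :
    ContDiffOn ℝ ∞ (fun z => hess L a b z i) U :=
  contDiffOn_pd hL.isOpen (hL.contDiffOn_tangent b i)

lemma LocalMap.hess_comm (hL : LocalMap L U W) (a b : Fin m) {y : E m} (hy : y ∈ U) :
    hess L a b y = hess L b a y :=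
  funext fun i => pd_comm hL.isOpen (hL.contDiffOn_apply i) hy

lemma chr1_comm (hG : LocalMetric G W) {z : E n} (hz : z ∈ W) (k : Fin n) :
    (chr1 G z k).IsSymm := by
  ext i j
  have : pd k (fun z => G z j i) z = pd k (fun z => G z i j) z :=
    pd_congr (Filter.eventually_of_mem (hG.isOpen.mem_nhds hz) fun x hx => (hG.symm hx).apply i j)
  simp only [Matrix.transpose_apply, chr1, Matrix.of_apply, this]
  ring

/-- Leibniz rule for `T(u, v)` along a map: the base point moves as well, which produces the
derivative of `T` contracted with `∂_c L`. -/
lemma LocalMap.pd_bil (hL : LocalMap L U W) (hW : IsOpen W)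
    (hT : ∀ i j, ContDiffOn ℝ ∞ (fun z => T z i j) W) {u v : E m → Fin n → ℝ} {y : E m}
    (hy : y ∈ U) (hu : ∀ i, DifferentiableAt ℝ (fun z => u z i) y)
    (hv : ∀ i, DifferentiableAt ℝ (fun z => v z i) y) (c : Fin m) :
    pd c (fun z => bil (T (L z)) (u z) (v z)) y =
      tri (pdm T (L y)) (tangent L c y) (u y) (v y) + bil (T (L y)) (pdv c u y) (v y)
        + bil (T (L y)) (u y) (pdv c v y) := by
  have hLy := differentiableAt_of_contDiffOn hL.isOpen hL.smooth hy
  have hTy : ∀ i j, DifferentiableAt ℝ (fun z => T z i j) (L y) := fun i j =>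
    differentiableAt_of_contDiffOn hW (hT i j) (hL.mapsTo hy)
  have hTL : ∀ i j, DifferentiableAt ℝ (fun z => T (L z) i j) y := fun i j =>
    (hTy i j).comp y hLy
  have key : ∀ i j, pd c (fun z => T (L z) i j * u z i * v z j) y =
      (∑ l, pdm T (L y) l i j * tangent L c y l) * u y i * v y j
        + T (L y) i j * pdv c u y i * v y j + T (L y) i j * u y i * pdv c v y j := by
    intro i j
    rw [pd_mul ((hTL i j).fun_mul (hu i)) (hv j), pd_mul (hTL i j) (hu i),
      pd_comp (u := fun z => T z i j) (hTy i j) hLy]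
    simp only [pdm, pdv, tangent, Matrix.of_apply]
    ring
  simp only [bil]
  rw [pd_sum fun i _ => DifferentiableAt.fun_sum fun j _ => ((hTL i j).fun_mul (hu i)).fun_mul (hv j)]
  simp only [pd_sum fun j _ => ((hTL _ j).fun_mul (hu _)).fun_mul (hv j), key, Finset.sum_add_distrib]
  congr 2
  simp only [tri, bil, Finset.sum_mul, Finset.mul_sum]
  rw [Finset.sum_congr rfl fun i _ => Finset.sum_comm, Finset.sum_comm]
  exact Finset.sum_congr rfl fun i _ => Finset.sum_congr rfl fun j _ =>
    Finset.sum_congr rfl fun j _ => by ring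

end

end Fields

/-! ### The Gauss equation in coordinates -/

section Gauss

variable {m n : ℕ} {G T : E n → Matrix (Fin n) (Fin n) ℝ} {W : Set (E n)} {L : E m → E n}
  {U : Set (E m)}

/-- `R(u, v, w, x) = R_{lkij} uˡ vᵏ wⁱ xʲ`. -/
def quad (R : Fin n → Fin n → Matrix (Fin n) (Fin n) ℝ) (u v w x : Fin n → ℝ) : ℝ :=
  ∑ l, u l * tri (R l) v w x

/-- The Riemann tensor with all indices lowered. -/
def riem1 (G : E n → Matrix (Fin n) (Fin n) ℝ) (y : E n) (l k : Fin n) :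
    Matrix (Fin n) (Fin n) ℝ :=
  Matrix.of fun i j => ∑ r, G y l r * riemannCoord G r k i j y

lemma LocalMap.pd_tri (hL : LocalMap L U W) (hW : IsOpen W)
    {C : E n → Fin n → Matrix (Fin n) (Fin n) ℝ}
    (hC : ∀ k i j, ContDiffOn ℝ ∞ (fun z => C z k i j) W) {w u v : E m → Fin n → ℝ} {y : E m}
    (hy : y ∈ U) (hw : ∀ i, DifferentiableAt ℝ (fun z => w z i) y)
    (hu : ∀ i, DifferentiableAt ℝ (fun z => u z i) y)
    (hv : ∀ i, DifferentiableAt ℝ (fun z => v z i) y) (c : Fin m) :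
    pd c (fun z => tri (C (L z)) (w z) (u z) (v z)) y =
      quad (fun k => pdm (fun z => C z k) (L y)) (w y) (tangent L c y) (u y) (v y)
        + tri (C (L y)) (pdv c w y) (u y) (v y) + tri (C (L y)) (w y) (pdv c u y) (v y)
        + tri (C (L y)) (w y) (u y) (pdv c v y) := by
  have hb : ∀ k, DifferentiableAt ℝ (fun z => bil (C (L z) k) (u z) (v z)) y := fun k => by
    have hTL : ∀ i j, DifferentiableAt ℝ (fun z => C (L z) k i j) y := fun i j =>
      (differentiableAt_of_contDiffOn hW (hC k i j) (hL.mapsTo hy)).comp y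
        (differentiableAt_of_contDiffOn hL.isOpen hL.smooth hy)
    exact DifferentiableAt.fun_sum fun i _ => DifferentiableAt.fun_sum fun j _ =>
      ((hTL i j).fun_mul (hu i)).fun_mul (hv j)
  simp only [tri, quad]
  rw [pd_sum fun k _ => (hw k).fun_mul (hb k)]
  simp only [← Finset.sum_add_distrib]
  refine Finset.sum_congr rfl fun k _ => ?_
  rw [pd_mul (hw k) (hb k), hL.pd_bil hW (T := fun z => C z k) (hC k) hy hu hv c]
  simp only [pdv, tri]
  ring

/-- The Koszul formula contracted with three arbitrary vectors. In this index-free form later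
computations reduce to `ring`. -/
lemma tri_chr1 (y : E n) (w u v : Fin n → ℝ) :
    tri (chr1 G y) w u v =
      (1 / 2) * (tri (pdm G y) u v w + tri (pdm G y) v u w - tri (pdm G y) w u v) := by
  have h1 : tri (pdm G y) u v w = ∑ k, ∑ i, ∑ j, w k * u i * v j * pd i (fun z => G z j k) y := by
    simp only [tri, bil, pdm, Matrix.of_apply, Finset.mul_sum]
    rw [Finset.sum_congr rfl fun i _ => Finset.sum_comm, Finset.sum_comm]
    exact Finset.sum_congr rfl fun i _ => Finset.sum_congr rfl fun j _ =>
      Finset.sum_congr rfl fun j _ => by ring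
  have h2 : tri (pdm G y) v u w = ∑ k, ∑ i, ∑ j, w k * u i * v j * pd j (fun z => G z i k) y := by
    simp only [tri, bil, pdm, Matrix.of_apply, Finset.mul_sum]
    rw [Finset.sum_congr rfl fun i _ => Finset.sum_comm, Finset.sum_comm,
      Finset.sum_congr rfl fun i _ => Finset.sum_comm]
    exact Finset.sum_congr rfl fun i _ => Finset.sum_congr rfl fun j _ =>
      Finset.sum_congr rfl fun j _ => by ring
  have h3 : tri (pdm G y) w u v = ∑ k, ∑ i, ∑ j, w k * u i * v j * pd k (fun z => G z i j) y := by
    simp only [tri, bil, pdm, Matrix.of_apply, Finset.mul_sum]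
    exact Finset.sum_congr rfl fun i _ => Finset.sum_congr rfl fun j _ =>
      Finset.sum_congr rfl fun j _ => by ring
  rw [h1, h2, h3]
  simp only [tri, bil, chr1, Matrix.of_apply, Finset.mul_sum, ← Finset.sum_add_distrib,
    ← Finset.sum_sub_distrib]
  exact Finset.sum_congr rfl fun i _ => Finset.sum_congr rfl fun j _ =>
    Finset.sum_congr rfl fun j _ => by ring

lemma mulVec_chrVec {z : E n} (hz : IsUnit (G z).det) (u v : Fin n → ℝ) :
    G z *ᵥ chrVec G z u v = fun k => bil (chr1 G z k) u v := by
  rw [chrVec, Matrix.mulVec_mulVec, Matrix.mul_nonsing_inv _ hz, Matrix.one_mulVec]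

lemma bil_chrVec_right {z : E n} (hz : IsUnit (G z).det) (u v w : Fin n → ℝ) :
    bil (G z) w (chrVec G z u v) = tri (chr1 G z) w u v := by
  rw [bil_eq_dot, mulVec_chrVec hz]
  rfl

lemma pd_pull (hG : LocalMetric G W) (hL : LocalMap L U W)
    (hT : ∀ i j, ContDiffOn ℝ ∞ (fun z => T z i j) W) {y : E m} (hy : y ∈ U) (a b c : Fin m) :
    pd c (fun z => pull L T z a b) y =
      tri (pdm T (L y)) (tangent L c y) (tangent L a y) (tangent L b y)
        + bil (T (L y)) (hess L c a y) (tangent L b y)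
        + bil (T (L y)) (tangent L a y) (hess L c b y) := by
  have h := fun a i => differentiableAt_of_contDiffOn hL.isOpen (hL.contDiffOn_tangent a i) hy
  simp only [pull_apply]
  exact hL.pd_bil hG.isOpen hT hy (h a) (h b) c

/-- In the Koszul combination of the derivatives of `⟨∂_a L, ∂_b L⟩` six Hessian terms occur; by
symmetry of second derivatives four cancel and the other two coincide. -/
lemma chr1_pull (hG : LocalMetric G W) (hL : LocalMap L U W) {y : E m} (hy : y ∈ U)
    (d a b : Fin m) : chr1 (pull L G) y d a b =
      tri (chr1 G (L y)) (tangent L d y) (tangent L a y) (tangent L b y)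
        + bil (G (L y)) (tangent L d y) (hess L a b y) := by
  have hs := bil_comm (hG.symm (hL.mapsTo hy))
  simp only [chr1, Matrix.of_apply, pd_pull hG hL hG.smooth hy]
  change _ = tri (chr1 G (L y)) _ _ _ + _
  rw [tri_chr1, hL.hess_comm b a hy, hL.hess_comm d a hy, hL.hess_comm d b hy,
    hs (hess L a b y) (tangent L d y),
    hs (hess L a d y) (tangent L b y)]
  ring

/-- The connection of the pulled-back metric is the tangential part of the ambient one. With the
index lowered, the inverse of the pulled-back metric does not enter. -/
lemma chr1_pull_eq_accel (hG : LocalMetric G W) (hL : LocalMap L U W) {y : E m} (hy : y ∈ U)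
    (d a b : Fin m) : chr1 (pull L G) y d a b =
      bil (G (L y)) (tangent L d y) (accel G L a b y) := by
  rw [accel, bil_add_right, bil_chrVec_right (hG.isUnit_det (hL.mapsTo hy)), chr1_pull hG hL hy,
    add_comm]

/-- Metric compatibility `∇g = 0`, written with lowered symbols. -/
lemma chr1_add_chr1 (hG : LocalMetric G W) {z : E n} (hz : z ∈ W) (l i k : Fin n) :
    pd i (fun x => G x l k) z = chr1 G z l i k + chr1 G z k i l := by
  have h : ∀ i a b, pd i (fun x => G x a b) z = pd i (fun x => G x b a) z := fun i a b =>
    pd_congr (Filter.eventually_of_mem (hG.isOpen.mem_nhds hz) fun x hx => (hG.symm hx).apply b a)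
  simp only [chr1, Matrix.of_apply]
  rw [h i k l, h l i k, h k i l]
  ring

lemma sum_mul_christoffel (hG : LocalMetric G W) {z : E n} (hz : z ∈ W) (l i j : Fin n) :
    ∑ r, G z l r * christoffel G r i j z = chr1 G z l i j := by
  have : (fun r => christoffel G r i j z) = (G z)⁻¹ *ᵥ fun s => chr1 G z s i j :=
    funext fun r => christoffel_eq G r i j z
  have h2 : (G z *ᵥ fun r => christoffel G r i j z) l = chr1 G z l i j := by
    rw [this, Matrix.mulVec_mulVec, Matrix.mul_nonsing_inv _ (hG.isUnit_det hz),
      Matrix.one_mulVec]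
  exact h2

/-- Differentiating the product `g_{lr} Γʳ_{jk} = Γ_{l,jk}` avoids differentiating the inverse
matrix. -/
lemma sum_mul_pd_christoffel (hG : LocalMetric G W) {z : E n} (hz : z ∈ W) (l i j k : Fin n) :
    ∑ r, G z l r * pd i (christoffel G r j k) z = pd i (fun x => chr1 G x l j k) z
      - ∑ r, (chr1 G z l i r + chr1 G z r i l) * christoffel G r j k z := by
  have h : pd i (fun x => chr1 G x l j k) z =
      pd i (fun x => ∑ r, G x l r * christoffel G r j k x) z :=
    pd_congr (Filter.eventually_of_mem (hG.isOpen.mem_nhds hz) fun x hx =>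
      (sum_mul_christoffel hG hx l j k).symm)
  have h1 := fun r => differentiableAt_of_contDiffOn hG.isOpen (hG.smooth l r) hz
  have h2 := fun r => differentiableAt_of_contDiffOn hG.isOpen
    (hG.contDiffOn_christoffel r j k) hz
  rw [h, pd_sum fun r _ => (h1 r).fun_mul (h2 r), ← Finset.sum_sub_distrib]
  refine Finset.sum_congr rfl fun r _ => ?_
  rw [pd_mul (h1 r) (h2 r), chr1_add_chr1 hG hz]
  ring

/-- Lowering the index by the product rule creates extra quadratic terms; half of them cancel the
quadratic terms of the curvature. What remains pairs Christoffel symbols of the first kind through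
the inverse metric only, the form that can be compared under pull-back. -/
lemma riem1_eq (hG : LocalMetric G W) {z : E n} (hz : z ∈ W) (l k i j : Fin n) :
    riem1 G z l k i j = pd i (fun x => chr1 G x l j k) z - pd j (fun x => chr1 G x l i k) z
      - bil (G z)⁻¹ (fun r => chr1 G z r i l) (fun r => chr1 G z r j k)
      + bil (G z)⁻¹ (fun r => chr1 G z r j l) (fun r => chr1 G z r i k) := by
  have hb : ∀ i j : Fin n, bil (G z)⁻¹ (fun r => chr1 G z r i l) (fun r => chr1 G z r j k) =
      ∑ r, chr1 G z r i l * christoffel G r j k z := fun i j => by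
    rw [bil_eq_dot]
    refine Finset.sum_congr rfl fun r _ => ?_
    rw [christoffel_eq]
    rfl
  have hc : ∀ i j : Fin n, ∑ r, G z l r * ∑ s, christoffel G r i s z * christoffel G s j k z =
      ∑ s, chr1 G z l i s * christoffel G s j k z := fun i j => by
    simp only [Finset.mul_sum, ← sum_mul_christoffel hG hz l i, Finset.sum_mul]
    rw [Finset.sum_comm]
    exact Finset.sum_congr rfl fun r _ => Finset.sum_congr rfl fun s _ => by ring
  simp only [riem1, Matrix.of_apply, riemannCoord, mul_add, mul_sub, Finset.sum_add_distrib,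
    Finset.sum_sub_distrib, sum_mul_pd_christoffel hG hz, hb, hc, add_mul]
  ring

lemma bil_sum_left {ι : Type*} [Fintype ι] (K : Matrix (Fin n) (Fin n) ℝ) (f : ι → Fin n → ℝ)
    (c : ι → ℝ) (q : Fin n → ℝ) :
    bil K (fun r => ∑ i, c i * f i r) q = ∑ i, c i * bil K (f i) q := by
  have : (fun r => ∑ i, c i * f i r) = ∑ i, c i • f i := by
    ext r
    simp [Finset.sum_apply]
  simp only [this, bil_eq_dot, sum_dotProduct, smul_dotProduct, smul_eq_mul]

lemma bil_sum_right {ι : Type*} [Fintype ι] (K : Matrix (Fin n) (Fin n) ℝ) (f : ι → Fin n → ℝ)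
    (c : ι → ℝ) (q : Fin n → ℝ) :
    bil K q (fun r => ∑ i, c i * f i r) = ∑ i, c i * bil K q (f i) := by
  simp only [← bil_transpose (T := K), bil_sum_left]

lemma bil_sum_bil (K : Matrix (Fin n) (Fin n) ℝ) (A B : Fin n → Matrix (Fin n) (Fin n) ℝ)
    (u v w x : Fin n → ℝ) :
    bil K (fun r => bil (A r) w u) (fun r => bil (B r) x v) =
      ∑ l, ∑ k, ∑ i, ∑ j, u l * v k * w i * x j *
        bil K (fun r => A r i l) (fun r => B r j k) := by
  have h : ∀ (A : Fin n → Matrix (Fin n) (Fin n) ℝ) (u w : Fin n → ℝ),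
      (fun r => bil (A r) w u) = fun r => ∑ p : Fin n × Fin n, (w p.1 * u p.2) * A r p.1 p.2 :=
    fun A u w => by
    ext r
    rw [Fintype.sum_prod_type]
    exact Finset.sum_congr rfl fun i _ => Finset.sum_congr rfl fun l _ => by ring
  rw [h A, h B, bil_sum_left K fun (p : Fin n × Fin n) r => A r p.1 p.2]
  rw [Finset.sum_congr rfl fun p _ => by
    rw [bil_sum_right K fun (p : Fin n × Fin n) r => B r p.1 p.2]]
  simp only [Fintype.sum_prod_type, Finset.mul_sum]
  rw [Finset.sum_comm]
  refine Finset.sum_congr rfl fun l _ => ?_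
  rw [Finset.sum_congr rfl fun i _ => Finset.sum_comm, Finset.sum_comm]
  exact Finset.sum_congr rfl fun i _ => Finset.sum_congr rfl fun j _ =>
    Finset.sum_congr rfl fun j _ => by ring

lemma LocalMetric.inv_symm (hG : LocalMetric G W) {z : E n} (hz : z ∈ W) :
    (G z)⁻¹.IsSymm := by
  rw [Matrix.IsSymm, Matrix.transpose_nonsing_inv, (hG.symm hz).eq]

lemma bil_eq_bil_inv (hG : LocalMetric G W) {z : E n} (hz : z ∈ W) (u v : Fin n → ℝ) :
    bil (G z) u v = bil (G z)⁻¹ (G z *ᵥ u) (G z *ᵥ v) := by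
  rw [bil_comm (hG.inv_symm hz), bil_eq_dot (G z)⁻¹, Matrix.mulVec_mulVec,
    Matrix.nonsing_inv_mul _ (hG.isUnit_det hz), Matrix.one_mulVec, bil_eq_dot]
  exact dotProduct_comm u (G z *ᵥ v)

/-- `riem1_eq` extended by multilinearity from basis vectors to four arbitrary ones. -/
lemma quad_riem1 (hG : LocalMetric G W) {z : E n} (hz : z ∈ W) (u v w x : Fin n → ℝ) :
    quad (riem1 G z) u v w x = quad (fun k => pdm (fun z => chr1 G z k) z) u w x v
      - quad (fun k => pdm (fun z => chr1 G z k) z) u x w v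
      - bil (G z) (chrVec G z w u) (chrVec G z x v)
      + bil (G z) (chrVec G z x u) (chrVec G z w v) := by
  have hu := hG.isUnit_det hz
  have hb : ∀ w x, bil (G z) (chrVec G z w u) (chrVec G z x v) =
      ∑ l, ∑ k, ∑ i, ∑ j, u l * v k * w i * x j *
        bil (G z)⁻¹ (fun r => chr1 G z r i l) (fun r => chr1 G z r j k) := fun w x => by
    rw [← bil_sum_bil, bil_eq_bil_inv hG hz, mulVec_chrVec hu, mulVec_chrVec hu]
  have hq : ∀ w x, quad (fun k => pdm (fun z => chr1 G z k) z) u w x v =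
      ∑ l, ∑ k, ∑ i, ∑ j, u l * v k * w i * x j * pd i (fun y => chr1 G y l j k) z :=
    fun w x => by
    simp only [quad, tri, bil, pdm, Matrix.of_apply, Finset.mul_sum]
    refine Finset.sum_congr rfl fun l _ => ?_
    rw [Finset.sum_congr rfl fun i _ => Finset.sum_comm, Finset.sum_comm]
    exact Finset.sum_congr rfl fun k _ => Finset.sum_congr rfl fun i _ =>
      Finset.sum_congr rfl fun j _ => by ring
  have hswap : ∀ f : Fin n → Fin n → Fin n → Fin n → ℝ,
      ∑ l, ∑ k, ∑ i, ∑ j, f l k i j = ∑ l, ∑ k, ∑ i, ∑ j, f l k j i := fun f =>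
    Finset.sum_congr rfl fun l _ => Finset.sum_congr rfl fun k _ => Finset.sum_comm
  rw [hq w x, hq x w, hb w x, hb x w, hswap fun l k i j => u l * v k * x i * w j * _,
    hswap fun l k i j => u l * v k * x i * w j * bil _ _ _]
  simp only [← Finset.sum_add_distrib, ← Finset.sum_sub_distrib]
  change ∑ l, u l * ∑ k, v k * ∑ i, ∑ j, riem1 G z l k i j * w i * x j = _
  simp only [Finset.mul_sum]
  refine Finset.sum_congr rfl fun l _ => Finset.sum_congr rfl fun k _ =>
    Finset.sum_congr rfl fun i _ => Finset.sum_congr rfl fun j _ => ?_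
  rw [riem1_eq hG hz]
  ring

lemma tri_comm {C : Fin n → Matrix (Fin n) (Fin n) ℝ} (hC : ∀ k, (C k).IsSymm)
    (w u v : Fin n → ℝ) : tri C w u v = tri C w v u :=
  Finset.sum_congr rfl fun k _ => by rw [bil_comm (hC k)]

lemma tri_pdm (hG : LocalMetric G W) {z : E n} (hz : z ∈ W) (w u v : Fin n → ℝ) :
    tri (pdm G z) w u v = tri (chr1 G z) u w v + tri (chr1 G z) v w u := by
  have hs : ∀ k, (pdm G z k).IsSymm := fun k => by
    ext i j
    exact pd_congr (Filter.eventually_of_mem (hG.isOpen.mem_nhds hz)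
      fun x hx => (hG.symm hx).apply i j)
  rw [tri_chr1, tri_chr1, tri_comm hs w v u, tri_comm hs v w u, tri_comm hs u w v]
  ring

/-- The Gauss equation before any normal is chosen. Differentiating `chr1_pull` and antisymmetrising
in `a` and `c` removes the third derivatives of `L`; metric compatibility (`tri_pdm`) then assembles
the mixed terms into products of covariant accelerations. -/
lemma riem1_pull (hG : LocalMetric G W) (hL : LocalMap L U W) (hg : LocalMetric (pull L G) U)
    {y : E m} (hy : y ∈ U) (a b c d : Fin m) :
    riem1 (pull L G) y d b c a =
      quad (riem1 G (L y)) (tangent L d y) (tangent L b y) (tangent L c y) (tangent L a y)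
        + bil (G (L y)) (accel G L a b y) (accel G L c d y)
        - bil (G (L y)) (accel G L c b y) (accel G L a d y)
        - bil (pull L G y)⁻¹ (fun r => chr1 (pull L G) y r c d) (fun r => chr1 (pull L G) y r a b)
        + bil (pull L G y)⁻¹ (fun r => chr1 (pull L G) y r a d)
          (fun r => chr1 (pull L G) y r c b) := by
  have hz := hL.mapsTo hy
  have ht := fun a i => differentiableAt_of_contDiffOn hL.isOpen (hL.contDiffOn_tangent a i) hy
  have hh := fun a b i => differentiableAt_of_contDiffOn hL.isOpen (hL.contDiffOn_hess a b i) hy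
  have hLy := differentiableAt_of_contDiffOn hL.isOpen hL.smooth hy
  have hc1 : ∀ k i j, DifferentiableAt ℝ (fun x => chr1 G (L x) k i j) y := fun k i j =>
    (differentiableAt_of_contDiffOn hG.isOpen (hG.contDiffOn_chr1 k i j) hz).comp y hLy
  have hG1 : ∀ i j, DifferentiableAt ℝ (fun x => G (L x) i j) y := fun i j =>
    (differentiableAt_of_contDiffOn hG.isOpen (hG.smooth i j) hz).comp y hLy
  have key : ∀ a c, pd c (fun x => chr1 (pull L G) x d a b) y =
      quad (fun k => pdm (fun z => chr1 G z k) (L y)) (tangent L d y) (tangent L c y)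
        (tangent L a y) (tangent L b y)
      + tri (chr1 G (L y)) (hess L c d y) (tangent L a y) (tangent L b y)
      + tri (chr1 G (L y)) (tangent L d y) (hess L c a y) (tangent L b y)
      + tri (chr1 G (L y)) (tangent L d y) (tangent L a y) (hess L c b y)
      + (tri (pdm G (L y)) (tangent L c y) (tangent L d y) (hess L a b y)
      + bil (G (L y)) (hess L c d y) (hess L a b y)
      + bil (G (L y)) (tangent L d y) (pdv c (hess L a b) y)) := by
    intro a c
    have h1 : pd c (fun x => chr1 (pull L G) x d a b) y = pd c (fun x =>
        tri (chr1 G (L x)) (tangent L d x) (tangent L a x) (tangent L b x)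
          + bil (G (L x)) (tangent L d x) (hess L a b x)) y :=
      pd_congr (Filter.eventually_of_mem (hL.isOpen.mem_nhds hy) fun x hx =>
        chr1_pull hG hL hx d a b)
    rw [h1, pd_add, hL.pd_tri hG.isOpen (C := chr1 G) hG.contDiffOn_chr1 hy (ht d) (ht a) (ht b) c,
      hL.pd_bil hG.isOpen hG.smooth hy (ht d) (hh a b) c]
    · rfl
    · exact DifferentiableAt.fun_sum fun k _ => (ht d k).fun_mul (DifferentiableAt.fun_sum
        fun i _ => DifferentiableAt.fun_sum fun j _ =>
          ((hc1 k i j).fun_mul (ht a i)).fun_mul (ht b j))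
    · exact DifferentiableAt.fun_sum fun i _ => DifferentiableAt.fun_sum fun j _ =>
          ((hG1 i j).fun_mul (ht d i)).fun_mul (hh a b j)
  -- Third derivatives of `L` are symmetric, so they drop out of the difference.
  have h3 : pdv c (hess L a b) y = pdv a (hess L c b) y := funext fun i =>
    pd_comm hL.isOpen (hL.contDiffOn_tangent b i) hy
  have hu := hG.isUnit_det hz
  have hs := bil_comm (hG.symm hz)
  have hC := tri_comm (chr1_comm hG hz)
  rw [riem1_eq hg hy, key a c, key c a, quad_riem1 hG hz, h3, hL.hess_comm c a hy]
  have hacc : ∀ h h' p q r s, bil (G (L y)) (h + chrVec G (L y) p q) (h' + chrVec G (L y) r s) =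
      bil (G (L y)) h h' + tri (chr1 G (L y)) h r s + tri (chr1 G (L y)) h' p q
        + bil (G (L y)) (chrVec G (L y) p q) (chrVec G (L y) r s) := fun h h' p q r s => by
    rw [bil_add_left, bil_add_right, bil_add_right, bil_chrVec_right hu r s h,
      hs (chrVec G (L y) p q) h', bil_chrVec_right hu p q h']
    ring
  rw [accel, accel, accel, accel, hacc, hacc, tri_pdm hG hz, tri_pdm hG hz,
    hs (chrVec G (L y) (tangent L c y) (tangent L d y)),
    hs (chrVec G (L y) (tangent L a y) (tangent L d y)), hs (hess L c d y) (hess L a b y),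
    hs (hess L a d y) (hess L c b y)]
  ring

end Gauss

/-! ### Contractions of the Gauss equation -/

section Contracted

variable {m n : ℕ} {G T : E n → Matrix (Fin n) (Fin n) ℝ} {W : Set (E n)} {L : E m → E n}
  {U : Set (E m)}

/-- The tangential part of the inverse metric at `L y` is induced from the inverse of the pulled
back metric, and `ν` spans its normal part. -/
def InvSplit (G : E n → Matrix (Fin n) (Fin n) ℝ) (L : E m → E n) (ν : Fin n → ℝ) (y : E m) :
    Prop :=
  (G (L y))⁻¹ = jac L y * (pull L G y)⁻¹ * (jac L y)ᵀ + Matrix.vecMulVec ν ν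

/-- Minus the second fundamental form with respect to `ν`. -/
def normalAccel (G : E n → Matrix (Fin n) (Fin n) ℝ) (L : E m → E n) (ν : Fin n → ℝ) (y : E m) :
    Matrix (Fin m) (Fin m) ℝ := Matrix.of fun a b => bil (G (L y)) ν (accel G L a b y)

/-- The scalar curvature in coordinates. -/
def scalCoord (G : E n → Matrix (Fin n) (Fin n) ℝ) (y : E n) : ℝ := traceOf (G y) (ricciCoord G y)

lemma bil_mul_transpose (J : Matrix (Fin n) (Fin m) ℝ) (K : Matrix (Fin m) (Fin m) ℝ)
    (u v : Fin n → ℝ) : bil (J * K * Jᵀ) u v = bil K (Jᵀ *ᵥ u) (Jᵀ *ᵥ v) := by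
  conv_lhs => rw [← Matrix.transpose_transpose J]
  exact bil_mul_mul _ _ _ _

lemma bil_add_matrix (K K' : Matrix (Fin n) (Fin n) ℝ) (u v : Fin n → ℝ) :
    bil (K + K') u v = bil K u v + bil K' u v := by
  simp only [bil_eq_dot, Matrix.add_mulVec, dotProduct_add]

lemma bil_vecMulVec (a b u v : Fin n → ℝ) :
    bil (Matrix.vecMulVec a b) u v = (a ⬝ᵥ u) * (b ⬝ᵥ v) := by
  simp only [bil, Matrix.vecMulVec_apply, dotProduct, Finset.sum_mul_sum]
  exact Finset.sum_congr rfl fun i _ => Finset.sum_congr rfl fun j _ => by ring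

lemma transpose_jac_mulVec_accel (hG : LocalMetric G W) (hL : LocalMap L U W) {y : E m}
    (hy : y ∈ U) (a b : Fin m) :
    (jac L y)ᵀ *ᵥ (G (L y) *ᵥ accel G L a b y) = fun d => chr1 (pull L G) y d a b := by
  ext d
  rw [chr1_pull_eq_accel hG hL hy, bil_eq_dot]
  rfl

/-- Splits the product of two accelerations with `InvSplit`. The tangential parts are intrinsic
Christoffel symbols and cancel the quadratic terms in `riem1_pull`; the normal parts are the entries
of the second fundamental form. -/
lemma bil_accel_accel (hG : LocalMetric G W) (hL : LocalMap L U W) {y : E m} (hy : y ∈ U)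
    {ν : Fin n → ℝ} (hν : InvSplit G L ν y) (a b c d : Fin m) :
    bil (G (L y)) (accel G L a b y) (accel G L c d y) =
      bil (pull L G y)⁻¹ (fun r => chr1 (pull L G) y r a b) (fun r => chr1 (pull L G) y r c d)
        + normalAccel G L ν y a b * normalAccel G L ν y c d := by
  rw [bil_eq_bil_inv hG (hL.mapsTo hy), hν, bil_add_matrix, bil_mul_transpose, bil_vecMulVec,
    transpose_jac_mulVec_accel hG hL hy, transpose_jac_mulVec_accel hG hL hy, ← bil_eq_dot,
    ← bil_eq_dot]
  rfl

/-- The Gauss equation. -/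
lemma riem1_pull_eq (hG : LocalMetric G W) (hL : LocalMap L U W) (hg : LocalMetric (pull L G) U)
    {y : E m} (hy : y ∈ U) {ν : Fin n → ℝ} (hν : InvSplit G L ν y) (a b c d : Fin m) :
    riem1 (pull L G) y d b c a =
      quad (riem1 G (L y)) (tangent L d y) (tangent L b y) (tangent L c y) (tangent L a y)
        + normalAccel G L ν y a b * normalAccel G L ν y c d
        - normalAccel G L ν y c b * normalAccel G L ν y a d := by
  rw [riem1_pull hG hL hg hy, bil_accel_accel hG hL hy hν, bil_accel_accel hG hL hy hν,
    bil_comm (hg.inv_symm hy) (fun r => chr1 (pull L G) y r a b),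
    bil_comm (hg.inv_symm hy) (fun r => chr1 (pull L G) y r c b)]
  ring

lemma riem1_swap_right (z : E n) (l k i j : Fin n) : riem1 G z l k i j = -riem1 G z l k j i := by
  simp only [riem1, Matrix.of_apply, ← Finset.sum_neg_distrib]
  refine Finset.sum_congr rfl fun r _ => ?_
  simp only [riemannCoord, Finset.sum_sub_distrib]
  ring

/-- By metric compatibility the derivative terms in `R_{lkij} + R_{klij}` add up to `(∂ᵢ∂ⱼ - ∂ⱼ∂ᵢ)
g_{lk} = 0`, while the quadratic terms cancel by symmetry of the inverse metric. -/
lemma riem1_swap_left (hG : LocalMetric G W) {z : E n} (hz : z ∈ W) (l k i j : Fin n) :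
    riem1 G z l k i j = -riem1 G z k l i j := by
  have h : ∀ i j, pd i (fun x => chr1 G x l j k) z + pd i (fun x => chr1 G x k j l) z =
      pd i (pd j (fun x => G x l k)) z := fun i j => by
    rw [← pd_add (differentiableAt_of_contDiffOn hG.isOpen (hG.contDiffOn_chr1 l j k) hz)
      (differentiableAt_of_contDiffOn hG.isOpen (hG.contDiffOn_chr1 k j l) hz)]
    exact pd_congr (Filter.eventually_of_mem (hG.isOpen.mem_nhds hz) fun x hx =>
      (chr1_add_chr1 hG hx l j k).symm)
  have h2 := pd_comm (i := i) (j := j) hG.isOpen (hG.smooth l k) hz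
  rw [← h, ← h] at h2
  rw [riem1_eq hG hz, riem1_eq hG hz, bil_comm (hG.inv_symm hz) (fun r => chr1 G z r i l),
    bil_comm (hG.inv_symm hz) (fun r => chr1 G z r j l)]
  linarith

lemma ricciCoord_eq (hG : LocalMetric G W) {z : E n} (hz : z ∈ W) (j k : Fin n) :
    ricciCoord G z j k = frob (G z)⁻¹ (Matrix.of fun i l => riem1 G z l k i j) := by
  simp only [ricciCoord, frob, Matrix.of_apply]
  refine Finset.sum_congr rfl fun i _ => ?_
  have h : (fun l => riem1 G z l k i j) = G z *ᵥ fun r => riemannCoord G r k i j z := rfl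
  have h2 : ((G z)⁻¹ *ᵥ fun l => riem1 G z l k i j) i = riemannCoord G i k i j z := by
    rw [h, Matrix.mulVec_mulVec, Matrix.nonsing_inv_mul _ (hG.isUnit_det hz), Matrix.one_mulVec]
  exact h2.symm

lemma frob_bil (K : Matrix (Fin n) (Fin n) ℝ)
    (R : Fin m → Fin m → Fin n → Fin n → ℝ) (u v : Fin m → ℝ) :
    frob K (Matrix.of fun i l => bil (Matrix.of fun j k => R j k i l) u v) =
      bil (Matrix.of fun j k => frob K (Matrix.of fun i l => R j k i l)) u v := by
  simp only [frob, bil, Matrix.of_apply, Finset.mul_sum, Finset.sum_mul]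
  rw [Finset.sum_congr rfl fun i _ => Finset.sum_comm, Finset.sum_comm]
  refine Finset.sum_congr rfl fun j _ => ?_
  rw [Finset.sum_congr rfl fun i _ => Finset.sum_comm, Finset.sum_comm]
  exact Finset.sum_congr rfl fun k _ => Finset.sum_congr rfl fun i _ =>
    Finset.sum_congr rfl fun l _ => by ring

lemma quad_eq_bil (R : Fin n → Fin n → Matrix (Fin n) (Fin n) ℝ) (u v w x : Fin n → ℝ) :
    quad R u v w x =
      bil (Matrix.of fun i l => bil (Matrix.of fun j k => R l k i j) x v) w u := by
  simp only [quad, tri, bil, Matrix.of_apply, Finset.mul_sum, Finset.sum_mul]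
  rw [Finset.sum_congr rfl fun l _ => Finset.sum_comm, Finset.sum_comm]
  refine Finset.sum_congr rfl fun i _ => Finset.sum_congr rfl fun l _ => ?_
  rw [Finset.sum_comm]
  exact Finset.sum_congr rfl fun j _ => Finset.sum_congr rfl fun k _ => by ring

/-- The double trace of a tensor with four indices. -/
def frob₂ (K K' : Matrix (Fin n) (Fin n) ℝ) (R : Fin n → Fin n → Matrix (Fin n) (Fin n) ℝ) : ℝ :=
  frob K (Matrix.of fun j k => frob K' (Matrix.of fun i l => R l k i j))

/-- Moves the Jacobians from the tensor to the contracting matrices: a double trace over the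
hypersurface becomes one with the tangential part `J K Jᵀ` of the ambient inverse metric. -/
lemma frob_quad (K : Matrix (Fin m) (Fin m) ℝ) (R : Fin n → Fin n → Matrix (Fin n) (Fin n) ℝ)
    (J : Matrix (Fin n) (Fin m) ℝ) :
    frob₂ K K (fun d b => Matrix.of fun c a =>
        quad R (fun i => J i d) (fun i => J i b) (fun i => J i c) (fun i => J i a)) =
      frob₂ (J * K * Jᵀ) (J * K * Jᵀ) R := by
  have h : ∀ T : Matrix (Fin n) (Fin n) ℝ,
      Matrix.of (fun a b => bil T (fun i => J i a) fun i => J i b) = Jᵀ * T * J := fun T => by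
    ext a b
    exact (mul_mul_apply_eq_bil J T a b).symm
  simp only [frob₂, quad_eq_bil, Matrix.of_apply, h, frob_mul_mul]
  have h2 : ∀ u v : Fin n → ℝ, frob (J * K * Jᵀ)
      (Matrix.of fun i l => bil (Matrix.of fun j k => R l k i j) u v) =
      bil (Matrix.of fun j k => frob (J * K * Jᵀ) (Matrix.of fun i l => R l k i j)) u v :=
    fun u v => frob_bil _ (fun j k i l => R l k i j) u v
  simp only [h2, h, frob_mul_mul]

lemma scalCoord_eq (hG : LocalMetric G W) {z : E n} (hz : z ∈ W) :
    scalCoord G z = frob₂ (G z)⁻¹ (G z)⁻¹ (riem1 G z) := by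
  rw [scalCoord, traceOf_eq_frob, frob₂]
  congr 1
  ext j k
  exact ricciCoord_eq hG hz j k

lemma frob₂_mul (K K' A B : Matrix (Fin n) (Fin n) ℝ) :
    frob₂ K K' (fun l k => Matrix.of fun i j => A j k * B i l) = frob K A * frob K' B := by
  simp only [frob₂, frob, Matrix.of_apply, Finset.sum_mul]
  refine Finset.sum_congr rfl fun j _ => Finset.sum_congr rfl fun k _ => ?_
  simp only [Finset.mul_sum]
  exact Finset.sum_congr rfl fun i _ => Finset.sum_congr rfl fun l _ => by ring

lemma frob₂_normSqOf {g : Matrix (Fin n) (Fin n) ℝ} (hg : g⁻¹.IsSymm)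
    {A : Matrix (Fin n) (Fin n) ℝ} (hA : A.IsSymm) :
    frob₂ g⁻¹ g⁻¹ (fun l k => Matrix.of fun i j => A i k * A j l) = normSqOf g A := by
  simp only [frob₂, frob, normSqOf, Matrix.of_apply, Finset.mul_sum]
  refine Finset.sum_congr rfl fun i _ => ?_
  rw [Finset.sum_congr rfl fun i _ => Finset.sum_comm, Finset.sum_comm]
  refine Finset.sum_congr rfl fun j _ => Finset.sum_congr rfl fun k _ =>
    Finset.sum_congr rfl fun l _ => ?_
  rw [hg.apply j l, hA.apply k l]
  ring

/-- Expand both inverse metrics in the double trace. The term with `ν` in all four slots vanishes by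
antisymmetry of the curvature, and each of the two mixed terms equals `Ric(ν, ν)`. -/
lemma frob₂_split (hG : LocalMetric G W) {z : E n} (hz : z ∈ W) {K : Matrix (Fin n) (Fin n) ℝ}
    {ν : Fin n → ℝ} (hK : (G z)⁻¹ = K + Matrix.vecMulVec ν ν) :
    scalCoord G z = frob₂ K K (riem1 G z) + 2 * bil (ricciCoord G z) ν ν := by
  have h0 : ∀ A : Matrix (Fin n) (Fin n) ℝ, (∀ i j, A i j = -A j i) → bil A ν ν = 0 := by
    intro A hA
    have h1 : bil Aᵀ ν ν = - bil A ν ν := by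
      simp only [bil, Matrix.transpose_apply, ← Finset.sum_neg_distrib]
      exact Finset.sum_congr rfl fun i _ => Finset.sum_congr rfl fun j _ => by
        rw [hA j i]; ring
    rw [bil_transpose] at h1
    linarith
  have hadd : ∀ A B C D, frob₂ (A + B) (C + D) (riem1 G z) = frob₂ A C (riem1 G z)
      + frob₂ A D (riem1 G z) + frob₂ B (C + D) (riem1 G z) := fun A B C D => by
    simp only [frob₂, frob_add_left]
    rw [show (Matrix.of fun j k => frob C (Matrix.of fun i l => riem1 G z l k i j)
      + frob D (Matrix.of fun i l => riem1 G z l k i j)) =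
      (Matrix.of fun j k => frob C (Matrix.of fun i l => riem1 G z l k i j)) +
      Matrix.of fun j k => frob D (Matrix.of fun i l => riem1 G z l k i j) from rfl]
    simp only [frob_add_right]
  have hN : frob₂ (Matrix.vecMulVec ν ν) (G z)⁻¹ (riem1 G z) = bil (ricciCoord G z) ν ν := by
    rw [frob₂, frob_vecMulVec]
    congr 1
    ext j k
    exact (ricciCoord_eq hG hz j k).symm
  have hNN : frob₂ (Matrix.vecMulVec ν ν) (Matrix.vecMulVec ν ν) (riem1 G z) = 0 := by
    have h := frob_bil (Matrix.vecMulVec ν ν) (fun i l j k => riem1 G z l k i j) ν ν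
    simp only [frob_vecMulVec] at h
    simp only [frob₂, frob_vecMulVec]
    rw [h, ← quad_eq_bil, quad, Finset.sum_eq_zero]
    intro l _
    rw [tri, Finset.sum_eq_zero, mul_zero]
    intro k _
    rw [h0 _ (riem1_swap_right z l k), mul_zero]
  -- The normal now sits in the other pair of slots; exchanging both antisymmetric pairs identifies
  -- the trace with the Ricci tensor again.
  have hM : frob₂ (G z)⁻¹ (Matrix.vecMulVec ν ν) (riem1 G z) = bil (ricciCoord G z) ν ν := by
    simp only [frob₂, frob_vecMulVec]
    refine (frob_bil (G z)⁻¹ (fun i l j k => riem1 G z l k i j) ν ν).trans ?_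
    congr 1
    ext i l
    simp only [Matrix.of_apply]
    rw [ricciCoord_eq hG hz]
    congr 1
    ext j k
    simp only [Matrix.of_apply]
    rw [riem1_swap_right, riem1_swap_left hG hz, neg_neg]
  -- Replacing the full inverse metric by `K` costs only the all-normal term, which is zero.
  have hKN : frob₂ K (Matrix.vecMulVec ν ν) (riem1 G z) = bil (ricciCoord G z) ν ν := by
    rw [hK] at hM
    simp only [frob₂, frob_add_left] at hM hNN ⊢
    linarith
  rw [scalCoord_eq hG hz, ← hN]
  conv_lhs => rw [hK, hadd]
  rw [← hK, hKN, hN]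
  ring

lemma normalAccel_symm (hG : LocalMetric G W) (hL : LocalMap L U W) {y : E m} (hy : y ∈ U)
    (ν : Fin n → ℝ) : (normalAccel G L ν y).IsSymm := by
  ext a b
  have : chrVec G (L y) (tangent L b y) (tangent L a y) =
      chrVec G (L y) (tangent L a y) (tangent L b y) := by
    rw [chrVec, chrVec]
    congr 1
    ext l
    exact bil_comm (chr1_comm hG (hL.mapsTo hy) l) _ _
  simp only [Matrix.transpose_apply, normalAccel, Matrix.of_apply, accel, this,
    hL.hess_comm b a hy]

/-- The doubly contracted Gauss equation. -/
lemma scalCoord_pull (hG : LocalMetric G W) (hL : LocalMap L U W) (hg : LocalMetric (pull L G) U)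
    {y : E m} (hy : y ∈ U) {ν : Fin n → ℝ} (hν : InvSplit G L ν y) :
    scalCoord (pull L G) y = scalCoord G (L y) - 2 * bil (ricciCoord G (L y)) ν ν
      + traceOf (pull L G y) (normalAccel G L ν y) ^ 2
      - normSqOf (pull L G y) (normalAccel G L ν y) := by
  rw [frob₂_split hG (hL.mapsTo hy) hν, ← frob_quad, scalCoord_eq hg hy, pow_two, traceOf_eq_frob,
    ← frob₂_mul, ← frob₂_normSqOf (hg.inv_symm hy) (normalAccel_symm hG hL hy ν)]
  have : riem1 (pull L G) y = fun d b => Matrix.of fun c a => 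
      quad (riem1 G (L y)) (tangent L d y) (tangent L b y) (tangent L c y) (tangent L a y)
        + normalAccel G L ν y a b * normalAccel G L ν y c d
        - normalAccel G L ν y c b * normalAccel G L ν y a d := by
    ext d b c a
    exact riem1_pull_eq hG hL hg hy hν a b c d
  rw [this]
  simp only [frob₂, frob, Matrix.of_apply, mul_add, mul_sub, Finset.sum_add_distrib,
    Finset.sum_sub_distrib]
  simp only [jac, Matrix.of_apply]
  ring

end Contracted

/-! ### Behaviour of coordinate expressions under isometries -/

section Invariance

variable {m n : ℕ} {G T : E n → Matrix (Fin n) (Fin n) ℝ} {W : Set (E n)} {L : E m → E n}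
  {U : Set (E m)}

/-- In equal dimensions no normal direction is left, so `ν = 0`. Chart changes thereby share their
algebra with hypersurfaces. -/
lemma invSplit_of_isUnit_det {G : E n → Matrix (Fin n) (Fin n) ℝ} {L : E n → E n} {y : E n}
    (hJ : IsUnit (jac L y).det) : InvSplit G L 0 y := by
  have hJt : IsUnit (jac L y)ᵀ.det := by rwa [Matrix.det_transpose]
  rw [InvSplit, pull, Matrix.mul_inv_rev, Matrix.mul_inv_rev, Matrix.mul_nonsing_inv_cancel_left _ _ hJ,
    Matrix.nonsing_inv_mul_cancel_right _ _ hJt, Matrix.vecMulVec_zero, add_zero]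

/-- Adjoin `ν` to the Jacobian as an extra column, giving `A`. Orthogonality makes `Aᵀ G A` block
diagonal with blocks `g` and `1`; inverting this gives `G⁻¹ = A diag(g⁻¹, 1) Aᵀ`, which is the claim
in block form. -/
lemma invSplit_of_normal (h : m + 1 = n) (hG : LocalMetric G W) (hg : LocalMetric (pull L G) U)
    {y : E m} (hy : y ∈ U) (hLy : L y ∈ W) {ν : Fin n → ℝ} (h1 : bil (G (L y)) ν ν = 1)
    (h0 : ∀ a, bil (G (L y)) ν (tangent L a y) = 0) : InvSplit G L ν y := by
  have hsymm := hG.symm hLy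
  set N : Matrix (Fin n) Unit ℝ := Matrix.of fun i _ => ν i
  set A := Matrix.fromCols (jac L y) N
  set D := Matrix.fromBlocks (pull L G y)⁻¹ 0 0 (1 : Matrix Unit Unit ℝ)
  have hJN : Nᵀ * G (L y) * jac L y = 0 := by
    ext i a
    rw [Matrix.mul_assoc]
    change ν ⬝ᵥ ((G (L y) * jac L y)ᵀ a) = 0
    exact (bil_eq_dot _ _ _).symm.trans (h0 a)
  have hNJ : (jac L y)ᵀ * G (L y) * N = 0 := by
    have := congrArg Matrix.transpose hJN
    simpa [Matrix.transpose_mul, hsymm.eq, Matrix.mul_assoc] using this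
  have hNN : Nᵀ * G (L y) * N = 1 := by
    ext i j
    rw [Matrix.mul_assoc]
    change ν ⬝ᵥ (G (L y) *ᵥ ν) = 1
    rw [← bil_eq_dot, h1]
  have h2 : (D * Aᵀ * G (L y)) * A = 1 := by
    have : Aᵀ * G (L y) * A = Matrix.fromBlocks (pull L G y) 0 0 1 := by
      rw [Matrix.transpose_fromCols, Matrix.fromRows_mul, Matrix.fromRows_mul_fromCols, hJN, hNJ,
        hNN]
      rfl
    rw [Matrix.mul_assoc D, Matrix.mul_assoc D, this, Matrix.fromBlocks_multiply]
    simp [Matrix.nonsing_inv_mul _ (hg.isUnit_det hy)]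
  -- The codimension-one hypothesis enters here: `A` has `m + 1 = n` columns, so its left inverse is
  -- a right inverse.
  have h3 : A * (D * Aᵀ * G (L y)) = 1 :=
    (Matrix.mul_eq_one_comm_of_card_eq _ _ _ (by simp [h])).1 h2
  rw [← Matrix.mul_assoc] at h3
  rw [InvSplit, Matrix.inv_eq_left_inv h3, ← Matrix.mul_assoc, Matrix.transpose_fromCols,
    Matrix.fromCols_mul_fromBlocks, Matrix.fromCols_mul_fromRows]
  simp only [Matrix.mul_zero, add_zero, zero_add, Matrix.mul_one]
  congr 1
  ext i j
  simp [Matrix.mul_apply, N, Matrix.vecMulVec_apply]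

lemma InvSplit.traceOf_pull {ν : Fin n → ℝ} {y : E m} (h : InvSplit G L ν y) :
    traceOf (pull L G y) (pull L T y) = traceOf (G (L y)) (T (L y)) - bil (T (L y)) ν ν := by
  rw [traceOf_eq_frob, traceOf_eq_frob, h, frob_add_left, frob_vecMulVec, pull, pull, frob_mul_mul]
  ring

lemma InvSplit.traceOf_pull_eq {y : E m} (h : InvSplit G L 0 y) :
    traceOf (pull L G y) (pull L T y) = traceOf (G (L y)) (T (L y)) := by
  rw [h.traceOf_pull]
  simp [bil]

lemma InvSplit.eq {y : E m} (h : InvSplit G L 0 y) :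
    (G (L y))⁻¹ = jac L y * (pull L G y)⁻¹ * (jac L y)ᵀ := by
  have := h
  rwa [InvSplit, Matrix.vecMulVec_zero, add_zero] at this

lemma InvSplit.normSqOf_pull {y : E m} (h : InvSplit G L 0 y) :
    normSqOf (pull L G y) (pull L T y) = normSqOf (G (L y)) (T (L y)) := by
  rw [normSqOf_eq_frob, normSqOf_eq_frob, h.eq, pull.eq_1 L T, frob_mul_mul]
  simp only [Matrix.transpose_mul, Matrix.transpose_transpose, Matrix.mul_assoc]

lemma InvSplit.coinner_pull {y : E m} (h : InvSplit G L 0 y) (a b : Fin n → ℝ) :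
    coinner (pull L G y) ((jac L y)ᵀ *ᵥ a) ((jac L y)ᵀ *ᵥ b) = coinner (G (L y)) a b := by
  rw [coinner_eq_bil, coinner_eq_bil, h.eq, bil_mul_transpose]

/-- The transformation law of the Christoffel symbols. -/
lemma InvSplit.accel_eq (hG : LocalMetric G W) (hL : LocalMap L U W) {y : E m} (hy : y ∈ U)
    (h : InvSplit G L 0 y) (a b : Fin m) :
    accel G L a b y = jac L y *ᵥ fun c => christoffel (pull L G) c a b y := by
  have h1 : accel G L a b y = (G (L y))⁻¹ *ᵥ (G (L y) *ᵥ accel G L a b y) := by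
    rw [Matrix.mulVec_mulVec, Matrix.nonsing_inv_mul _ (hG.isUnit_det (hL.mapsTo hy)),
      Matrix.one_mulVec]
  rw [h1, h.eq, ← Matrix.mulVec_mulVec, ← Matrix.mulVec_mulVec, transpose_jac_mulVec_accel hG hL hy]
  congr 2
  ext c
  exact (christoffel_eq _ _ _ _ _).symm

/-- The covariant derivative `∇ₗ T_{ij}`. -/
def covD (G T : E n → Matrix (Fin n) (Fin n) ℝ) (z : E n) (l : Fin n) : Matrix (Fin n) (Fin n) ℝ :=
  Matrix.of fun i j => covDerivCoord G T l i j z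

lemma tri_covD (z : E n) (w u v : Fin n → ℝ) :
    tri (covD G T z) w u v = tri (pdm T z) w u v - bil (T z) (chrVec G z w u) v
      - bil (T z) u (chrVec G z w v) := by
  have h1 : bil (T z) (chrVec G z w u) v =
      ∑ l, ∑ i, ∑ j, w l * u i * v j * ∑ r, christoffel G r l i z * T z r j := by
    simp only [bil, ← sum_christoffel, Finset.mul_sum, Finset.sum_mul]
    rw [Finset.sum_congr rfl fun i _ => Finset.sum_comm, Finset.sum_comm]
    refine Finset.sum_congr rfl fun l _ => ?_
    rw [Finset.sum_congr rfl fun i _ => Finset.sum_comm, Finset.sum_comm]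
    refine Finset.sum_congr rfl fun i _ => ?_
    rw [Finset.sum_comm]
    exact Finset.sum_congr rfl fun i _ => Finset.sum_congr rfl fun j _ => by ring
  have h2 : bil (T z) u (chrVec G z w v) =
      ∑ l, ∑ i, ∑ j, w l * u i * v j * ∑ r, christoffel G r l j z * T z i r := by
    simp only [bil, ← sum_christoffel, Finset.mul_sum]
    rw [Finset.sum_congr rfl fun i _ => Finset.sum_comm, Finset.sum_comm]
    refine Finset.sum_congr rfl fun l _ => Finset.sum_congr rfl fun i _ => ?_
    rw [Finset.sum_comm]
    exact Finset.sum_congr rfl fun i _ => Finset.sum_congr rfl fun j _ => by ring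
  rw [h1, h2]
  simp only [tri, bil, pdm, covD, covDerivCoord, Matrix.of_apply, Finset.mul_sum,
    ← Finset.sum_sub_distrib]
  refine Finset.sum_congr rfl fun i _ => Finset.sum_congr rfl fun j _ =>
    Finset.sum_congr rfl fun j _ => ?_
  rw [Finset.sum_add_distrib, ← Finset.mul_sum,  ← Finset.mul_sum]
  ring

lemma bil_sum_tangent (S : Matrix (Fin n) (Fin n) ℝ) (c : Fin m → ℝ) (y : E m) (v : Fin n → ℝ) :
    bil S (jac L y *ᵥ c) v = ∑ r, c r * bil S (tangent L r y) v := by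
  rw [← bil_sum_left]
  congr 1
  ext i
  exact (Finset.sum_congr rfl fun r _ => mul_comm (jac L y i r) (c r) :
    ∑ r, jac L y i r * c r = ∑ r, c r * jac L y i r)

lemma bil_sum_tangent_right (S : Matrix (Fin n) (Fin n) ℝ) (c : Fin m → ℝ) (y : E m)
    (v : Fin n → ℝ) : bil S v (jac L y *ᵥ c) = ∑ r, c r * bil S v (tangent L r y) := by
  simp only [← bil_transpose (T := S), bil_sum_tangent]

/-- The second derivatives of `L` created by differentiating the Jacobians are exactly those in the
transformation law of the Christoffel symbols, so they cancel and `∇T` transforms as a tensor. -/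
lemma InvSplit.covDerivCoord_pull (hG : LocalMetric G W) (hL : LocalMap L U W)
    (hT : ∀ i j, ContDiffOn ℝ ∞ (fun z => T z i j) W) {y : E m} (hy : y ∈ U)
    (h : InvSplit G L 0 y) (a b c : Fin m) :
    covDerivCoord (pull L G) (pull L T) c a b y =
      tri (covD G T (L y)) (tangent L c y) (tangent L a y) (tangent L b y) := by
  have ha := h.accel_eq hG hL hy
  have h1 : ∀ a b c, ∑ r, christoffel (pull L G) r c a y * pull L T y r b =
      bil (T (L y)) (accel G L c a y) (tangent L b y) := fun a b c => by
    rw [ha, bil_sum_tangent]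
    simp only [pull_apply]
  have h2 : ∀ a b c, ∑ r, christoffel (pull L G) r c b y * pull L T y a r =
      bil (T (L y)) (tangent L a y) (accel G L c b y) := fun a b c => by
    rw [ha, bil_sum_tangent_right]
    simp only [pull_apply]
  rw [covDerivCoord, pd_pull hG hL hT hy, Finset.sum_add_distrib, h1, h2, tri_covD, accel, accel,
    bil_add_left, bil_add_right]
  ring

/-- The divergence of a field of bilinear forms in coordinates. -/
def divCoord₂ (G T : E n → Matrix (Fin n) (Fin n) ℝ) (y : E n) (j : Fin n) : ℝ :=
  ∑ l, ∑ i, (G y)⁻¹ l i * covDerivCoord G T l i j y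

lemma InvSplit.divCoord₂_pull (hG : LocalMetric G W) (hL : LocalMap L U W)
    (hT : ∀ i j, ContDiffOn ℝ ∞ (fun z => T z i j) W) {y : E m} (hy : y ∈ U)
    (h : InvSplit G L 0 y) :
    divCoord₂ (pull L G) (pull L T) y = (jac L y)ᵀ *ᵥ divCoord₂ G T (L y) := by
  ext b
  have h1 : divCoord₂ (pull L G) (pull L T) y b = frob (pull L G y)⁻¹ ((jac L y)ᵀ *
      (Matrix.of fun l i => ∑ j, covDerivCoord G T l i j (L y) * tangent L b y j) * jac L y) := by
    refine Finset.sum_congr rfl fun c _ => Finset.sum_congr rfl fun a _ => ?_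
    rw [h.covDerivCoord_pull hG hL hT hy, mul_mul_apply_eq_bil]
    congr 1
    simp only [tri, bil, covD, jac, Matrix.of_apply, Finset.mul_sum, Finset.sum_mul]
    exact Finset.sum_congr rfl fun l _ => Finset.sum_congr rfl fun i _ =>
      Finset.sum_congr rfl fun j _ => by ring
  rw [h1, frob_mul_mul, ← h.eq]
  simp only [Matrix.mulVec, dotProduct, Matrix.transpose_apply, jac, frob, divCoord₂,
    Matrix.of_apply, Finset.mul_sum]
  rw [Finset.sum_congr rfl fun l _ => Finset.sum_comm, Finset.sum_comm]
  exact Finset.sum_congr rfl fun l _ => Finset.sum_congr rfl fun i _ =>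
      Finset.sum_congr rfl fun j _ => by ring

end Invariance

/-! ### Compositions -/

section Composition

variable {l m n : ℕ} {G : E n → Matrix (Fin n) (Fin n) ℝ} {V : Set (E l)} {U : Set (E m)}
  {W : Set (E n)} {A : E l → E m} {B : E m → E n}

lemma LocalMap.comp (hB : LocalMap B U W) (hA : LocalMap A V U) : LocalMap (B ∘ A) V W :=
  ⟨hA.isOpen, hB.smooth.comp hA.smooth hA.mapsTo, hB.mapsTo.comp hA.mapsTo⟩

lemma tangent_comp (hB : LocalMap B U W) (hA : LocalMap A V U) {y : E l} (hy : y ∈ V)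
    (a : Fin l) : tangent (B ∘ A) a y = jac B (A y) *ᵥ tangent A a y := by
  ext i
  exact pd_comp (u := fun z => B z i)
    (differentiableAt_of_contDiffOn hB.isOpen (hB.contDiffOn_apply i) (hA.mapsTo hy))
    (differentiableAt_of_contDiffOn hA.isOpen hA.smooth hy)

lemma hess_comp (hB : LocalMap B U W) (hA : LocalMap A V U) {y : E l} (hy : y ∈ V)
    (a b : Fin l) (k : Fin n) : hess (B ∘ A) a b y k = (jac B (A y) *ᵥ hess A a b y) k
      + bil (Matrix.of fun i j => hess B i j (A y) k) (tangent A a y) (tangent A b y) := by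
  have h1 : hess (B ∘ A) a b y k =
      pd a (fun z => ∑ i, jac B (A z) k i * tangent A b z i) y :=
    pd_congr (Filter.eventually_of_mem (hA.isOpen.mem_nhds hy) fun z hz =>
      congrFun (tangent_comp hB hA hz b) k)
  have hAy := differentiableAt_of_contDiffOn hA.isOpen hA.smooth hy
  have hd := fun i => differentiableAt_of_contDiffOn hB.isOpen (hB.contDiffOn_tangent i k)
    (hA.mapsTo hy)
  have hd1 : ∀ i, DifferentiableAt ℝ (fun z => jac B (A z) k i) y := fun i => (hd i).comp y hAy
  have hd2 := fun i => differentiableAt_of_contDiffOn hA.isOpen (hA.contDiffOn_tangent b i) hy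
  have h2 : ∀ i, pd a (fun z => jac B (A z) k i) y =
      ∑ j, hess B j i (A y) k * tangent A a y j := fun i => pd_comp (hd i) hAy
  rw [h1, pd_sum fun i _ => (hd1 i).fun_mul (hd2 i)]
  simp only [fun i => pd_mul (hd1 i) (hd2 i) (i := a), h2, Finset.sum_add_distrib]
  rw [add_comm]
  congr 1
  simp only [bil, Matrix.of_apply, Finset.sum_mul]
  rw [Finset.sum_comm]

lemma chrVec_eq_bil (z : E n) (u v : Fin n → ℝ) (k : Fin n) :
    chrVec G z u v k = bil (Matrix.of fun i j => christoffel G k i j z) u v :=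
  (sum_christoffel G z u v k).symm

lemma chrVec_jac_mulVec (z : E n) (y : E m) (u v : Fin m → ℝ) (k : Fin n) :
    chrVec G z (jac B y *ᵥ u) (jac B y *ᵥ v) k =
      bil (Matrix.of fun i j => chrVec G z (tangent B i y) (tangent B j y) k) u v := by
  rw [chrVec_eq_bil, ← bil_mul_mul]
  congr 1
  ext i j
  rw [mul_mul_apply_eq_bil, Matrix.of_apply, chrVec_eq_bil]
  rfl

lemma accel_comp (hB : LocalMap B U W) (hA : LocalMap A V U) {y : E l} (hy : y ∈ V)
    (a b : Fin l) : accel G (B ∘ A) a b y = jac B (A y) *ᵥ hess A a b y +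
      fun k => bil (Matrix.of fun i j => accel G B i j (A y) k) (tangent A a y)
        (tangent A b y) := by
  ext k
  have : (Matrix.of fun i j => accel G B i j (A y) k) = (Matrix.of fun i j => hess B i j (A y) k)
      + Matrix.of fun i j => chrVec G (B (A y)) (tangent B i (A y)) (tangent B j (A y)) k := rfl
  simp only [accel, Pi.add_apply, hess_comp hB hA hy, tangent_comp hB hA hy, Function.comp_apply,
    chrVec_jac_mulVec]
  change _ = _ + bil ((Matrix.of fun i j => hess B i j (A y) k)
      + Matrix.of fun i j => chrVec G (B (A y)) (tangent B i (A y)) (tangent B j (A y)) k) _ _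
  rw [bil_add_matrix, add_assoc]

lemma bil_bil_right (S : Matrix (Fin n) (Fin n) ℝ) (X : Fin m → Fin m → Fin n → ℝ)
    (ν : Fin n → ℝ) (u v : Fin m → ℝ) :
    bil S ν (fun k => bil (Matrix.of fun i j => X i j k) u v) =
      bil (Matrix.of fun i j => bil S ν (X i j)) u v := by
  have : (fun k => bil (Matrix.of fun i j => X i j k) u v) =
      fun k => ∑ p : Fin m × Fin m, (u p.1 * v p.2) * X p.1 p.2 k := by
    ext r
    rw [Fintype.sum_prod_type]
    exact Finset.sum_congr rfl fun i _ => Finset.sum_congr rfl fun l _ => by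
      rw [Matrix.of_apply]; ring
  rw [this, bil_sum_right S fun (p : Fin m × Fin m) k => X p.1 p.2 k, Fintype.sum_prod_type]
  exact Finset.sum_congr rfl fun i _ => Finset.sum_congr rfl fun l _ => by
    rw [Matrix.of_apply]; ring

lemma accel_comp_left (hG : LocalMetric G W) {B : E m → E n} (hB : LocalMap B U W)
    (hA : LocalMap A V U) {y : E l} (hy : y ∈ V) (h : InvSplit G B 0 (A y)) (a b : Fin l) :
    accel G (B ∘ A) a b y = jac B (A y) *ᵥ accel (pull B G) A a b y := by
  rw [accel_comp hB hA hy, accel, Matrix.mulVec_add]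
  congr 1
  ext k
  simp only [h.accel_eq hG hB (hA.mapsTo hy), Matrix.mulVec, dotProduct, bil, Matrix.of_apply,
    ← sum_christoffel, Finset.mul_sum, Finset.sum_mul]
  rw [Finset.sum_congr rfl fun i _ => Finset.sum_comm, Finset.sum_comm]
  exact Finset.sum_congr rfl fun i _ => Finset.sum_congr rfl fun j _ =>
    Finset.sum_congr rfl fun j _ => by ring

/-- An isometric change of ambient coordinates carries accelerations to accelerations, so it leaves
their normal components unchanged. -/
lemma normalAccel_comp_left (hG : LocalMetric G W) {B : E m → E n} (hB : LocalMap B U W)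
    (hA : LocalMap A V U) {y : E l} (hy : y ∈ V) (h : InvSplit G B 0 (A y)) (ν : Fin m → ℝ) :
    normalAccel G (B ∘ A) (jac B (A y) *ᵥ ν) y = normalAccel (pull B G) A ν y := by
  ext a b
  simp only [normalAccel, Matrix.of_apply, accel_comp_left hG hB hA hy h]
  exact (bil_mul_mul _ _ _ _).symm

/-- The second derivatives of `A` enter only through a vector tangent to `B`, which `ν` annihilates.
Hence normal accelerations are tensorial in the source variables although Hessians are not. -/
lemma normalAccel_comp_right (hB : LocalMap B U W) (hA : LocalMap A V U)
    {y : E l} (hy : y ∈ V) {ν : Fin n → ℝ}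
    (hν : ∀ c, bil (G (B (A y))) ν (tangent B c (A y)) = 0) :
    normalAccel G (B ∘ A) ν y = (jac A y)ᵀ * normalAccel G B ν (A y) * jac A y := by
  ext a b
  rw [mul_mul_apply_eq_bil]
  simp only [normalAccel, Matrix.of_apply, accel_comp hB hA hy, bil_add_right,
    bil_sum_tangent_right, Function.comp_apply, hν, mul_zero, Finset.sum_const_zero, zero_add]
  exact bil_bil_right _ (fun i j => accel G B i j (A y)) _ _ _

end Composition

/-! ### The divergence of a covector field -/

section Divergence

variable {m n : ℕ} {G : E n → Matrix (Fin n) (Fin n) ℝ} {α : E n → Fin n → ℝ} {W : Set (E n)}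
  {L : E m → E n} {U : Set (E m)}

/-- The divergence of a covector field in coordinates. -/
def divCoord (G : E n → Matrix (Fin n) (Fin n) ℝ) (α : E n → Fin n → ℝ) (z : E n) : ℝ :=
  (√(G z).det)⁻¹ * ∑ i, pd i (fun y => √(G y).det * ∑ j, (G y)⁻¹ i j * α y j) z

/-- The covariant derivative `∇ᵢ αⱼ`. -/
def covD₁ (G : E n → Matrix (Fin n) (Fin n) ℝ) (α : E n → Fin n → ℝ) (z : E n) :
    Matrix (Fin n) (Fin n) ℝ :=
  Matrix.of fun i j => pd i (fun y => α y j) z - ∑ k, christoffel G k i j z * α z k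

/-- The pull-back of a covector field. -/
def pullCov (L : E m → E n) (α : E n → Fin n → ℝ) (y : E m) : Fin m → ℝ :=
  (jac L y)ᵀ *ᵥ α (L y)

lemma pullCov_apply (y : E m) (a : Fin m) :
    pullCov L α y a = ∑ j, α (L y) j * tangent L a y j :=
  (Finset.sum_congr rfl fun j _ => mul_comm (jac L y j a) (α (L y) j) :
    ∑ j, jac L y j a * α (L y) j = ∑ j, α (L y) j * jac L y j a)

/-- Jacobi's formula for the derivative of a determinant. -/
lemma pd_det {A : E m → Matrix (Fin n) (Fin n) ℝ} {y : E m}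
    (hA : ∀ i j, DifferentiableAt ℝ (fun z => A z i j) y) (i : Fin m) :
    pd i (fun z => (A z).det) y =
      ∑ k, ∑ l, (A y).adjugate k l * pd i (fun z => A z l k) y := by
  have h1 : ∀ k, ∑ l, (A y).adjugate k l * pd i (fun z => A z l k) y =
      ((A y).updateCol k fun l => pd i (fun z => A z l k) y).det := fun k => by
    rw [← Matrix.cramer_apply, Matrix.cramer_eq_adjugate_mulVec]
    rfl
  simp only [h1, Matrix.det_apply']
  have hp : ∀ σ : Equiv.Perm (Fin n), DifferentiableAt ℝ (fun z => ∏ k, A z (σ k) k) y :=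
    fun σ => (HasFDerivAt.finsetProd fun k _ => (hA (σ k) k).hasFDerivAt).differentiableAt
  rw [pd_sum fun σ _ => (differentiableAt_const _).fun_mul (hp σ), Finset.sum_comm]
  refine Finset.sum_congr rfl fun σ _ => ?_
  rw [pd_const_mul _ (hp σ), ← Finset.mul_sum]
  congr 1
  simp only [pd]
  rw [(HasFDerivAt.finsetProd fun k _ => (hA (σ k) k).hasFDerivAt).fderiv, sum_apply]
  refine Finset.sum_congr rfl fun k _ => ?_
  rw [← Finset.mul_prod_erase _ _ (Finset.mem_univ k), Matrix.updateCol_self, smul_apply,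
    smul_eq_mul, mul_comm]
  congr 1
  exact Finset.prod_congr rfl fun j hj => by rw [Matrix.updateCol_ne (Finset.ne_of_mem_erase hj)]

/-- The other two terms of the Christoffel symbol form an antisymmetric expression, killed by the
symmetric inverse metric. -/
lemma sum_christoffel_self (hG : LocalMetric G W) {z : E n} (hz : z ∈ W) (i : Fin n) :
    ∑ k, christoffel G k i k z = (1 / 2) * frob (G z)⁻¹ (pdm G z i) := by
  have h : ∀ k l, chr1 G z l i k = (1 / 2) * pdm G z i k l
      + (1 / 2) * (pd k (fun x => G x i l) z - pd l (fun x => G x i k) z) := fun k l => by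
    simp only [chr1, pdm, Matrix.of_apply]
    ring
  have h2 : ∑ k, ∑ l, (G z)⁻¹ k l * pd k (fun x => G x i l) z =
      ∑ k, ∑ l, (G z)⁻¹ k l * pd l (fun x => G x i k) z := by
    rw [Finset.sum_comm]
    exact Finset.sum_congr rfl fun k _ => Finset.sum_congr rfl fun l _ => by
      rw [(hG.inv_symm hz).apply]
  simp only [christoffel_eq, h, mul_add, mul_sub, Finset.sum_add_distrib, Finset.sum_sub_distrib]
  simp only [mul_left_comm _ (1 / 2 : ℝ), ← Finset.mul_sum, h2, frob, sub_self, add_zero]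

lemma LocalMetric.sqrt_det_pos (hG : LocalMetric G W) {z : E n} (hz : z ∈ W) :
    0 < √(G z).det := Real.sqrt_pos.2 (hG.posDef z hz).det_pos

lemma LocalMetric.contDiffOn_sqrt_det (hG : LocalMetric G W) :
    ContDiffOn ℝ ∞ (fun z => √(G z).det) W :=
  (contDiffOn_det hG.smooth).sqrt fun z hz => (hG.posDef z hz).det_pos.ne'

lemma pd_sqrt_det (hG : LocalMetric G W) {z : E n} (hz : z ∈ W) (i : Fin n) :
    pd i (fun z => √(G z).det) z = √(G z).det * ∑ k, christoffel G k i k z := by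
  have hd := differentiableAt_of_contDiffOn hG.isOpen (contDiffOn_det hG.smooth) hz
  have hpos := (hG.posDef z hz).det_pos
  have h1 : pd i (fun z => √(G z).det) z = 1 / (2 * √(G z).det) * pd i (fun z => (G z).det) z := by
    simp only [pd, (hd.hasFDerivAt.sqrt hpos.ne').fderiv, smul_apply, smul_eq_mul]
  have h2 : pd i (fun z => (G z).det) z = (G z).det * frob (G z)⁻¹ (pdm G z i) := by
    rw [pd_det fun i j => differentiableAt_of_contDiffOn hG.isOpen (hG.smooth i j) hz]
    simp only [frob, Matrix.inv_def, Ring.inverse_eq_inv', Matrix.smul_apply, smul_eq_mul, pdm,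
      Matrix.of_apply, Finset.mul_sum]
    refine Finset.sum_congr rfl fun k _ => Finset.sum_congr rfl fun l _ => ?_
    rw [pd_congr (u := fun z => G z l k) (v := fun z => G z k l)
      (Filter.eventually_of_mem (hG.isOpen.mem_nhds hz) fun x hx => (hG.symm hx).apply k l)]
    field_simp
  rw [h1, h2, sum_christoffel_self hG hz]
  nth_rw 2 [← Real.mul_self_sqrt hpos.le]
  have := (hG.sqrt_det_pos hz).ne'
  field_simp

/-- Obtained by differentiating `G⁻¹ G = 1` and multiplying by `G⁻¹` on the right. -/
lemma pd_inv (hG : LocalMetric G W) {z : E n} (hz : z ∈ W) (c i j : Fin n) :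
    pd c (fun y => (G y)⁻¹ i j) z =
      -∑ l, ∑ k, (G z)⁻¹ i l * pdm G z c l k * (G z)⁻¹ k j := by
  have hd := fun i j => differentiableAt_of_contDiffOn hG.isOpen (hG.smooth i j) hz
  have hi := fun i j => differentiableAt_of_contDiffOn hG.isOpen (hG.contDiffOn_inv i j) hz
  set X : Matrix (Fin n) (Fin n) ℝ := Matrix.of fun i j => pd c (fun y => (G y)⁻¹ i j) z
  have h1 : X * G z + (G z)⁻¹ * pdm G z c = 0 := by
    ext i j
    have h2 : pd c (fun y => ∑ l, (G y)⁻¹ i l * G y l j) z = 0 := by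
      rw [pd_congr (v := fun _ => (1 : Matrix (Fin n) (Fin n) ℝ) i j), pd_const]
      exact Filter.eventually_of_mem (hG.isOpen.mem_nhds hz) fun x hx => by
        rw [← Matrix.nonsing_inv_mul _ (hG.isUnit_det hx), Matrix.mul_apply]
    rw [pd_sum fun l _ => (hi i l).fun_mul (hd l j)] at h2
    simp only [fun l => pd_mul (hi i l) (hd l j) (i := c), Finset.sum_add_distrib] at h2
    exact h2
  have h3 : X = -((G z)⁻¹ * pdm G z c * (G z)⁻¹) := by
    have := congrArg (· * (G z)⁻¹) h1
    simp only [add_mul, zero_mul, Matrix.mul_assoc X, Matrix.mul_nonsing_inv _ (hG.isUnit_det hz),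
      Matrix.mul_one] at this
    exact eq_neg_of_add_eq_zero_left this
  have h4 := congrFun (congrFun h3 i) j
  rw [Matrix.neg_apply, Matrix.mul_apply] at h4
  simp only [Matrix.mul_apply, Finset.sum_mul] at h4
  rw [Finset.sum_comm]
  exact h4

/-- The divergence is the trace of the covariant derivative. -/
lemma divCoord_eq (hG : LocalMetric G W) {z : E n} (hz : z ∈ W)
    (hα : ∀ j, DifferentiableAt ℝ (fun y => α y j) z) :
    divCoord G α z = frob (G z)⁻¹ (covD₁ G α z) := by
  have hi := fun i j => differentiableAt_of_contDiffOn hG.isOpen (hG.contDiffOn_inv i j) hz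
  have hs := differentiableAt_of_contDiffOn hG.isOpen hG.contDiffOn_sqrt_det hz
  have hsum : ∀ i, DifferentiableAt ℝ (fun y => ∑ j, (G y)⁻¹ i j * α y j) z := fun i =>
    DifferentiableAt.fun_sum fun j _ => (hi i j).fun_mul (hα j)
  have h1 : ∀ i, pd i (fun y => ∑ j, (G y)⁻¹ i j * α y j) z =
      ∑ j, (pd i (fun y => (G y)⁻¹ i j) z * α z j + (G z)⁻¹ i j * pd i (fun y => α y j) z) :=
    fun i => by
    rw [pd_sum fun j _ => (hi i j).fun_mul (hα j)]
    exact Finset.sum_congr rfl fun j _ => pd_mul (hi i j) (hα j)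
  -- This is `∂ᵢ g^{ij} = -g^{ij} Γᵏᵢₖ - g^{il} Γʲᵢₗ`. Its first part cancels the derivative of the
  -- volume density; its second part turns `∂α` into `∇α`.
  have h2 : ∀ j, ∑ i, pd i (fun y => (G y)⁻¹ i j) z =
      -(∑ i, (G z)⁻¹ i j * ∑ k, christoffel G k i k z)
        - ∑ i, ∑ l, (G z)⁻¹ i l * christoffel G j i l z := fun j => by
    have e1 : ∑ i, (G z)⁻¹ i j * ∑ k, christoffel G k i k z =
        ∑ i, ∑ l, ∑ k, (G z)⁻¹ i l * chr1 G z l i k * (G z)⁻¹ k j := by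
      simp only [christoffel_eq, Finset.mul_sum]
      rw [Finset.sum_comm]
      refine Finset.sum_congr rfl fun i _ => ?_
      rw [Finset.sum_comm]
      exact Finset.sum_congr rfl fun l _ => Finset.sum_congr rfl fun k _ => by
        rw [(chr1_comm hG hz l).apply i k]; ring
    have e2 : ∑ i, ∑ l, (G z)⁻¹ i l * christoffel G j i l z =
        ∑ i, ∑ l, ∑ k, (G z)⁻¹ i l * chr1 G z k i l * (G z)⁻¹ k j := by
      simp only [christoffel_eq, Finset.mul_sum]
      exact Finset.sum_congr rfl fun i _ => Finset.sum_congr rfl fun l _ =>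
        Finset.sum_congr rfl fun k _ => by rw [(hG.inv_symm hz).apply k j]; ring
    have e3 : ∀ c l k, pdm G z c l k = chr1 G z l c k + chr1 G z k c l := fun c l k =>
      chr1_add_chr1 hG hz l c k
    simp only [pd_inv hG hz, e3, mul_add, add_mul, Finset.sum_add_distrib, Finset.sum_neg_distrib]
    rw [e1, e2]
    ring
  have hpos := (hG.sqrt_det_pos hz).ne'
  simp only [divCoord, fun i => pd_mul hs (hsum i) (i := i), pd_sqrt_det hG hz, h1]
  have h3 : ∑ i, ∑ j, pd i (fun y => (G y)⁻¹ i j) z * α z j =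
      -(∑ i, (∑ k, christoffel G k i k z) * ∑ j, (G z)⁻¹ i j * α z j)
        - ∑ i, ∑ j, (G z)⁻¹ i j * ∑ k, christoffel G k i j z * α z k := by
    rw [Finset.sum_comm]
    simp only [← Finset.sum_mul, h2, sub_mul, neg_mul, Finset.sum_sub_distrib,
      Finset.sum_neg_distrib]
    congr 1
    · congr 1
      simp only [Finset.mul_sum, Finset.sum_mul]
      rw [Finset.sum_comm]
      exact Finset.sum_congr rfl fun i _ => Finset.sum_congr rfl fun j _ =>
        Finset.sum_congr rfl fun k _ => by ring
    · simp only [Finset.mul_sum, Finset.sum_mul]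
      rw [Finset.sum_comm]
      refine Finset.sum_congr rfl fun i _ => ?_
      rw [Finset.sum_comm]
      exact Finset.sum_congr rfl fun j _ => Finset.sum_congr rfl fun k _ => by ring
  have h4 : frob (G z)⁻¹ (covD₁ G α z) = ∑ i, ∑ j, (G z)⁻¹ i j * pd i (fun y => α y j) z
      - ∑ i, ∑ j, (G z)⁻¹ i j * ∑ k, christoffel G k i j z * α z k := by
    simp only [frob, covD₁, Matrix.of_apply, mul_sub, Finset.sum_sub_distrib]
  simp only [mul_assoc, ← mul_add, ← Finset.mul_sum, inv_mul_cancel_left₀ hpos]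
  simp only [Finset.sum_add_distrib, h3, h4]
  ring

lemma divCoord_mul (hG : LocalMetric G W) {z : E n} (hz : z ∈ W) {u : E n → ℝ}
    (hu : DifferentiableAt ℝ u z) (hα : ∀ j, DifferentiableAt ℝ (fun y => α y j) z) :
    divCoord G (fun y j => u y * α y j) z =
      u z * divCoord G α z + coinner (G z) (fun i => pd i u z) (α z) := by
  rw [divCoord_eq hG hz hα, divCoord_eq hG hz fun j => hu.fun_mul (hα j), coinner_eq_bil]
  simp only [frob, bil, covD₁, Matrix.of_apply, pd_mul hu (hα _), Finset.mul_sum,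
    ← Finset.sum_add_distrib]
  refine Finset.sum_congr rfl fun i _ => Finset.sum_congr rfl fun j _ => ?_
  simp only [mul_left_comm _ (u z), ← Finset.mul_sum]
  ring

lemma divCoord_add (hG : LocalMetric G W) {z : E n} (hz : z ∈ W) {β : E n → Fin n → ℝ}
    (hα : ∀ j, DifferentiableAt ℝ (fun y => α y j) z)
    (hβ : ∀ j, DifferentiableAt ℝ (fun y => β y j) z) :
    divCoord G (fun y j => α y j + β y j) z = divCoord G α z + divCoord G β z := by
  rw [divCoord_eq hG hz hα, divCoord_eq hG hz hβ,
    divCoord_eq hG hz fun j => (hα j).fun_add (hβ j)]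
  simp only [frob, covD₁, Matrix.of_apply, pd_add (hα _) (hβ _), ← Finset.sum_add_distrib, mul_add]
  refine Finset.sum_congr rfl fun i _ => Finset.sum_congr rfl fun j _ => ?_
  simp only [Finset.sum_add_distrib]
  ring

/-- The argument passes through the trace of `∇α`, which is tensorial. The density formula would
require differentiating a Jacobian determinant. -/
lemma InvSplit.divCoord_pull (hG : LocalMetric G W) (hL : LocalMap L U W)
    (hg : LocalMetric (pull L G) U)
    (hα : ∀ j, ContDiffOn ℝ ∞ (fun y => α y j) W) {y : E m} (hy : y ∈ U)
    (h : InvSplit G L 0 y) :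
    divCoord (pull L G) (pullCov L α) y = divCoord G α (L y) := by
  have hLy := differentiableAt_of_contDiffOn hL.isOpen hL.smooth hy
  have hd := fun j => differentiableAt_of_contDiffOn hG.isOpen (hα j) (hL.mapsTo hy)
  have hdL : ∀ j, DifferentiableAt ℝ (fun y => α (L y) j) y := fun j => (hd j).comp y hLy
  have ht := fun a i => differentiableAt_of_contDiffOn hL.isOpen (hL.contDiffOn_tangent a i) hy
  have hp : ∀ a, DifferentiableAt ℝ (fun y => pullCov L α y a) y := fun a => by
    simp only [pullCov_apply]
    exact DifferentiableAt.fun_sum fun j _ => (hdL j).fun_mul (ht a j)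
  have h1 : covD₁ (pull L G) (pullCov L α) y = (jac L y)ᵀ * covD₁ G α (L y) * jac L y := by
    ext a b
    have e1 : pd a (fun y => pullCov L α y b) y =
        ∑ j, ∑ i, pd i (fun z => α z j) (L y) * tangent L a y i * tangent L b y j
          + ∑ j, α (L y) j * hess L a b y j := by
      simp only [pullCov_apply]
      rw [pd_sum fun j _ => (hdL j).fun_mul (ht b j)]
      simp only [fun j => pd_mul (hdL j) (ht b j) (i := a), Finset.sum_add_distrib]
      congr 1
      refine Finset.sum_congr rfl fun j _ => ?_
      rw [pd_comp (hd j) hLy, Finset.sum_mul]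
      rfl
    have e2 : ∑ c, christoffel (pull L G) c a b y * pullCov L α y c =
        ∑ j, α (L y) j * (hess L a b y j + chrVec G (L y) (tangent L a y) (tangent L b y) j) := by
      have := h.accel_eq hG hL hy a b
      rw [accel] at this
      simp only [pullCov_apply, ← Pi.add_apply, this, Matrix.mulVec, dotProduct, Finset.mul_sum]
      rw [Finset.sum_comm]
      exact Finset.sum_congr rfl fun j _ => Finset.sum_congr rfl fun c _ => by
        simp only [jac, Matrix.of_apply]; ring
    rw [mul_mul_apply_eq_bil]
    change _ = bil _ (tangent L a y) (tangent L b y)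
    simp only [covD₁, Matrix.of_apply, e1, e2, bil, mul_add, Finset.sum_add_distrib, sub_mul,
      Finset.sum_sub_distrib, ← sum_christoffel, Finset.mul_sum, Finset.sum_mul]
    rw [Finset.sum_comm (f := fun j i => pd i (fun z => α z j) (L y) * _ * _),
      Finset.sum_comm (f := fun j i => ∑ k, α (L y) j * _)]
    have e3 : ∑ i, ∑ j, ∑ k, α (L y) j * (christoffel G j i k (L y) * tangent L a y i *
        tangent L b y k) = ∑ i, ∑ j, ∑ k, christoffel G k i j (L y) * α (L y) k *
          tangent L a y i * tangent L b y j := Finset.sum_congr rfl fun i _ => by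
      rw [Finset.sum_comm]
      exact Finset.sum_congr rfl fun j _ => Finset.sum_congr rfl fun k _ => by ring
    rw [e3]
    ring
  rw [divCoord_eq hg hy hp, divCoord_eq hG (hL.mapsTo hy) hd, h1, frob_mul_mul, ← h.eq]

end Divergence

/-! ### Dependence on germs -/

section Germs

open Filter

variable {m n : ℕ} {G G' T T' : E n → Matrix (Fin n) (Fin n) ℝ} {α α' : E n → Fin n → ℝ} {z : E n}

lemma pd_eventuallyEq {u v : E n → ℝ} (h : u =ᶠ[nhds z] v) (i : Fin n) :
    pd i u =ᶠ[nhds z] pd i v :=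
  h.eventuallyEq_nhds.mono fun _ hx => pd_congr hx

/-- Equality near the point, not merely at it, has to be propagated because curvature differentiates
the symbols once more. -/
lemma christoffel_congr (h : G =ᶠ[nhds z] G') (k i j : Fin n) :
    christoffel G k i j =ᶠ[nhds z] christoffel G' k i j := by
  have hp : ∀ i a b, pd i (fun z => G z a b) =ᶠ[nhds z] pd i (fun z => G' z a b) := fun i a b =>
    pd_eventuallyEq (h.mono fun x hx => by simp only [hx]) i
  have h3 : ∀ᶠ x in nhds z, ∀ i a b, pd i (fun z => G z a b) x = pd i (fun z => G' z a b) x := by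
    simp only [eventually_all]
    exact hp
  filter_upwards [h, h3] with x h1 h2
  simp only [christoffel, h1, h2]

lemma scalCoord_congr (h : G =ᶠ[nhds z] G') : scalCoord G z = scalCoord G' z := by
  have h2 := fun i k a b => pd_congr (i := i) (christoffel_congr h k a b)
  have h3 := fun k a b => (christoffel_congr h k a b).eq_of_nhds
  simp only [scalCoord, traceOf, ricciCoord, riemannCoord, h2, h3, h.eq_of_nhds]

lemma divCoord₂_congr (h : G =ᶠ[nhds z] G') (hT : T =ᶠ[nhds z] T') :
    divCoord₂ G T z = divCoord₂ G' T' z := by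
  have h2 : ∀ i a b, pd i (fun z => T z a b) z = pd i (fun z => T' z a b) z := fun i a b =>
    pd_congr (hT.mono fun x hx => by simp only [hx])
  have h3 := fun k a b => (christoffel_congr h k a b).eq_of_nhds
  ext j
  simp only [divCoord₂, covDerivCoord, h2, h3, h.eq_of_nhds, hT.eq_of_nhds]

lemma divCoord_congr (h : G =ᶠ[nhds z] G') (hα : α =ᶠ[nhds z] α') :
    divCoord G α z = divCoord G' α' z := by
  have h2 : ∀ i, pd i (fun y => √(G y).det * ∑ j, (G y)⁻¹ i j * α y j) z =
      pd i (fun y => √(G' y).det * ∑ j, (G' y)⁻¹ i j * α' y j) z := fun i =>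
    pd_congr ((h.and hα).mono fun x hx => by simp only [hx.1, hx.2])
  simp only [divCoord, h2, h.eq_of_nhds]

lemma normalAccel_congr {L L' : E m → E n} {y : E m} (h : L =ᶠ[nhds y] L') (ν : Fin n → ℝ) :
    normalAccel G L ν y = normalAccel G L' ν y := by
  have h1 : ∀ b i, (fun x => tangent L b x i) =ᶠ[nhds y] fun x => tangent L' b x i := fun b i =>
    pd_eventuallyEq (h.mono fun x hx => by simp only [hx]) b
  have h2 : ∀ b, tangent L b y = tangent L' b y := fun b => funext fun i => (h1 b i).eq_of_nhds
  have h3 : ∀ a b, hess L a b y = hess L' a b y := fun a b => funext fun i => pd_congr (h1 b i)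
  ext a b
  simp only [normalAccel, accel, Matrix.of_apply, h2, h3, h.eq_of_nhds]

end Germs

/-! ### Charts -/

section Charts

variable {m n : ℕ} {N : Type*} [TopologicalSpace N] [ChartedSpace (E m) N]
  {M : Type*} [TopologicalSpace M] [ChartedSpace (E n) M]

/-- The expression of a map in the charts around `x` and `q`. -/
def rep (m n : ℕ) {N : Type*} [TopologicalSpace N] [ChartedSpace (E m) N]
    {M : Type*} [TopologicalSpace M] [ChartedSpace (E n) M] (F : N → M) (x : N) (q : M) (y : E m) : E n :=
  extChartAt (𝓡 n) q (F ((extChartAt (𝓡 m) x).symm y))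

/-- The domain of the expression of a map in the charts around `x` and `q`. -/
def repDom (m n : ℕ) {N : Type*} [TopologicalSpace N] [ChartedSpace (E m) N]
    {M : Type*} [TopologicalSpace M] [ChartedSpace (E n) M] (F : N → M) (x : N) (q : M) : Set (E m) :=
  (extChartAt (𝓡 m) x).target ∩
    (extChartAt (𝓡 m) x).symm ⁻¹' (F ⁻¹' (extChartAt (𝓡 n) q).source)

lemma isOpen_repDom {F : N → M} (hF : Continuous F) (x : N) (q : M) : IsOpen (repDom m n F x q) :=
  (continuousOn_extChartAt_symm x).isOpen_inter_preimage (isOpen_extChartAt_target x)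
    ((isOpen_extChartAt_source q).preimage hF)

lemma center_mem_target (x : N) : (center x : E m) ∈ (extChartAt (𝓡 m) x).target :=
  mem_extChartAt_target x

lemma symm_center (x : N) : (extChartAt (𝓡 m) x).symm (center x : E m) = x := extChartAt_to_inv x

lemma center_mem_repDom {F : N → M} {x : N} {q : M} (hx : F x ∈ (extChartAt (𝓡 n) q).source) :
    center x ∈ repDom m n F x q :=
  ⟨center_mem_target x, by rwa [Set.mem_preimage, Set.mem_preimage, symm_center]⟩

lemma rep_center (F : N → M) (x : N) (q : M) :
    rep m n F x q (center x) = extChartAt (𝓡 n) q (F x) := by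
  rw [rep, symm_center]

lemma symm_rep {F : N → M} {x : N} {q : M} {y : E m} (hy : y ∈ repDom m n F x q) :
    (extChartAt (𝓡 n) q).symm (rep m n F x q y) = F ((extChartAt (𝓡 m) x).symm y) :=
  (extChartAt (𝓡 n) q).left_inv hy.2

lemma sum_smul_coordVec (p : N) (y : E m) (c : Fin m → ℝ) :
    mfderiv (𝓡 m) (𝓡 m) (extChartAt (𝓡 m) p).symm y (WithLp.toLp 2 c : E m) =
      ∑ i, c i • coordVec p y i := by
  have := sum_smul_stdVec (WithLp.toLp 2 c : E m)
  conv_lhs => rw [← this]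
  simp only [coordVec]
  exact (map_sum _ _ _).trans (Finset.sum_congr rfl fun i _ => map_smul _ _ _)

lemma fderiv_stdVec {L : E m → E n} {y : E m} (hL : DifferentiableAt ℝ L y) (a : Fin m) :
    fderiv ℝ L y (stdVec a) = WithLp.toLp 2 (tangent L a y) := by
  ext i
  exact (pd_apply_eq hL a i).symm

variable [IsManifold (𝓡 m) ∞ N] [IsManifold (𝓡 n) ∞ M]

lemma localMap_rep {F : N → M} (hF : ContMDiff (𝓡 m) (𝓡 n) ∞ F) (x : N) (q : M) :
    LocalMap (rep m n F x q) (repDom m n F x q) (extChartAt (𝓡 n) q).target where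
  isOpen := isOpen_repDom hF.continuous x q
  smooth := (contMDiff_iff.1 hF).2 x q
  mapsTo := fun _ hy => (extChartAt (𝓡 n) q).map_source hy.2

lemma contMDiffAt_symm (p : N) {y : E m} (hy : y ∈ (extChartAt (𝓡 m) p).target) :
    ContMDiffAt (𝓡 m) (𝓡 m) ∞ (extChartAt (𝓡 m) p).symm y :=
  (contMDiffOn_extChartAt_symm p).contMDiffAt ((isOpen_extChartAt_target p).mem_nhds hy)

lemma mdifferentiableAt_symm (p : N) {y : E m} (hy : y ∈ (extChartAt (𝓡 m) p).target) :
    MDifferentiableAt (𝓡 m) (𝓡 m) (extChartAt (𝓡 m) p).symm y :=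
  (contMDiffAt_symm p hy).mdifferentiableAt (by simp)

lemma mfderiv_coordVec {F : N → M} (hF : ContMDiff (𝓡 m) (𝓡 n) ∞ F) {x : N} {q : M} {y : E m}
    (hy : y ∈ repDom m n F x q) (a : Fin m) :
    (mfderiv (𝓡 m) (𝓡 n) F ((extChartAt (𝓡 m) x).symm y) (coordVec x y a) : E n) =
      ∑ i, tangent (rep m n F x q) a y i • (coordVec q (rep m n F x q y) i : E n) := by
  have hL := localMap_rep hF x q
  -- Both sides express `F` in the source chart, the right one through the target chart as well; the
  -- chain rule applied to each gives the claim.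
  have h1 : F ∘ (extChartAt (𝓡 m) x).symm =ᶠ[nhds y] (extChartAt (𝓡 n) q).symm ∘ rep m n F x q :=
    Filter.eventually_of_mem (hL.isOpen.mem_nhds hy) fun z hz => (symm_rep hz).symm
  have h2 := h1.mfderiv_eq (I := 𝓡 m) (I' := 𝓡 n)
  have hd : DifferentiableAt ℝ (rep m n F x q) y := differentiableAt_of_contDiffOn hL.isOpen hL.smooth hy
  rw [mfderiv_comp y ((hF _).mdifferentiableAt (by simp)) (mdifferentiableAt_symm x hy.1),
    mfderiv_comp y (mdifferentiableAt_symm q (hL.mapsTo hy)) hd.mdifferentiableAt] at h2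
  have h3 := DFunLike.congr_fun h2 (stdVec a)
  rw [mfderiv_eq_fderiv] at h3
  refine Eq.trans h3 (Eq.trans ?_ (sum_smul_coordVec q (rep m n F x q y) _))
  exact congrArg (mfderiv (𝓡 n) (𝓡 n) (extChartAt (𝓡 n) q).symm (rep m n F x q y))
    (fderiv_stdVec hd a)

lemma mfderiv_symm_injective (p : N) {y : E m} (hy : y ∈ (extChartAt (𝓡 m) p).target) :
    Function.Injective (mfderiv (𝓡 m) (𝓡 m) (extChartAt (𝓡 m) p).symm y) := by
  have : IsManifold (𝓡 m) 1 N := IsManifold.of_le (n := ∞) (by simp)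
  have h := isInvertible_mfderivWithin_extChartAt_symm (I := 𝓡 m) hy
  rw [ModelWithCorners.range_eq_univ, mfderivWithin_univ] at h
  exact h.injective

end Charts

/-! ### Smooth tensor fields -/

section TensorFields

variable {m n : ℕ} {N : Type*} [TopologicalSpace N] [ChartedSpace (E m) N]
  {M : Type*} [TopologicalSpace M] [ChartedSpace (E n) M]

/-- A field of bilinear forms with smooth coefficients. -/
structure SmoothBilin (T : BilinField m N) : Prop where
  linear : ∃ B : ∀ x : N, TangentSpace (𝓡 m) x →ₗ[ℝ] TangentSpace (𝓡 m) x →ₗ[ℝ] ℝ,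
    ∀ x v w, T x v w = B x v w
  smooth : ∀ p i j, ContDiffOn ℝ ∞ (fun y => coeff T p y i j) (extChartAt (𝓡 m) p).target

/-- A smooth Riemannian metric. -/
structure SmoothMetric (g : BilinField m N) : Prop extends SmoothBilin g where
  symm : ∀ x v w, g x v w = g x w v
  pos : ∀ x v, v ≠ 0 → 0 < g x v v

/-- A field of covectors with smooth coefficients. -/
structure SmoothCov (α : CovectorField m N) : Prop where
  linear : ∃ A : ∀ x : N, TangentSpace (𝓡 m) x →ₗ[ℝ] ℝ, ∀ x v, α x v = A x v
  smooth : ∀ p i, ContDiffOn ℝ ∞ (fun y => coeffCov α p y i) (extChartAt (𝓡 m) p).target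

/-- A function with smooth coordinate expressions. -/
def SmoothFn (m : ℕ) {N : Type*} [TopologicalSpace N] [ChartedSpace (E m) N] (u : N → ℝ) : Prop :=
  ∀ p : N, ContDiffOn ℝ ∞ (fun y => u ((extChartAt (𝓡 m) p).symm y)) (extChartAt (𝓡 m) p).target

/-- The pull-back of a field of bilinear forms. -/
def pullbackField (F : N → M) (T : BilinField n M) : BilinField m N :=
  fun x v w => T (F x) (mfderiv (𝓡 m) (𝓡 n) F x v) (mfderiv (𝓡 m) (𝓡 n) F x w)

/-- All tangent spaces are definitionally the model space. Typing the sums in `E m` and keeping the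
equality of base points as a hypothesis allows comparison at equal points without transport. -/
lemma bilin_coordVec {T : BilinField m N}
    (hT : ∃ B : ∀ x : N, TangentSpace (𝓡 m) x →ₗ[ℝ] TangentSpace (𝓡 m) x →ₗ[ℝ] ℝ,
      ∀ x v w, T x v w = B x v w) {p : N} {y : E m} {z : N}
    (hz : (extChartAt (𝓡 m) p).symm y = z) (u v : Fin m → ℝ) :
    T z (∑ i, u i • (coordVec p y i : E m) : E m) (∑ i, v i • (coordVec p y i : E m) : E m) =
      bil (coeff T p y) u v := by
  obtain ⟨B, hB⟩ := hT
  subst hz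
  have h1 : ∀ u : Fin m → ℝ, (∑ i, u i • (coordVec p y i : E m) : E m) =
      (∑ i, u i • coordVec p y i : TangentSpace (𝓡 m) ((extChartAt (𝓡 m) p).symm y)) :=
    fun u => rfl
  rw [h1, h1, hB, LinearMap.map_sum₂]
  refine Finset.sum_congr rfl fun i _ => ?_
  rw [map_sum]
  refine Finset.sum_congr rfl fun j _ => ?_
  rw [LinearMap.map_smul₂, map_smul, ← hB, smul_eq_mul, smul_eq_mul]
  simp only [coeff, Matrix.of_apply]
  ring

lemma cov_coordVec {α : CovectorField m N}
    (hα : ∃ A : ∀ x : N, TangentSpace (𝓡 m) x →ₗ[ℝ] ℝ, ∀ x v, α x v = A x v) {p : N} {y : E m}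
    {z : N} (hz : (extChartAt (𝓡 m) p).symm y = z) (u : Fin m → ℝ) :
    α z (∑ i, u i • (coordVec p y i : E m) : E m) = ∑ i, coeffCov α p y i * u i := by
  obtain ⟨A, hA⟩ := hα
  subst hz
  have h1 : (∑ i, u i • (coordVec p y i : E m) : E m) =
      (∑ i, u i • coordVec p y i : TangentSpace (𝓡 m) ((extChartAt (𝓡 m) p).symm y)) := rfl
  rw [h1, hA, map_sum]
  refine Finset.sum_congr rfl fun i _ => ?_
  rw [map_smul, ← hA, smul_eq_mul, mul_comm]
  rfl

lemma pullbackField_id (T : BilinField m N) : pullbackField id T = T := by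
  ext x v w
  simp only [pullbackField, mfderiv_id]
  rfl

variable [IsManifold (𝓡 m) ∞ N] [IsManifold (𝓡 n) ∞ M]

lemma coeff_pullbackField {T : BilinField n M}
    (hT : ∃ B : ∀ x : M, TangentSpace (𝓡 n) x →ₗ[ℝ] TangentSpace (𝓡 n) x →ₗ[ℝ] ℝ,
      ∀ x v w, T x v w = B x v w) {F : N → M} (hF : ContMDiff (𝓡 m) (𝓡 n) ∞ F) {x : N} {q : M}
    {y : E m} (hy : y ∈ repDom m n F x q) :
    coeff (pullbackField F T) x y = pull (rep m n F x q) (coeff T q) y := by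
  ext a b
  rw [pull_apply]
  exact (congrArg₂ (T (F _)) (mfderiv_coordVec hF hy a) (mfderiv_coordVec hF hy b)).trans
    (bilin_coordVec hT (symm_rep hy) _ _)

/-- A change of charts is the coordinate expression of the identity map, so transformation laws are
instances of pull-back laws. -/
lemma coeff_eq_pull {T : BilinField m N} (hT : SmoothBilin T) {x p : N} {y : E m}
    (hy : y ∈ repDom m m id x p) : coeff T x y = pull (rep m m id x p) (coeff T p) y := by
  rw [← coeff_pullbackField hT.linear contMDiff_id hy, pullbackField_id]

lemma coeffCov_eq_pullCov {α : CovectorField m N} (hα : SmoothCov α) {x p : N} {y : E m}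
    (hy : y ∈ repDom m m id x p) :
    coeffCov α x y = pullCov (rep m m id x p) (coeffCov α p) y := by
  ext a
  rw [pullCov_apply]
  have h := mfderiv_coordVec contMDiff_id hy a
  rw [mfderiv_id] at h
  exact (congrArg (α _) h).trans (cov_coordVec hα.linear (symm_rep hy) _)

lemma SmoothMetric.localMetric {g : BilinField m N} (hg : SmoothMetric g) (p : N) :
    LocalMetric (coeff g p) (extChartAt (𝓡 m) p).target where
  isOpen := isOpen_extChartAt_target p
  smooth := hg.smooth p
  posDef := fun y hy => by
    rw [Matrix.posDef_iff_dotProduct_mulVec]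
    refine ⟨?_, fun c hc => ?_⟩
    · ext i j
      simp only [Matrix.conjTranspose_apply, star_trivial, coeff, Matrix.of_apply]
      exact hg.symm _ _ _
    · rw [star_trivial, ← bil_eq_dot, ← bilin_coordVec hg.linear rfl]
      refine hg.pos _ _ fun h0 => hc ?_
      have h1 := sum_smul_coordVec p y c
      have h2 : mfderiv (𝓡 m) (𝓡 m) (extChartAt (𝓡 m) p).symm y (WithLp.toLp 2 c : E m) = 0 :=
        h1.trans h0
      have h3 := (injective_iff_map_eq_zero _).1 (mfderiv_symm_injective p hy) _ h2
      exact (WithLp.toLp_injective 2) h3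

lemma SmoothBilin.pullbackField {T : BilinField n M} (hT : SmoothBilin T) {F : N → M}
    (hF : ContMDiff (𝓡 m) (𝓡 n) ∞ F) : SmoothBilin (pullbackField (m := m) F T) where
  linear := by
    obtain ⟨B, hB⟩ := hT.linear
    exact ⟨fun x => (B (F x)).compl₁₂ (mfderiv (𝓡 m) (𝓡 n) F x).toLinearMap
      (mfderiv (𝓡 m) (𝓡 n) F x).toLinearMap, fun x v w => hB _ _ _⟩
  smooth := fun x a b => by
    intro y hy
    -- Smoothness is local, so the target chart may be chosen around the image of the point under
    -- consideration.
    set q := F ((extChartAt (𝓡 m) x).symm y)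
    have hyD : y ∈ repDom m n F x q := ⟨hy, mem_extChartAt_source q⟩
    have hL := localMap_rep hF x q
    refine ContDiffAt.contDiffWithinAt ?_
    have h1 : ContDiffOn ℝ ∞ (fun y => pull (rep m n F x q) (coeff T q) y a b)
        (repDom m n F x q) := by
      simp only [pull_apply, bil]
      exact ContDiffOn.sum fun i _ => ContDiffOn.sum fun j _ =>
        (((hT.smooth q i j).comp hL.smooth hL.mapsTo).mul (hL.contDiffOn_tangent a i)).mul
          (hL.contDiffOn_tangent b j)
    refine (h1.contDiffAt (hL.isOpen.mem_nhds hyD)).congr_of_eventuallyEq ?_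
    exact Filter.eventually_of_mem (hL.isOpen.mem_nhds hyD) fun z hz =>
      congrFun (congrFun (coeff_pullbackField hT.linear hF hz) a) b

lemma SmoothMetric.pullbackField {g : BilinField n M} (hg : SmoothMetric g) {F : N → M}
    (hF : ContMDiff (𝓡 m) (𝓡 n) ∞ F)
    (hi : ∀ x, Function.Injective (mfderiv (𝓡 m) (𝓡 n) F x)) :
    SmoothMetric (pullbackField (m := m) F g) where
  toSmoothBilin := hg.toSmoothBilin.pullbackField hF
  symm := fun _ _ _ => hg.symm _ _ _
  pos := fun x _ hv => hg.pos _ _ fun h => hv ((injective_iff_map_eq_zero _).1 (hi x) _ h)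

/-- Change of charts is an isometry between open sets of the model space. -/
lemma SmoothMetric.localMetric_pull {g : BilinField m N} (hg : SmoothMetric g) (x p : N) :
    LocalMetric (pull (rep m m id x p) (coeff g p)) (repDom m m id x p) where
  isOpen := isOpen_repDom continuous_id x p
  smooth := fun i j => ((hg.smooth x i j).mono Set.inter_subset_left).congr fun y hy => by
    rw [coeff_eq_pull hg.toSmoothBilin hy]
  posDef := fun y hy => by
    rw [← coeff_eq_pull hg.toSmoothBilin hy]
    exact (hg.localMetric x).posDef y hy.1

/-- The Jacobian is invertible because the metric coefficients in the other chart, `Jᵀ G J`, have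
nonzero determinant. -/
lemma SmoothMetric.invSplit {g : BilinField m N} (hg : SmoothMetric g) {x p : N} {y : E m}
    (hy : y ∈ repDom m m id x p) : InvSplit (coeff g p) (rep m m id x p) 0 y := by
  refine invSplit_of_isUnit_det ?_
  have h := ((hg.localMetric_pull x p).isUnit_det hy).ne_zero
  rw [pull, Matrix.det_mul] at h
  exact (right_ne_zero_of_mul h).isUnit

end TensorFields

/-! ### Scalar invariants in an arbitrary chart -/

section ScalarInvariants

variable {m : ℕ} {N : Type*} [TopologicalSpace N] [ChartedSpace (E m) N]
  {g T : BilinField m N} {α β : CovectorField m N} {u v : N → ℝ}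

lemma center_symm_mem (p : N) {y : E m} (hy : y ∈ (extChartAt (𝓡 m) p).target) :
    (center ((extChartAt (𝓡 m) p).symm y) : E m) ∈
      repDom m m id ((extChartAt (𝓡 m) p).symm y) p :=
  center_mem_repDom ((extChartAt (𝓡 m) p).map_target hy)

lemma rep_center_symm (p : N) {y : E m} (hy : y ∈ (extChartAt (𝓡 m) p).target) :
    rep m m id ((extChartAt (𝓡 m) p).symm y) p (center ((extChartAt (𝓡 m) p).symm y)) = y := by
  rw [rep_center]
  exact (extChartAt (𝓡 m) p).right_inv hy

lemma SmoothFn.contMDiff (hu : SmoothFn m u) : ContMDiff (𝓡 m) 𝓘(ℝ, ℝ) ∞ u := fun x => by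
  have h1 : ContDiffAt ℝ ∞ (fun y => u ((extChartAt (𝓡 m) x).symm y)) (extChartAt (𝓡 m) x x) :=
    (hu x).contDiffAt (extChartAt_target_mem_nhds x)
  refine (h1.contMDiffAt.comp x contMDiffAt_extChartAt).congr_of_eventuallyEq ?_
  filter_upwards [extChartAt_source_mem_nhds (I := 𝓡 m) x] with z hz
  rw [Function.comp_apply, (extChartAt (𝓡 m) x).left_inv hz]

lemma SmoothFn.continuous (hu : SmoothFn m u) : Continuous u := hu.contMDiff.continuous

lemma SmoothCov.smul (hu : SmoothFn m u) (hα : SmoothCov α) :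
    SmoothCov (fun x w => u x * α x w) where
  linear := by
    obtain ⟨A, hA⟩ := hα.linear
    exact ⟨fun x => u x • A x, fun x w => by rw [hA]; rfl⟩
  smooth := fun p i => (hu p).mul (hα.smooth p i)

lemma SmoothCov.add (hα : SmoothCov α) (hβ : SmoothCov β) :
    SmoothCov (fun x w => α x w + β x w) where
  linear := by
    obtain ⟨A, hA⟩ := hα.linear
    obtain ⟨B, hB⟩ := hβ.linear
    exact ⟨fun x => A x + B x, fun x w => by rw [hA, hB]; rfl⟩
  smooth := fun p i => (hα.smooth p i).add (hβ.smooth p i)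

lemma SmoothBilin.sub_smul (hT : SmoothBilin T) (hg : SmoothBilin g) (hu : SmoothFn m u) :
    SmoothBilin (fun x v w => T x v w - u x * g x v w) where
  linear := by
    obtain ⟨A, hA⟩ := hT.linear
    obtain ⟨B, hB⟩ := hg.linear
    exact ⟨fun x => A x - u x • B x, fun x v w => by rw [hA, hB]; rfl⟩
  smooth := fun p i j => (hT.smooth p i j).sub ((hu p).mul (hg.smooth p i j))

variable [IsManifold (𝓡 m) ∞ N]

lemma SmoothBilin.eventuallyEq (hT : SmoothBilin T) {x p : N} {z : E m}
    (hz : z ∈ repDom m m id x p) : coeff T x =ᶠ[nhds z] pull (rep m m id x p) (coeff T p) :=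
  Filter.eventually_of_mem ((isOpen_repDom continuous_id x p).mem_nhds hz) fun _ h =>
    coeff_eq_pull hT h

lemma SmoothCov.eventuallyEq (hα : SmoothCov α) {x p : N} {z : E m}
    (hz : z ∈ repDom m m id x p) :
    coeffCov α x =ᶠ[nhds z] pullCov (rep m m id x p) (coeffCov α p) :=
  Filter.eventually_of_mem ((isOpen_repDom continuous_id x p).mem_nhds hz) fun _ h =>
    coeffCov_eq_pullCov hα h

/-- The definition uses at each point the preferred chart of that point, and preferred charts need
not vary continuously. This lemma and its analogues below rewrite the value throughout one fixed
chart, as needed for smoothness and for integration. -/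
lemma metricTrace_symm (hg : SmoothMetric g) (hT : SmoothBilin T) {p : N} {y : E m}
    (hy : y ∈ (extChartAt (𝓡 m) p).target) :
    metricTrace g T ((extChartAt (𝓡 m) p).symm y) = traceOf (coeff g p y) (coeff T p y) := by
  have hc := center_symm_mem p hy
  rw [metricTrace, coeff_eq_pull hg.toSmoothBilin hc, coeff_eq_pull hT hc,
    (hg.invSplit hc).traceOf_pull_eq, rep_center_symm p hy]

lemma metricNormSq_symm (hg : SmoothMetric g) (hT : SmoothBilin T) {p : N} {y : E m}
    (hy : y ∈ (extChartAt (𝓡 m) p).target) :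
    metricNormSq g T ((extChartAt (𝓡 m) p).symm y) = normSqOf (coeff g p y) (coeff T p y) := by
  have hc := center_symm_mem p hy
  rw [metricNormSq, coeff_eq_pull hg.toSmoothBilin hc, coeff_eq_pull hT hc,
    (hg.invSplit hc).normSqOf_pull, rep_center_symm p hy]

lemma metricCoinner_symm (hg : SmoothMetric g) (hα : SmoothCov α) (hβ : SmoothCov β) {p : N}
    {y : E m} (hy : y ∈ (extChartAt (𝓡 m) p).target) :
    metricCoinner g α β ((extChartAt (𝓡 m) p).symm y) =
      coinner (coeff g p y) (coeffCov α p y) (coeffCov β p y) := by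
  have hc := center_symm_mem p hy
  rw [metricCoinner, coeff_eq_pull hg.toSmoothBilin hc, coeffCov_eq_pullCov hα hc,
    coeffCov_eq_pullCov hβ hc, pullCov, pullCov, (hg.invSplit hc).coinner_pull,
    rep_center_symm p hy]

/-- The contracted Gauss equation with `ν = 0`: all extrinsic terms vanish and invariance of scalar
curvature remains. -/
lemma scalarCurvature_symm (hg : SmoothMetric g) {p : N} {y : E m}
    (hy : y ∈ (extChartAt (𝓡 m) p).target) :
    scalarCurvature g ((extChartAt (𝓡 m) p).symm y) = scalCoord (coeff g p) y := by
  have hc := center_symm_mem p hy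
  have h1 := scalCoord_congr (hg.toSmoothBilin.eventuallyEq hc)
  have h0 : ∀ A : Matrix (Fin m) (Fin m) ℝ, normSqOf A 0 = 0 := fun A => by simp [normSqOf]
  have h2 := scalCoord_pull (hg.localMetric p) (localMap_rep contMDiff_id _ p)
    (hg.localMetric_pull _ p) hc (hg.invSplit hc)
  have h3 : normalAccel (coeff g p) (rep m m id ((extChartAt (𝓡 m) p).symm y) p) 0
      (center ((extChartAt (𝓡 m) p).symm y)) = 0 := by
    ext a b
    simp [normalAccel, bil]
  rw [h3] at h2
  refine (h1.trans h2).trans ?_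
  rw [h0, rep_center_symm p hy]
  simp [bil, traceOf]

/-- The components of the divergence depend on the chart; only their squared norm is invariant, and
it is all that `|J|` requires. -/
lemma divTensor_symm (hg : SmoothMetric g) (hT : SmoothBilin T) {p : N} {y : E m}
    (hy : y ∈ (extChartAt (𝓡 m) p).target) :
    coinner (coeff g ((extChartAt (𝓡 m) p).symm y) (center ((extChartAt (𝓡 m) p).symm y)))
        (divTensor g T ((extChartAt (𝓡 m) p).symm y))
        (divTensor g T ((extChartAt (𝓡 m) p).symm y)) =
      coinner (coeff g p y) (divCoord₂ (coeff g p) (coeff T p) y)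
        (divCoord₂ (coeff g p) (coeff T p) y) := by
  have hc := center_symm_mem p hy
  have h1 := divCoord₂_congr (hg.toSmoothBilin.eventuallyEq hc) (hT.eventuallyEq hc)
  have h2 := (hg.invSplit hc).divCoord₂_pull (hg.localMetric p) (localMap_rep contMDiff_id _ p)
    (hT.smooth p) hc
  have h3 : divTensor g T ((extChartAt (𝓡 m) p).symm y) = _ := h1.trans h2
  rw [h3, coeff_eq_pull hg.toSmoothBilin hc, (hg.invSplit hc).coinner_pull, rep_center_symm p hy]

lemma divergence_symm (hg : SmoothMetric g) (hα : SmoothCov α) {p : N} {y : E m}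
    (hy : y ∈ (extChartAt (𝓡 m) p).target) :
    divergence g α ((extChartAt (𝓡 m) p).symm y) = divCoord (coeff g p) (coeffCov α p) y := by
  have hc := center_symm_mem p hy
  have h1 := divCoord_congr (hg.toSmoothBilin.eventuallyEq hc) (hα.eventuallyEq hc)
  have h2 := (hg.invSplit hc).divCoord_pull (hg.localMetric p) (localMap_rep contMDiff_id _ p)
    (hg.localMetric_pull _ p) (hα.smooth p) hc
  rw [rep_center_symm p hy] at h2
  exact h1.trans h2

/-! ### Smoothness -/

lemma contDiffOn_traceOf {U : Set (E m)} {A B : E m → Matrix (Fin m) (Fin m) ℝ}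
    (hA : LocalMetric A U) (hB : ∀ i j, ContDiffOn ℝ ∞ (fun z => B z i j) U) :
    ContDiffOn ℝ ∞ (fun z => traceOf (A z) (B z)) U :=
  ContDiffOn.sum fun i _ => ContDiffOn.sum fun j _ => (hA.contDiffOn_inv i j).mul (hB i j)

lemma contDiffOn_normSqOf {U : Set (E m)} {A B : E m → Matrix (Fin m) (Fin m) ℝ}
    (hA : LocalMetric A U) (hB : ∀ i j, ContDiffOn ℝ ∞ (fun z => B z i j) U) :
    ContDiffOn ℝ ∞ (fun z => normSqOf (A z) (B z)) U :=
  ContDiffOn.sum fun i _ => ContDiffOn.sum fun j _ => ContDiffOn.sum fun p _ =>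
    ContDiffOn.sum fun q _ => (((hA.contDiffOn_inv i p).mul (hA.contDiffOn_inv j q)).mul
      (hB i j)).mul (hB p q)

lemma contDiffOn_coinner {U : Set (E m)} {A : E m → Matrix (Fin m) (Fin m) ℝ}
    {a b : E m → Fin m → ℝ} (hA : LocalMetric A U) (ha : ∀ i, ContDiffOn ℝ ∞ (fun z => a z i) U)
    (hb : ∀ i, ContDiffOn ℝ ∞ (fun z => b z i) U) :
    ContDiffOn ℝ ∞ (fun z => coinner (A z) (a z) (b z)) U :=
  ContDiffOn.sum fun i _ => ContDiffOn.sum fun j _ =>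
    ((hA.contDiffOn_inv i j).mul (ha i)).mul (hb j)

lemma contDiffOn_scalCoord {U : Set (E m)} {A : E m → Matrix (Fin m) (Fin m) ℝ}
    (hA : LocalMetric A U) : ContDiffOn ℝ ∞ (scalCoord A) U := by
  have h := hA.contDiffOn_christoffel
  have h2 := fun i k a b => contDiffOn_pd (i := i) hA.isOpen (h k a b)
  refine contDiffOn_traceOf hA fun j k => ?_
  simp only [ricciCoord, riemannCoord, Matrix.of_apply]
  refine ContDiffOn.sum fun i _ => ?_
  exact ((h2 _ _ _ _).sub (h2 _ _ _ _)).add (ContDiffOn.sum fun r _ =>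
    ((h _ _ _).mul (h _ _ _)).sub ((h _ _ _).mul (h _ _ _)))

lemma contDiffOn_divCoord₂ {U : Set (E m)} {A B : E m → Matrix (Fin m) (Fin m) ℝ}
    (hA : LocalMetric A U) (hB : ∀ i j, ContDiffOn ℝ ∞ (fun z => B z i j) U) (j : Fin m) :
    ContDiffOn ℝ ∞ (fun z => divCoord₂ A B z j) U := by
  have h := hA.contDiffOn_christoffel
  refine ContDiffOn.sum fun l _ => ContDiffOn.sum fun i _ => (hA.contDiffOn_inv l i).mul ?_
  exact (contDiffOn_pd hA.isOpen (hB i j)).sub (ContDiffOn.sum fun r _ =>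
    ((h _ _ _).mul (hB _ _)).add ((h _ _ _).mul (hB _ _)))

lemma contDiffOn_divCoord {U : Set (E m)} {A : E m → Matrix (Fin m) (Fin m) ℝ}
    {a : E m → Fin m → ℝ} (hA : LocalMetric A U)
    (ha : ∀ i, ContDiffOn ℝ ∞ (fun z => a z i) U) : ContDiffOn ℝ ∞ (divCoord A a) U := by
  refine (hA.contDiffOn_sqrt_det.inv fun z hz => (hA.sqrt_det_pos hz).ne').mul
    (ContDiffOn.sum fun i _ => contDiffOn_pd hA.isOpen ?_)
  exact hA.contDiffOn_sqrt_det.mul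
    (ContDiffOn.sum fun j _ => (hA.contDiffOn_inv i j).mul (ha j))

lemma smoothFn_metricTrace (hg : SmoothMetric g) (hT : SmoothBilin T) :
    SmoothFn m (metricTrace g T) := fun p =>
  (contDiffOn_traceOf (hg.localMetric p) (hT.smooth p)).congr fun _ hy =>
    metricTrace_symm hg hT hy

lemma smoothFn_metricNormSq (hg : SmoothMetric g) (hT : SmoothBilin T) :
    SmoothFn m (metricNormSq g T) := fun p =>
  (contDiffOn_normSqOf (hg.localMetric p) (hT.smooth p)).congr fun _ hy =>
    metricNormSq_symm hg hT hy

lemma smoothFn_metricCoinner (hg : SmoothMetric g) (hα : SmoothCov α) (hβ : SmoothCov β) :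
    SmoothFn m (metricCoinner g α β) := fun p =>
  (contDiffOn_coinner (hg.localMetric p) (hα.smooth p) (hβ.smooth p)).congr fun _ hy =>
    metricCoinner_symm hg hα hβ hy

lemma smoothFn_scalarCurvature (hg : SmoothMetric g) : SmoothFn m (scalarCurvature g) := fun p =>
  (contDiffOn_scalCoord (hg.localMetric p)).congr fun _ hy => scalarCurvature_symm hg hy

lemma smoothFn_divergence (hg : SmoothMetric g) (hα : SmoothCov α) :
    SmoothFn m (divergence g α) := fun p =>
  (contDiffOn_divCoord (hg.localMetric p) (hα.smooth p)).congr fun _ hy =>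
    divergence_symm hg hα hy

lemma smoothFn_coinner_divTensor (hg : SmoothMetric g) (hT : SmoothBilin T) :
    SmoothFn m fun x => coinner (coeff g x (center x)) (divTensor g T x) (divTensor g T x) :=
  fun p => (contDiffOn_coinner (hg.localMetric p)
    (contDiffOn_divCoord₂ (hg.localMetric p) (hT.smooth p))
    (contDiffOn_divCoord₂ (hg.localMetric p) (hT.smooth p))).congr fun _ hy =>
      divTensor_symm hg hT hy

lemma coeffCov_differential (hu : SmoothFn m u) {p : N} {y : E m}
    (hy : y ∈ (extChartAt (𝓡 m) p).target) (i : Fin m) :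
    coeffCov (differential u) p y i = pd i (fun z => u ((extChartAt (𝓡 m) p).symm z)) y := by
  have h1 : mfderiv (𝓡 m) 𝓘(ℝ, ℝ) (u ∘ (extChartAt (𝓡 m) p).symm) y =
      (mfderiv (𝓡 m) 𝓘(ℝ, ℝ) u _).comp (mfderiv (𝓡 m) (𝓡 m) (extChartAt (𝓡 m) p).symm y) :=
    mfderiv_comp y ((hu.contMDiff _).mdifferentiableAt (by simp)) (mdifferentiableAt_symm p hy)
  rw [mfderiv_eq_fderiv] at h1
  exact (DFunLike.congr_fun h1 (stdVec i)).symm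

lemma smoothCov_differential (hu : SmoothFn m u) :
    SmoothCov (differential u : CovectorField m N) where
  linear := ⟨fun x => (mvfderiv (𝓡 m) u x).toLinearMap, fun _ _ => rfl⟩
  smooth := fun p i => (contDiffOn_pd (isOpen_extChartAt_target p) (hu p)).congr fun _ hy =>
    coeffCov_differential hu hy i

/-- The product rule for the divergence. -/
lemma divergence_smul (hg : SmoothMetric g) (hu : SmoothFn m u) (hα : SmoothCov α) (x : N) :
    divergence g (fun x w => u x * α x w) x =
      u x * divergence g α x + metricCoinner g (differential u) α x := by
  have hc := center_mem_target (m := m) x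
  have hd := fun j => differentiableAt_of_contDiffOn (isOpen_extChartAt_target x)
    (hα.smooth x j) hc
  have h := divCoord_mul (hg.localMetric x) hc
    (differentiableAt_of_contDiffOn (isOpen_extChartAt_target x) (hu x) hc) hd
  rw [symm_center] at h
  refine h.trans ?_
  rw [metricCoinner, ← funext (coeffCov_differential hu hc)]
  rfl

lemma divergence_add (hg : SmoothMetric g) (hα : SmoothCov α) (hβ : SmoothCov β) (x : N) :
    divergence g (fun x w => α x w + β x w) x = divergence g α x + divergence g β x := by
  have hc := center_mem_target (m := m) x
  exact divCoord_add (hg.localMetric x) hc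
    (fun j => differentiableAt_of_contDiffOn (isOpen_extChartAt_target x) (hα.smooth x j) hc)
    (fun j => differentiableAt_of_contDiffOn (isOpen_extChartAt_target x) (hβ.smooth x j) hc)

end ScalarInvariants

/-! ### Integrals of compactly supported functions on the model space -/

section ModelIntegrals

open MeasureTheory

variable {m : ℕ} {U K : Set (E m)} {w : E m → ℝ}

lemma hasCompactSupport_indicator (hK : IsCompact K) (h0 : ∀ y ∈ U, y ∉ K → w y = 0) :
    HasCompactSupport (U.indicator w) :=
  HasCompactSupport.intro hK fun y hy => by
    by_cases hyU : y ∈ U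
    · rw [Set.indicator_of_mem hyU, h0 y hyU hy]
    · exact Set.indicator_of_notMem hyU _

lemma contDiff_indicator (hU : IsOpen U) (hK : IsCompact K) (hKU : K ⊆ U)
    (hw : ContDiffOn ℝ ∞ w U) (h0 : ∀ y ∈ U, y ∉ K → w y = 0) :
    ContDiff ℝ ∞ (U.indicator w) := by
  refine contDiff_iff_contDiffAt.2 fun y => ?_
  by_cases hy : y ∈ U
  · exact (hw.contDiffAt (hU.mem_nhds hy)).congr_of_eventuallyEq
      (Filter.eventually_of_mem (hU.mem_nhds hy) fun z hz => Set.indicator_of_mem hz w)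
  · refine (contDiffAt_const (c := (0 : ℝ))).congr_of_eventuallyEq
      (Filter.eventually_of_mem (hK.isClosed.isOpen_compl.mem_nhds fun h => hy (hKU h))
        fun z hz => ?_)
    by_cases hzU : z ∈ U
    · exact (Set.indicator_of_mem hzU w).trans (h0 z hzU hz)
    · exact Set.indicator_of_notMem hzU w

lemma integrableOn_of_vanishing (hU : IsOpen U) (hK : IsCompact K) (hKU : K ⊆ U)
    (hw : ContinuousOn w U) (h0 : ∀ y ∈ U, y ∉ K → w y = 0) : IntegrableOn w U := by
  have h1 : IntegrableOn w K := (hw.mono hKU).integrableOn_compact hK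
  exact h1.of_forall_sdiff_eq_zero hU.measurableSet fun y hy => h0 y hy.1 hy.2

/-- The divergence theorem for compactly supported functions. -/
lemma setIntegral_pd_eq_zero (hU : IsOpen U) (hK : IsCompact K) (hKU : K ⊆ U)
    (hw : ContDiffOn ℝ ∞ w U) (h0 : ∀ y ∈ U, y ∉ K → w y = 0) (i : Fin m) :
    ∫ y in U, pd i w y = 0 := by
  have hc := hasCompactSupport_indicator hK h0
  have hs := contDiff_indicator hU hK hKU hw h0
  have hd : Continuous fun y => fderiv ℝ (U.indicator w) y (stdVec i) :=
    (hs.continuous_fderiv (by simp)).clm_apply continuous_const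
  have hdc : HasCompactSupport fun y => fderiv ℝ (U.indicator w) y (stdVec i) :=
    hc.fderiv_apply ℝ (stdVec i)
  have h1 : ∫ y in U, pd i w y = ∫ y, fderiv ℝ (U.indicator w) y (stdVec i) := by
    rw [← setIntegral_eq_integral_of_forall_compl_eq_zero (s := U)
      (f := fun y => fderiv ℝ (U.indicator w) y (stdVec i))]
    · refine setIntegral_congr_fun hU.measurableSet fun y hy => ?_
      exact pd_congr (u := w) (v := U.indicator w) (Filter.eventually_of_mem (hU.mem_nhds hy) fun z hz =>
        (Set.indicator_of_mem hz w).symm)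
    · intro y hy
      have hyK : y ∉ tsupport (U.indicator w) := fun h => hy <| hKU <|
        closure_minimal (fun z hz => by
          by_contra hzK
          refine hz ?_
          by_cases hzU : z ∈ U
          · rw [Set.indicator_of_mem hzU, h0 z hzU hzK]
          · exact Set.indicator_of_notMem hzU _) hK.isClosed h
      rw [image_eq_zero_of_notMem_tsupport
        (fun h => hyK (tsupport_fderiv_subset ℝ h)), zero_apply]
  -- Integration by parts against the constant function `1`.
  have h2 := integral_mul_fderiv_eq_neg_fderiv_mul_of_integrable (μ := (volume : Measure (E m)))
    (f := fun _ => (1 : ℝ)) (g := U.indicator w) (v := stdVec i)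
    (by simp) (by simpa using hd.integrable_of_hasCompactSupport hdc)
    (by simpa using hs.continuous.integrable_of_hasCompactSupport hc)
    (fun _ _ => differentiableAt_const _)
    (fun _ _ => hs.differentiable (by simp) _)
  rw [h1]
  simpa using h2

end ModelIntegrals

/-! ### The Riemannian measure -/

section Measure

open MeasureTheory

variable {m : ℕ} {N : Type*} [TopologicalSpace N] [ChartedSpace (E m) N]
  {g : BilinField m N} {α : CovectorField m N} {u : N → ℝ}

lemma rep_mem_repDom {x p : N} {y : E m} (hy : y ∈ repDom m m id x p) :
    rep m m id x p y ∈ repDom m m id p x :=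
  ⟨(extChartAt (𝓡 m) p).map_source hy.2, by
    rw [Set.mem_preimage, symm_rep hy]
    exact (extChartAt (𝓡 m) x).map_target hy.1⟩

lemma rep_rep {x p : N} {y : E m} (hy : y ∈ repDom m m id x p) :
    rep m m id p x (rep m m id x p y) = y := by
  have h := symm_rep hy
  rw [rep, h]
  exact (extChartAt (𝓡 m) x).right_inv hy.1

lemma image_rep (x p : N) : rep m m id x p '' repDom m m id x p = repDom m m id p x := by
  refine Set.Subset.antisymm ?_ fun y hy => ⟨rep m m id p x y, rep_mem_repDom hy, rep_rep hy⟩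
  rintro _ ⟨y, hy, rfl⟩
  exact rep_mem_repDom hy

lemma aemeasurable_symm [MeasurableSpace N] [BorelSpace N] (p : N) (f : E m → ENNReal) : AEMeasurable (extChartAt (𝓡 m) p).symm
    ((volume.restrict (extChartAt (𝓡 m) p).target).withDensity f) :=
  ((continuousOn_extChartAt_symm p).aemeasurable
    (isOpen_extChartAt_target p).measurableSet).mono_ac (withDensity_absolutelyContinuous _ _)

variable [IsManifold (𝓡 m) ∞ N]

lemma smoothFn_of_contMDiff (hu : ContMDiff (𝓡 m) 𝓘(ℝ, ℝ) ∞ u) : SmoothFn m u := fun p =>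
  (hu.comp_contMDiffOn (contMDiffOn_extChartAt_symm p)).contDiffOn

lemma SmoothMetric.contDiffOn_density (hg : SmoothMetric g) (p : N) :
    ContDiffOn ℝ ∞ (density g p) (extChartAt (𝓡 m) p).target :=
  (hg.localMetric p).contDiffOn_sqrt_det

lemma SmoothMetric.density_pos (hg : SmoothMetric g) (p : N) {y : E m}
    (hy : y ∈ (extChartAt (𝓡 m) p).target) : 0 < density g p y :=
  (hg.localMetric p).sqrt_det_pos hy

lemma SmoothMetric.density_eq (hg : SmoothMetric g) {x p : N} {y : E m}
    (hy : y ∈ repDom m m id x p) :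
    density g x y = |(jac (rep m m id x p) y).det| * density g p (rep m m id x p y) := by
  rw [density, coeff_eq_pull hg.toSmoothBilin hy, pull, Matrix.det_mul, Matrix.det_mul,
    Matrix.det_transpose, density]
  rw [show (jac (rep m m id x p) y).det * (coeff g p (rep m m id x p y)).det *
    (jac (rep m m id x p) y).det = (jac (rep m m id x p) y).det ^ 2 *
      (coeff g p (rep m m id x p y)).det by ring, Real.sqrt_mul (sq_nonneg _), Real.sqrt_sq_eq_abs]

lemma det_fderiv_eq {L : E m → E m} {y : E m} (hL : DifferentiableAt ℝ L y) :
    (fderiv ℝ L y).det = (jac L y).det := by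
  have h : LinearMap.toMatrix (EuclideanSpace.basisFun (Fin m) ℝ).toBasis
      (EuclideanSpace.basisFun (Fin m) ℝ).toBasis (fderiv ℝ L y).toLinearMap = jac L y := by
    ext i j
    rw [LinearMap.toMatrix_apply]
    simp only [OrthonormalBasis.coe_toBasis, EuclideanSpace.basisFun_apply,
      OrthonormalBasis.coe_toBasis_repr_apply, EuclideanSpace.basisFun_repr]
    exact congrArg (fun v : E m => v i) (fderiv_stdVec hL j)
  rw [ContinuousLinearMap.det, ← LinearMap.det_toMatrix (EuclideanSpace.basisFun (Fin m) ℝ).toBasis, h]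

/-- Change of variables between two charts. -/
lemma SmoothMetric.setIntegral_chart_eq (hg : SmoothMetric g) (x p : N)
    (h0 : ∀ z, z ∉ (extChartAt (𝓡 m) x).source ∩ (extChartAt (𝓡 m) p).source → u z = 0) :
    ∫ y in (extChartAt (𝓡 m) x).target, u ((extChartAt (𝓡 m) x).symm y) * density g x y =
      ∫ y in (extChartAt (𝓡 m) p).target, u ((extChartAt (𝓡 m) p).symm y) * density g p y := by
  -- Since `u` vanishes outside the overlap of the two charts, each integral may be restricted to
  -- the image of that overlap, where the change of variables lives.
  have key : ∀ x p : N,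
      (∀ z, z ∉ (extChartAt (𝓡 m) x).source ∩ (extChartAt (𝓡 m) p).source → u z = 0) →
      ∫ y in (extChartAt (𝓡 m) x).target, u ((extChartAt (𝓡 m) x).symm y) * density g x y =
        ∫ y in repDom m m id x p, u ((extChartAt (𝓡 m) x).symm y) * density g x y := by
    intro x p h0
    refine setIntegral_eq_of_subset_of_forall_sdiff_eq_zero
      (isOpen_extChartAt_target x).measurableSet Set.inter_subset_left fun y hy => ?_
    rw [h0 _ fun h => hy.2 ⟨hy.1, h.2⟩, zero_mul]
  have hL := localMap_rep (contMDiff_id (I := 𝓡 m) (M := N) (n := ∞)) x p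
  have hd : ∀ y ∈ repDom m m id x p, DifferentiableAt ℝ (rep m m id x p) y := fun y hy =>
    differentiableAt_of_contDiffOn hL.isOpen hL.smooth hy
  rw [key x p h0, key p x fun z hz => h0 z fun h => hz h.symm, ← image_rep x p,
    integral_image_eq_integral_abs_det_fderiv_smul volume hL.isOpen.measurableSet
      (fun y hy => (hd y hy).hasFDerivAt.hasFDerivWithinAt)
      (fun y hy z hz h => by rw [← rep_rep hy, ← rep_rep hz, h])]
  refine setIntegral_congr_fun hL.isOpen.measurableSet fun y hy => ?_
  simp only [det_fderiv_eq (hd y hy), smul_eq_mul, symm_rep hy, hg.density_eq hy, id_eq]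
  ring

/-- Smoothness of the partial sums is carried through the induction because `divergence_add` needs
it at every step. -/
lemma divergence_sum (hg : SmoothMetric g) (hα : SmoothCov α) {ι : Type*} (I : Finset ι)
    {u : ι → N → ℝ} (hu : ∀ i, SmoothFn m (u i)) (x : N) :
    SmoothCov (fun x w => ∑ i ∈ I, u i x * α x w) ∧
    divergence g (fun x w => ∑ i ∈ I, u i x * α x w) x =
      ∑ i ∈ I, divergence g (fun x w => u i x * α x w) x := by
  classical
  induction I using Finset.induction_on with
  | empty =>
    refine ⟨⟨⟨fun _ => 0, fun _ _ => by simp⟩, fun p i => ?_⟩, ?_⟩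
    · simpa [coeffCov] using contDiffOn_const
    · simp [divergence, coeffCov, pd]
  | insert a I ha ih =>
    have h1 := (hα.smul (hu a)).add ih.1
    simp only [Finset.sum_insert ha]
    exact ⟨h1, by rw [divergence_add hg (hα.smul (hu a)) ih.1, ih.2]⟩

variable [T2Space N] [CompactSpace N]

/-- The finite set of charts that carry the partition of unity. -/
def chartIndices (m : ℕ) (N : Type*) [TopologicalSpace N] [ChartedSpace (E m) N]
    [IsManifold (𝓡 m) ∞ N] [T2Space N] [CompactSpace N] : Finset N :=
  (chartPartition m N).locallyFinite.finite_nonempty_of_compact.toFinset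

lemma chartPartition_eq_zero {p : N} (hp : p ∉ chartIndices m N) (x : N) :
    chartPartition m N p x = 0 := by
  by_contra h
  exact hp ((Set.Finite.mem_toFinset _).2 ⟨x, h⟩)

lemma sum_chartPartition (x : N) : ∑ p ∈ chartIndices m N, chartPartition m N p x = 1 := by
  rw [← (chartPartition m N).sum_eq_one (Set.mem_univ x)]
  refine (finsum_eq_sum_of_support_subset _ fun p hp => ?_).symm
  by_contra h
  exact hp (chartPartition_eq_zero h x)

lemma smoothFn_chartPartition (p : N) : SmoothFn m (chartPartition m N p) :=
  smoothFn_of_contMDiff (chartPartition m N p).contMDiff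

/-- The support of the partition function of a chart, in that chart. -/
def chartSupport (m : ℕ) {N : Type*} [TopologicalSpace N] [ChartedSpace (E m) N]
    [IsManifold (𝓡 m) ∞ N] [T2Space N] [CompactSpace N] (p : N) : Set (E m) :=
  extChartAt (𝓡 m) p '' tsupport (chartPartition m N p)

lemma tsupport_chartPartition_subset (p : N) :
    tsupport (chartPartition m N p) ⊆ (extChartAt (𝓡 m) p).source := by
  rw [extChartAt_source]
  exact chartPartition_isSubordinate m N p

lemma isCompact_chartSupport (p : N) : IsCompact (chartSupport m p) :=
  (isClosed_tsupport _).isCompact.image_of_continuousOn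
    ((continuousOn_extChartAt p).mono (tsupport_chartPartition_subset p))

lemma chartSupport_subset (p : N) : chartSupport m p ⊆ (extChartAt (𝓡 m) p).target := by
  rintro _ ⟨x, hx, rfl⟩
  exact (extChartAt (𝓡 m) p).map_source (tsupport_chartPartition_subset p hx)

lemma notMem_tsupport_of_notMem_chartSupport {p : N} {y : E m}
    (hy : y ∈ (extChartAt (𝓡 m) p).target) (h : y ∉ chartSupport m p) :
    (extChartAt (𝓡 m) p).symm y ∉ tsupport (chartPartition m N p) := fun h1 =>
  h ⟨_, h1, (extChartAt (𝓡 m) p).right_inv hy⟩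

lemma SmoothMetric.continuousOn_weight (hg : SmoothMetric g) (p : N) :
    ContinuousOn (fun y => chartPartition m N p ((extChartAt (𝓡 m) p).symm y) * density g p y)
      (extChartAt (𝓡 m) p).target :=
  (smoothFn_chartPartition p p).continuousOn.mul (hg.contDiffOn_density p).continuousOn

lemma SmoothMetric.integrableOn_weight (hg : SmoothMetric g) (p : N) :
    IntegrableOn (fun y => chartPartition m N p ((extChartAt (𝓡 m) p).symm y) * density g p y)
      (extChartAt (𝓡 m) p).target :=
  integrableOn_of_vanishing (isOpen_extChartAt_target p) (isCompact_chartSupport p)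
    (chartSupport_subset p) (hg.continuousOn_weight p) fun y hy h => by
      rw [image_eq_zero_of_notMem_tsupport (notMem_tsupport_of_notMem_chartSupport hy h), zero_mul]

variable [MeasurableSpace N]

/-- The contribution of a chart to the Riemannian measure. -/
def chartMeasure (g : BilinField m N) (p : N) : Measure N :=
  ((volume.restrict (extChartAt (𝓡 m) p).target).withDensity fun y =>
    ENNReal.ofReal (chartPartition m N p ((extChartAt (𝓡 m) p).symm y) * density g p y)).map
      (extChartAt (𝓡 m) p).symm

/-- By compactness and local finiteness only finitely many partition functions are nonzero, so the
sum over all points of the manifold is finite. -/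
lemma riemannianMeasure_eq_sum (g : BilinField m N) :
    riemannianMeasure g = ∑ p ∈ chartIndices m N, chartMeasure g p := by
  have h0 : ∀ p : N, p ∉ chartIndices m N → chartMeasure g p = 0 := fun p hp => by
    simp only [chartMeasure, chartPartition_eq_zero hp, zero_mul, ENNReal.ofReal_zero]
    rw [show (fun _ : E m => (0 : ENNReal)) = 0 from rfl, withDensity_zero, Measure.map_zero]
  ext A hA
  rw [Measure.finsetSum_apply]
  refine (Measure.sum_apply _ hA).trans (tsum_eq_sum fun p hp => ?_)
  exact congrArg (fun μ : Measure N => μ A) (h0 p hp)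

lemma SmoothMetric.isFiniteMeasure_chart (hg : SmoothMetric g) (p : N) :
    IsFiniteMeasure (chartMeasure g p) := by
  have h := isFiniteMeasure_withDensity_ofReal (hg.integrableOn_weight p).2
  exact Measure.isFiniteMeasure_map _ _

lemma SmoothMetric.isFiniteMeasure (hg : SmoothMetric g) :
    IsFiniteMeasure (riemannianMeasure g) := by
  rw [riemannianMeasure_eq_sum]
  have := hg.isFiniteMeasure_chart
  infer_instance

variable [BorelSpace N]

lemma SmoothMetric.integrable (hg : SmoothMetric g) (hu : Continuous u) :
    Integrable u (riemannianMeasure g) := by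
  have := hg.isFiniteMeasure
  exact hu.integrable_of_hasCompactSupport (HasCompactSupport.of_compactSpace u)

lemma SmoothMetric.integral_chart (hg : SmoothMetric g) (p : N) (hu : Continuous u) :
    ∫ x, u x ∂chartMeasure g p = ∫ y in (extChartAt (𝓡 m) p).target,
      chartPartition m N p ((extChartAt (𝓡 m) p).symm y) * u ((extChartAt (𝓡 m) p).symm y)
        * density g p y := by
  have hU := (isOpen_extChartAt_target (I := 𝓡 m) p).measurableSet
  rw [chartMeasure, integral_map (aemeasurable_symm p _) hu.aestronglyMeasurable,
    integral_withDensity_eq_integral_toReal_smul₀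
      ((hg.continuousOn_weight p).aemeasurable hU).ennreal_ofReal
      (Filter.Eventually.of_forall fun _ => ENNReal.ofReal_lt_top)]
  refine setIntegral_congr_fun hU fun y hy => ?_
  simp only [smul_eq_mul]
  rw [ENNReal.toReal_ofReal (mul_nonneg ((chartPartition m N).nonneg p _) (hg.density_pos p hy).le)]
  ring

lemma SmoothMetric.integral_eq_sum (hg : SmoothMetric g) (hu : Continuous u) :
    ∫ x, u x ∂riemannianMeasure g = ∑ p ∈ chartIndices m N,
      ∫ y in (extChartAt (𝓡 m) p).target,
        chartPartition m N p ((extChartAt (𝓡 m) p).symm y) * u ((extChartAt (𝓡 m) p).symm y)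
          * density g p y := by
  have := hg.isFiniteMeasure_chart
  rw [riemannianMeasure_eq_sum, integral_finsetSum_measure fun p _ =>
    hu.integrable_of_hasCompactSupport (HasCompactSupport.of_compactSpace u)]
  exact Finset.sum_congr rfl fun p _ => hg.integral_chart p hu

/-- Some partition function is positive at some point. Its chart contributes the integral of a
nonnegative continuous function that is not identically zero. -/
lemma SmoothMetric.measure_univ_pos (hg : SmoothMetric g) [Nonempty N] :
    0 < (riemannianMeasure g).real Set.univ := by
  have := hg.isFiniteMeasure
  have h1 := hg.integral_eq_sum (continuous_const (y := (1 : ℝ)))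
  rw [integral_const, smul_eq_mul, mul_one] at h1
  rw [h1]
  have hnn : ∀ p : N, ∀ y ∈ (extChartAt (𝓡 m) p).target,
      0 ≤ chartPartition m N p ((extChartAt (𝓡 m) p).symm y) * 1 * density g p y := fun p y hy =>
    mul_nonneg (mul_nonneg ((chartPartition m N).nonneg p _) zero_le_one) (hg.density_pos p hy).le
  obtain ⟨x⟩ := ‹Nonempty N›
  obtain ⟨p, hp⟩ := (chartPartition m N).exists_pos_of_mem (Set.mem_univ x)
  have hpI : p ∈ chartIndices m N := by
    by_contra h
    exact hp.ne' (chartPartition_eq_zero h x)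
  refine Finset.sum_pos' (fun p _ =>
    setIntegral_nonneg (isOpen_extChartAt_target p).measurableSet (hnn p)) ⟨p, hpI, ?_⟩
  have hU := isOpen_extChartAt_target (I := 𝓡 m) p
  have h0 : ∀ y ∈ (extChartAt (𝓡 m) p).target, y ∉ chartSupport m p →
      chartPartition m N p ((extChartAt (𝓡 m) p).symm y) * 1 * density g p y = 0 := fun y hy h => by
    rw [image_eq_zero_of_notMem_tsupport (notMem_tsupport_of_notMem_chartSupport hy h)]
    ring
  rw [← integral_indicator hU.measurableSet]
  have hxs : x ∈ (extChartAt (𝓡 m) p).source :=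
    tsupport_chartPartition_subset p (subset_tsupport _ hp.ne')
  refine Continuous.integral_pos_of_hasCompactSupport_nonneg_nonzero
    (contDiff_indicator hU (isCompact_chartSupport p) (chartSupport_subset p)
      (((smoothFn_chartPartition p p).mul contDiffOn_const).mul (hg.contDiffOn_density p))
      h0).continuous
    (hasCompactSupport_indicator (isCompact_chartSupport p) h0)
    (Set.indicator_nonneg (hnn p)) (x := extChartAt (𝓡 m) p x) ?_
  have hy := (extChartAt (𝓡 m) p).map_source hxs
  rw [Set.indicator_of_mem hy, (extChartAt (𝓡 m) p).left_inv hxs, mul_one]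
  exact (mul_pos hp (hg.density_pos p hy)).ne'

/-- The divergence theorem on a compact manifold. -/
theorem SmoothMetric.integral_divergence (hg : SmoothMetric g) (hα : SmoothCov α) :
    ∫ x, divergence g α x ∂riemannianMeasure g = 0 := by
  have hρα : ∀ p : N, SmoothCov (fun x w => chartPartition m N p x * α x w) := fun p =>
    hα.smul (smoothFn_chartPartition p)
  -- Decompose `α` as the sum of the fields `ρₚ α`, each supported in a single chart.
  have hdiv : ∀ x, divergence g α x = ∑ p ∈ chartIndices m N,
      divergence g (fun x w => chartPartition m N p x * α x w) x := fun x => by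
    rw [← (divergence_sum hg hα (chartIndices m N) (smoothFn_chartPartition (m := m)) x).2]
    congr 1
    ext x w
    rw [← Finset.sum_mul, sum_chartPartition, one_mul]
  simp only [hdiv]
  rw [integral_finsetSum _ fun p _ => hg.integrable (smoothFn_divergence hg (hρα p)).continuous]
  refine Finset.sum_eq_zero fun p _ => ?_
  set β : CovectorField m N := fun x w => chartPartition m N p x * α x w with hβ
  have hU := isOpen_extChartAt_target (I := 𝓡 m) p
  -- Off the support of `ρₚ` both terms of the product rule vanish, so `div (ρₚ α)` is supported in
  -- the chart around `p`.
  have hvan : ∀ z, z ∉ tsupport (chartPartition m N p) → divergence g β z = 0 := fun z hz => by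
    have h1 := divergence_smul hg (smoothFn_chartPartition p) hα z
    have h2 : ⇑(chartPartition m N p) =ᶠ[nhds z] fun _ => 0 :=
      Filter.eventually_of_mem ((isClosed_tsupport _).isOpen_compl.mem_nhds hz)
        fun w hw => image_eq_zero_of_notMem_tsupport hw
    have h3 : coeffCov (differential (chartPartition m N p)) z (center z : E m) = 0 := by
      ext i
      rw [coeffCov_differential (smoothFn_chartPartition p) (center_mem_target z)]
      have h4 : (fun y => chartPartition m N p ((extChartAt (𝓡 m) z).symm y)) =ᶠ[nhds (center z)]
          fun _ => 0 := by
        have h5 : ContinuousAt (extChartAt (𝓡 m) z).symm (center z : E m) :=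
          continuousAt_extChartAt_symm (I := 𝓡 m) z
        rw [ContinuousAt, symm_center] at h5
        exact h5.eventually h2
      rw [pd_congr h4]
      exact pd_const _
    rw [hβ, h1, h2.eq_of_nhds, metricCoinner, h3]
    simp [coinner]
  -- The measure is itself a sum over charts `q`. Each contribution `ρ_q div (ρₚ α)` is supported in
  -- the overlap with the chart around `p` and can be moved there.
  have hsum : ∀ q ∈ chartIndices m N,
      (∫ y in (extChartAt (𝓡 m) q).target,
        chartPartition m N q ((extChartAt (𝓡 m) q).symm y) *
          divergence g β ((extChartAt (𝓡 m) q).symm y) * density g q y) =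
      ∫ y in (extChartAt (𝓡 m) p).target,
        chartPartition m N q ((extChartAt (𝓡 m) p).symm y) *
          divergence g β ((extChartAt (𝓡 m) p).symm y) * density g p y := fun q _ => by
    refine hg.setIntegral_chart_eq (u := fun z => chartPartition m N q z * divergence g β z) q p
      fun z hz => ?_
    by_cases h1 : z ∈ tsupport (chartPartition m N p)
    · rw [image_eq_zero_of_notMem_tsupport fun h2 => hz ⟨tsupport_chartPartition_subset q h2,
        tsupport_chartPartition_subset p h1⟩, zero_mul]
    · rw [hvan z h1, mul_zero]
  have hd := smoothFn_divergence hg (hρα p)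
  rw [hg.integral_eq_sum hd.continuous, Finset.sum_congr rfl hsum, ← integral_finsetSum]
  -- The weights `ρ_q` now add up to `1`. Multiplying by the density cancels its reciprocal in the
  -- divergence, leaving a sum of partial derivatives of compactly supported functions.
  · simp only [← Finset.sum_mul, sum_chartPartition, one_mul]
    have hw : ∀ i, ContDiffOn ℝ ∞ (fun y => √(coeff g p y).det *
        ∑ j, (coeff g p y)⁻¹ i j * coeffCov β p y j) (extChartAt (𝓡 m) p).target := fun i =>
      (hg.localMetric p).contDiffOn_sqrt_det.mul (ContDiffOn.sum fun j _ =>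
        ((hg.localMetric p).contDiffOn_inv i j).mul ((hρα p).smooth p j))
    have hw0 : ∀ i, ∀ y ∈ (extChartAt (𝓡 m) p).target, y ∉ chartSupport m p →
        √(coeff g p y).det * ∑ j, (coeff g p y)⁻¹ i j * coeffCov β p y j = 0 := fun i y hy h => by
      have h1 := image_eq_zero_of_notMem_tsupport (notMem_tsupport_of_notMem_chartSupport hy h)
      simp only [coeffCov, hβ, h1, zero_mul, mul_zero, Finset.sum_const_zero]
    have hz := fun i => setIntegral_pd_eq_zero hU (isCompact_chartSupport p) (chartSupport_subset p)
      (hw i) (hw0 i) i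
    rw [← Finset.sum_const_zero (s := (Finset.univ : Finset (Fin m))),
      ← Finset.sum_congr rfl fun i _ => hz i, ← integral_finsetSum]
    · refine setIntegral_congr_fun hU.measurableSet fun y hy => ?_
      have h1 := ((hg.localMetric p).sqrt_det_pos hy).ne'
      have h2 : divergence g β ((extChartAt (𝓡 m) p).symm y) * density g p y =
          ∑ i, pd i (fun y => √(coeff g p y).det *
            ∑ j, (coeff g p y)⁻¹ i j * coeffCov β p y j) y := by
        rw [divergence_symm hg (hρα p) hy, divCoord, density, mul_comm, mul_inv_cancel_left₀ h1]
      exact h2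
    · intro i _
      have h0 : ∀ y ∈ (extChartAt (𝓡 m) p).target, y ∉ chartSupport m p →
          pd i (fun y => √(coeff g p y).det *
            ∑ j, (coeff g p y)⁻¹ i j * coeffCov β p y j) y = 0 := fun y hy h => by
        have hW := hU.inter (isCompact_chartSupport (m := m) p).isClosed.isOpen_compl
        rw [pd_congr (v := fun _ => 0) (Filter.eventually_of_mem (hW.mem_nhds ⟨hy, h⟩)
          fun z hz => hw0 i z hz.1 hz.2)]
        exact pd_const _
      exact integrableOn_of_vanishing hU (isCompact_chartSupport p) (chartSupport_subset p)
        (contDiffOn_pd hU (hw i)).continuousOn h0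
  · intro q _
    refine integrableOn_of_vanishing hU (isCompact_chartSupport p) (chartSupport_subset p)
      (((smoothFn_chartPartition q p).continuousOn.mul (hd p).continuousOn).mul
        (hg.contDiffOn_density p).continuousOn) fun y hy h => ?_
    rw [hvan _ (notMem_tsupport_of_notMem_chartSupport hy h)]
    ring

end Measure

/-! ### Smooth sections of tensor bundles -/

section Sections

variable {m : ℕ} {N : Type*} [TopologicalSpace N] [ChartedSpace (E m) N] [IsManifold (𝓡 m) ∞ N]

/-- A coordinate field is the image of a constant vector field under the tangent map of the inverse
chart. -/
lemma contMDiffOn_coordVec (p : N) (i : Fin m) :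
    ContMDiffOn (𝓡 m) (𝓡 m).tangent ∞
      (fun y : E m => (⟨(extChartAt (𝓡 m) p).symm y, coordVec p y i⟩ : TangentBundle (𝓡 m) N))
      (extChartAt (𝓡 m) p).target := by
  have h1 : ContMDiff (𝓡 m) (𝓡 m).tangent ∞
      (fun y : E m => (⟨y, stdVec i⟩ : TangentBundle (𝓡 m) (E m))) :=
    contMDiff_vectorSpace_iff_contDiff.2 contDiff_const
  have hU := isOpen_extChartAt_target (I := 𝓡 m) p
  have : IsManifold (𝓡 m) 1 N := IsManifold.of_le (n := ∞) (by simp)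
  have h2 := (contMDiffOn_extChartAt_symm (I := 𝓡 m) (n := ∞) p).contMDiffOn_tangentMapWithin
    (m := ∞) (by simp) hU.uniqueMDiffOn
  refine (h2.comp h1.contMDiffOn fun y hy => hy).congr fun y hy => ?_
  simp only [Function.comp_apply, tangentMapWithin, mfderivWithin_of_isOpen hU hy]
  rfl

/-- Evaluating a smooth section on two smooth coordinate fields gives a smooth section of the
trivial line bundle, whose fibre component is the coefficient. -/
lemma smoothBilin_of_contMDiff
    {B : ∀ x : N, TangentSpace (𝓡 m) x →L[ℝ] TangentSpace (𝓡 m) x →L[ℝ] ℝ}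
    (hB : ContMDiff (𝓡 m) ((𝓡 m).prod 𝓘(ℝ, E m →L[ℝ] E m →L[ℝ] ℝ)) ∞
      (fun x : N => Bundle.TotalSpace.mk' (E m →L[ℝ] E m →L[ℝ] ℝ)
        (E := fun x : N => TangentSpace (𝓡 m) x →L[ℝ] TangentSpace (𝓡 m) x →L[ℝ] ℝ) x (B x))) :
    SmoothBilin (m := m) (N := N) fun x v w => B x v w where
  linear := ⟨fun x => (ContinuousLinearMap.coeLM ℝ).comp (B x).toLinearMap, fun _ _ _ => rfl⟩
  smooth := fun p i j => by
    have : IsManifold (𝓡 m) 1 N := IsManifold.of_le (n := ∞) (by simp)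
    refine contMDiffOn_iff_contDiffOn.1 fun y hy => ?_
    have h : ContMDiffWithinAt (𝓡 m) ((𝓡 m).prod 𝓘(ℝ)) ∞ (fun y : E m => Bundle.TotalSpace.mk' ℝ
        (E := Bundle.Trivial N ℝ) ((extChartAt (𝓡 m) p).symm y)
        (B ((extChartAt (𝓡 m) p).symm y) (coordVec p y i) (coordVec p y j)))
        (extChartAt (𝓡 m) p).target y := by
      apply ContMDiffWithinAt.clm_bundle_apply₂ (F₁ := E m) (F₂ := E m)
      · exact ContMDiffAt.comp_contMDiffWithinAt y hB.contMDiffAt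
          (contMDiffOn_extChartAt_symm p y hy)
      · exact contMDiffOn_coordVec p i y hy
      · exact contMDiffOn_coordVec p j y hy
    simp only [Bundle.contMDiffWithinAt_totalSpace] at h
    exact h.2

lemma InitialDataSet.smoothMetric_g (D : InitialDataSet m N) : SmoothMetric D.g where
  toSmoothBilin := smoothBilin_of_contMDiff D.metric.contMDiff
  symm := D.metric.symm
  pos := D.metric.pos

lemma InitialDataSet.smoothBilin_k (D : InitialDataSet m N) : SmoothBilin D.k :=
  smoothBilin_of_contMDiff D.tensor_smooth

lemma fderiv_eq_toLp {l : ℕ} {L : E m → E l} {y : E m} (hL : DifferentiableAt ℝ L y) (v : E m) :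
    fderiv ℝ L y v = WithLp.toLp 2 (jac L y *ᵥ v) := by
  conv_lhs => rw [← sum_smul_stdVec v]
  rw [map_sum]
  ext i
  simp only [map_smul, fderiv_stdVec hL, Matrix.mulVec, dotProduct, jac, Matrix.of_apply]
  simp [mul_comm]

/-- The components of a tangent vector in the chart around `q`. -/
def vecCoord (q : N) (x : N) (v : TangentSpace (𝓡 m) x) : Fin m → ℝ :=
  (show E m from mfderiv (𝓡 m) (𝓡 m) (extChartAt (𝓡 m) q) x v).ofLp

lemma sum_vecCoord_smul {q x : N} (hx : x ∈ (extChartAt (𝓡 m) q).source)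
    (v : TangentSpace (𝓡 m) x) :
    (∑ i, vecCoord q x v i • (coordVec q (extChartAt (𝓡 m) q x) i : E m)) = (v : E m) := by
  have : IsManifold (𝓡 m) 1 N := IsManifold.of_le (n := ∞) (by simp)
  have h := mfderivWithin_extChartAt_symm_comp_mfderiv_extChartAt' (I := 𝓡 m) hx
  rw [ModelWithCorners.range_eq_univ, mfderivWithin_univ] at h
  exact (sum_smul_coordVec q _ _).symm.trans (DFunLike.congr_fun h v)

lemma vecCoord_eq_mulVec {q q' x : N} (hx : x ∈ (extChartAt (𝓡 m) q).source)
    (hx' : x ∈ (extChartAt (𝓡 m) q').source) (v : TangentSpace (𝓡 m) x) :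
    vecCoord q' x v = jac (rep m m id q q') (extChartAt (𝓡 m) q x) *ᵥ vecCoord q x v := by
  have : IsManifold (𝓡 m) 1 N := IsManifold.of_le (n := ∞) (by simp)
  have hL := localMap_rep (contMDiff_id (I := 𝓡 m) (M := N) (n := ∞)) q q'
  have hy : extChartAt (𝓡 m) q x ∈ repDom m m id q q' :=
    ⟨(extChartAt (𝓡 m) q).map_source hx, by
      rwa [Set.mem_preimage, (extChartAt (𝓡 m) q).left_inv hx]⟩
  have hd : DifferentiableAt ℝ (rep m m id q q') (extChartAt (𝓡 m) q x) :=
    differentiableAt_of_contDiffOn hL.isOpen hL.smooth hy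
  have h1 : extChartAt (𝓡 m) q' =ᶠ[nhds x] rep m m id q q' ∘ extChartAt (𝓡 m) q :=
    Filter.eventually_of_mem ((isOpen_extChartAt_source q).mem_nhds hx) fun z hz => by
      rw [Function.comp_apply, rep, (extChartAt (𝓡 m) q).left_inv hz, id]
  have h2 := h1.mfderiv_eq (I := 𝓡 m) (I' := 𝓡 m)
  rw [mfderiv_comp x hd.mdifferentiableAt
    (mdifferentiableAt_extChartAt (by rwa [extChartAt_source] at hx)), mfderiv_eq_fderiv] at h2
  have h3 := DFunLike.congr_fun h2 v
  exact congrArg (WithLp.ofLp) (h3.trans (fderiv_eq_toLp hd _))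

/-- A smooth vector field along a map has smooth components. -/
lemma contDiffOn_vecCoord {l : ℕ} {S : Type*} [TopologicalSpace S] [ChartedSpace (E l) S]
    [IsManifold (𝓡 l) ∞ S] {F : S → N} {ν : ∀ x, TangentSpace (𝓡 m) (F x)}
    (hν : ContMDiff (𝓡 l) (𝓡 m).tangent ∞ (fun x => (⟨F x, ν x⟩ : TangentBundle (𝓡 m) N)))
    (x : S) (q : N) (i : Fin m) :
    ContDiffOn ℝ ∞ (fun y => vecCoord q _ (ν ((extChartAt (𝓡 l) x).symm y)) i)
      (repDom l m F x q) := by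
  have : IsManifold (𝓡 m) 1 N := IsManifold.of_le (n := ∞) (by simp)
  have hU := isOpen_extChartAt_source (I := 𝓡 m) q
  have h1 : ContMDiffOn (𝓡 m) 𝓘(ℝ, E m) ∞ (extChartAt (𝓡 m) q) (extChartAt (𝓡 m) q).source := by
    rw [extChartAt_source]
    exact contMDiffOn_extChartAt
  have h2 := h1.contMDiffOn_tangentMapWithin (m := ∞) (by simp) hU.uniqueMDiffOn
  have h3 := hν.comp_contMDiffOn (contMDiffOn_extChartAt_symm (I := 𝓡 l) x)
  have h4 := (contMDiff_snd_tangentBundle_modelSpace (E m) 𝓘(ℝ, E m) (n := ∞)).comp_contMDiffOn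
    (h2.comp (h3.mono (Set.inter_subset_left (t := (extChartAt (𝓡 l) x).symm ⁻¹'
      (F ⁻¹' (extChartAt (𝓡 m) q).source)))) fun y hy => hy.2)
  have h5 := h4.contDiffOn
  refine ((EuclideanSpace.proj i : E m →L[ℝ] ℝ).contDiff.comp_contDiffOn h5).congr fun y hy => ?_
  exact congrArg (fun A : TangentSpace (𝓡 m) (F ((extChartAt (𝓡 l) x).symm y)) →L[ℝ] E m =>
    (A (ν _)).ofLp i) (mfderivWithin_of_isOpen hU hy.2).symm

end Sections

/-! ### Normal accelerations and trace-free parts -/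

section LocalLemmas

variable {m n l : ℕ} {G G' : E n → Matrix (Fin n) (Fin n) ℝ} {L : E m → E n} {U : Set (E m)}
  {W : Set (E n)}

lemma normalAccel_congr_metric {y : E m} (h : G =ᶠ[nhds (L y)] G') (ν : Fin n → ℝ) :
    normalAccel G L ν y = normalAccel G' L ν y := by
  have h1 : ∀ i a b, pd i (fun z => G z a b) (L y) = pd i (fun z => G' z a b) (L y) :=
    fun i a b => pd_congr (h.mono fun x hx => by simp only [hx])
  ext a b
  simp only [normalAccel, accel, chrVec, chr1, Matrix.of_apply, h1, h.eq_of_nhds]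

lemma LocalMap.restrict (hL : LocalMap L U W) {W' : Set (E n)} (hW' : IsOpen W') :
    LocalMap L (U ∩ L ⁻¹' W') W' where
  isOpen := hL.smooth.continuousOn.isOpen_inter_preimage hL.isOpen hW'
  smooth := hL.smooth.mono Set.inter_subset_left
  mapsTo := fun _ hy => hy.2

lemma contDiffOn_bil {A : E m → Matrix (Fin n) (Fin n) ℝ} {u v : E m → Fin n → ℝ}
    (hA : ∀ i j, ContDiffOn ℝ ∞ (fun y => A y i j) U) (hu : ∀ i, ContDiffOn ℝ ∞ (fun y => u y i) U)
    (hv : ∀ i, ContDiffOn ℝ ∞ (fun y => v y i) U) :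
    ContDiffOn ℝ ∞ (fun y => bil (A y) (u y) (v y)) U :=
  ContDiffOn.sum fun i _ => ContDiffOn.sum fun j _ => ((hA i j).mul (hu i)).mul (hv j)

lemma contDiffOn_normalAccel (hG : LocalMetric G W) (hL : LocalMap L U W) {ν : E m → Fin n → ℝ}
    (hν : ∀ i, ContDiffOn ℝ ∞ (fun y => ν y i) U) (a b : Fin m) :
    ContDiffOn ℝ ∞ (fun y => normalAccel G L (ν y) y a b) U := by
  have hc : ∀ {u : E n → ℝ}, ContDiffOn ℝ ∞ u W → ContDiffOn ℝ ∞ (fun y => u (L y)) U :=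
    fun hu => hu.comp hL.smooth hL.mapsTo
  refine contDiffOn_bil (A := fun y => G (L y)) (v := accel G L a b)
    (fun i j => hc (hG.smooth i j)) hν fun k => (hL.contDiffOn_hess a b k).add ?_
  simp only [chrVec, Matrix.mulVec, dotProduct]
  exact ContDiffOn.sum fun i _ => (hc (hG.contDiffOn_inv k i)).mul
    (contDiffOn_bil (A := fun y => chr1 G (L y) i) (fun p q => hc (hG.contDiffOn_chr1 i p q))
      (hL.contDiffOn_tangent a) (hL.contDiffOn_tangent b))

lemma traceOf_neg (A B : Matrix (Fin n) (Fin n) ℝ) : traceOf A (-B) = -traceOf A B := by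
  simp [traceOf]

lemma normSqOf_neg (A B : Matrix (Fin n) (Fin n) ℝ) : normSqOf A (-B) = normSqOf A B := by
  simp [normSqOf]

/-- Uses that the trace of `A` with respect to itself is the dimension. For the second fundamental
form and `c = H/(n-1)`, in dimension `n - 1`, this gives `|B̊|² = |B|² - H²/(n-1)`. -/
lemma normSqOf_sub_smul {A : Matrix (Fin n) (Fin n) ℝ} (hA : A.IsSymm) (hdet : IsUnit A.det)
    (B : Matrix (Fin n) (Fin n) ℝ) (c : ℝ) :
    normSqOf A (B - c • A) = normSqOf A B - 2 * c * traceOf A B + c ^ 2 * n := by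
  have h1 : ∀ i j, ∑ q, A⁻¹ i q * A j q = if i = j then 1 else 0 := fun i j => by
    have := congrFun (congrFun (Matrix.nonsing_inv_mul A hdet) i) j
    rw [Matrix.one_apply, Matrix.mul_apply] at this
    rw [← this]
    exact Finset.sum_congr rfl fun q _ => by rw [hA.apply]
  have h2 : ∀ p j, ∑ i, A⁻¹ i p * A i j = if p = j then 1 else 0 := fun p j => by
    have hi : A⁻¹.IsSymm := by rw [Matrix.IsSymm, Matrix.transpose_nonsing_inv, hA]
    rw [← h1 p j]
    exact Finset.sum_congr rfl fun q _ => by rw [hA.apply, hi.apply]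
  have e1 : ∑ i, ∑ j, ∑ p, ∑ q, A⁻¹ i p * A⁻¹ j q * B i j * A p q = traceOf A B := by
    have : ∀ i j p, ∑ q, A⁻¹ i p * A⁻¹ j q * B i j * A p q =
        A⁻¹ i p * B i j * if j = p then 1 else 0 := fun i j p => by
      rw [← h1 j p, Finset.mul_sum]
      exact Finset.sum_congr rfl fun q _ => by ring
    simp [this, traceOf]
  have e2 : ∀ C : Matrix (Fin n) (Fin n) ℝ,
      ∑ i, ∑ j, ∑ p, ∑ q, A⁻¹ i p * A⁻¹ j q * A i j * C p q = traceOf A C := fun C => by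
    rw [Finset.sum_comm]
    have : ∀ j, ∑ i, ∑ p, ∑ q, A⁻¹ i p * A⁻¹ j q * A i j * C p q =
        ∑ p, ∑ q, A⁻¹ j q * C p q * if p = j then 1 else 0 := fun j => by
      rw [Finset.sum_comm]
      refine Finset.sum_congr rfl fun p _ => ?_
      rw [Finset.sum_comm]
      refine Finset.sum_congr rfl fun q _ => ?_
      rw [← h2 p j, Finset.mul_sum]
      exact Finset.sum_congr rfl fun i _ => by ring
    simp only [this, traceOf]
    refine Finset.sum_congr rfl fun j _ => ?_
    rw [Finset.sum_comm]
    simp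
  have e3 : traceOf A A = n := by
    have : ∀ i, ∑ q, A⁻¹ i q * A i q = 1 := fun i => by rw [h1, if_pos rfl]
    simp [traceOf, this]
  have e4 : normSqOf A (B - c • A) = normSqOf A B
      - c * (∑ i, ∑ j, ∑ p, ∑ q, A⁻¹ i p * A⁻¹ j q * B i j * A p q)
      - c * (∑ i, ∑ j, ∑ p, ∑ q, A⁻¹ i p * A⁻¹ j q * A i j * B p q)
      + c ^ 2 * ∑ i, ∑ j, ∑ p, ∑ q, A⁻¹ i p * A⁻¹ j q * A i j * A p q := by
    simp only [normSqOf, Finset.mul_sum, ← Finset.sum_sub_distrib, ← Finset.sum_add_distrib,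
      Matrix.sub_apply, Matrix.smul_apply, smul_eq_mul]
    exact Finset.sum_congr rfl fun i _ => Finset.sum_congr rfl fun j _ =>
      Finset.sum_congr rfl fun p _ => Finset.sum_congr rfl fun q _ => by ring
  rw [e4, e1, e2, e2, e3]
  ring

/-- The sets on which `F` lands in a single target chart are open and cover the source chart. -/
lemma contDiffOn_of_repDom {S M : Type*} [TopologicalSpace S] [ChartedSpace (E m) S]
    [TopologicalSpace M] [ChartedSpace (E n) M] {F : S → M} (hF : Continuous F) {u : E m → ℝ}
    {x : S} (h : ∀ q, ContDiffOn ℝ ∞ u (repDom m n F x q)) :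
    ContDiffOn ℝ ∞ u (extChartAt (𝓡 m) x).target := fun y hy =>
  ((h (F ((extChartAt (𝓡 m) x).symm y))).contDiffAt
    ((isOpen_repDom hF x _).mem_nhds ⟨hy, mem_extChartAt_source (I := 𝓡 n) _⟩)).contDiffWithinAt

end LocalLemmas

/-! ### Hypersurfaces in coordinates -/

namespace Hypersurface

variable {n : ℕ} {M : Type*} [TopologicalSpace M] [ChartedSpace (E n) M] [IsManifold (𝓡 n) ∞ M]
  {D : InitialDataSet n M} {S : Type*} [TopologicalSpace S] [ChartedSpace (E (n - 1)) S]

/-- The components of the unit normal in the chart around `q`, as a function of coordinates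
around `x`. -/
def normalIn (s : Hypersurface D S) (x : S) (q : M) (y : E (n - 1)) : Fin n → ℝ :=
  vecCoord q _ (s.ν ((extChartAt (𝓡 (n - 1)) x).symm y))

/-- The second fundamental form in arbitrary charts. -/
def secondFormIn (s : Hypersurface D S) (x : S) (q : M) (y : E (n - 1)) :
    Matrix (Fin (n - 1)) (Fin (n - 1)) ℝ :=
  -normalAccel (coeff D.g q) (rep (n - 1) n s.F x q) (s.normalIn x q y) y

variable (s : Hypersurface D S) {x : S} {q : M} {y : E (n - 1)}

lemma bil_normalIn (hy : y ∈ repDom (n - 1) n s.F x q) :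
    bil (coeff D.g q (rep (n - 1) n s.F x q y)) (s.normalIn x q y) (s.normalIn x q y) = 1 := by
  rw [← bilin_coordVec D.smoothMetric_g.linear (symm_rep hy), ← s.ν_unit]
  exact congrArg₂ (D.g _) (sum_vecCoord_smul hy.2 _) (sum_vecCoord_smul hy.2 _)

lemma center_mem (x : S) : center x ∈ repDom (n - 1) n s.F x (s.F x) :=
  center_mem_repDom (mem_extChartAt_source _)

lemma normalIn_center (x : S) : s.normalIn x q (center x) = vecCoord q _ (s.ν x) := by
  rw [normalIn, symm_center]

lemma secondForm_eq (x : S) : s.secondForm x = s.secondFormIn x (s.F x) (center x) := by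
  ext a b
  rw [secondFormIn, normalIn_center, Matrix.neg_apply, normalAccel, Matrix.of_apply, bil,
    rep_center]
  rw [secondForm, Matrix.of_apply]
  refine congrArg Neg.neg (Finset.sum_congr rfl fun i _ => Finset.sum_congr rfl fun j _ => ?_)
  rw [accel, Pi.add_apply, ← sum_christoffel, rep_center]
  rfl

variable [IsManifold (𝓡 (n - 1)) ∞ S]

lemma smoothMetric_inducedMetric : SmoothMetric s.inducedMetric :=
  D.smoothMetric_g.pullbackField s.smooth s.immersion

lemma smoothBilin_pullback {T : BilinField n M} (hT : SmoothBilin T) : SmoothBilin (s.pullback T) :=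
  hT.pullbackField s.smooth

lemma coeff_inducedMetric (hy : y ∈ repDom (n - 1) n s.F x q) :
    coeff s.inducedMetric x y = pull (rep (n - 1) n s.F x q) (coeff D.g q) y :=
  coeff_pullbackField D.smoothMetric_g.linear s.smooth hy

lemma localMetric_pull (x : S) (q : M) : LocalMetric (pull (rep (n - 1) n s.F x q) (coeff D.g q))
    (repDom (n - 1) n s.F x q) where
  isOpen := isOpen_repDom s.smooth.continuous x q
  smooth := fun i j => ((s.smoothMetric_inducedMetric.smooth x i j).mono
    Set.inter_subset_left).congr fun y hy => by rw [s.coeff_inducedMetric hy]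
  posDef := fun y hy => by
    rw [← s.coeff_inducedMetric hy]
    exact (s.smoothMetric_inducedMetric.localMetric x).posDef y hy.1

lemma localMap (x : S) (q : M) : LocalMap (rep (n - 1) n s.F x q) (repDom (n - 1) n s.F x q)
    (extChartAt (𝓡 n) q).target :=
  localMap_rep s.smooth x q

lemma bil_normalIn_tangent (hy : y ∈ repDom (n - 1) n s.F x q) (a : Fin (n - 1)) :
    bil (coeff D.g q (rep (n - 1) n s.F x q y)) (s.normalIn x q y)
      (tangent (rep (n - 1) n s.F x q) a y) = 0 := by
  rw [← bilin_coordVec D.smoothMetric_g.linear (symm_rep hy),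
    ← s.ν_normal ((extChartAt (𝓡 (n - 1)) x).symm y) (coordVec x y a)]
  exact congrArg₂ (D.g _) (sum_vecCoord_smul hy.2 _) (mfderiv_coordVec s.smooth hy a).symm

lemma coeffCov_kNormal (hy : y ∈ repDom (n - 1) n s.F x q) (a : Fin (n - 1)) :
    coeffCov s.kNormal x y a = bil (coeff D.k q (rep (n - 1) n s.F x q y))
      (tangent (rep (n - 1) n s.F x q) a y) (s.normalIn x q y) := by
  rw [← bilin_coordVec D.smoothBilin_k.linear (symm_rep hy)]
  exact congrArg₂ (D.k _) (mfderiv_coordVec s.smooth hy a) (sum_vecCoord_smul hy.2 _).symm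

lemma invSplit (hn : n - 1 + 1 = n) (hy : y ∈ repDom (n - 1) n s.F x q) :
    InvSplit (coeff D.g q) (rep (n - 1) n s.F x q) (s.normalIn x q y) y :=
  invSplit_of_normal hn (D.smoothMetric_g.localMetric q) (s.localMetric_pull x q) hy
    ((s.localMap x q).mapsTo hy) (s.bil_normalIn hy) (s.bil_normalIn_tangent hy)

/-- The transformation law of the second fundamental form. -/
lemma secondForm_symm (hy : y ∈ repDom (n - 1) n s.F x q) :
    s.secondForm ((extChartAt (𝓡 (n - 1)) x).symm y) =
      pull (rep (n - 1) (n - 1) id ((extChartAt (𝓡 (n - 1)) x).symm y) x)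
        (fun _ => s.secondFormIn x q y) (center ((extChartAt (𝓡 (n - 1)) x).symm y)) := by
  set x' := (extChartAt (𝓡 (n - 1)) x).symm y with hx'
  set q' := s.F x'
  set z : E (n - 1) := center x'
  set ψ := rep (n - 1) (n - 1) id x' x
  set A := rep (n - 1) n s.F x q
  set B := rep n n id q q'
  have hz : z ∈ repDom (n - 1) (n - 1) id x' x := center_symm_mem x hy.1
  have hψz : ψ z = y := rep_center_symm x hy.1
  have hAy : A y ∈ repDom n n id q q' := ⟨(s.localMap x q).mapsTo hy, by
    rw [Set.mem_preimage, symm_rep hy]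
    exact mem_extChartAt_source q'⟩
  have hB : LocalMap B (repDom n n id q q') (extChartAt (𝓡 n) q').target :=
    localMap_rep contMDiff_id q q'
  have hA := (s.localMap x q).restrict hB.isOpen
  have hψ := (localMap_rep (contMDiff_id (I := 𝓡 (n - 1)) (M := S) (n := ∞)) x' x).restrict
    hA.isOpen
  change LocalMap A (repDom (n - 1) n s.F x q ∩ A ⁻¹' repDom n n id q q') _ at hA
  change LocalMap ψ (_ ∩ ψ ⁻¹' _) (repDom (n - 1) n s.F x q ∩ A ⁻¹' repDom n n id q q') at hψ
  have hzV : z ∈ repDom (n - 1) (n - 1) id x' x ∩ ψ ⁻¹' (repDom (n - 1) n s.F x q ∩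
      A ⁻¹' repDom n n id q q') := ⟨hz, by rw [Set.mem_preimage, hψz]; exact ⟨hy, hAy⟩⟩
  have hAψ := hA.comp hψ
  have hg := D.smoothMetric_g
  -- The immersion in the new charts is the old expression `A`, preceded by the source chart change
  -- `ψ` and followed by the ambient chart change `B`.
  have h1 : rep (n - 1) n s.F x' q' =ᶠ[nhds z] B ∘ (A ∘ ψ) :=
    Filter.eventually_of_mem (hψ.isOpen.mem_nhds hzV) fun w hw => by
      have e1 := symm_rep (F := id) hw.1
      have e2 := symm_rep hw.2.1
      simp only [Function.comp_apply, B, A, ψ, rep] at e1 e2 ⊢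
      rw [e2, e1]
      rfl
  have h2 : s.normalIn x' q' z = jac B ((A ∘ ψ) z) *ᵥ s.normalIn x q y := by
    rw [Function.comp_apply, hψz, s.normalIn_center]
    exact vecCoord_eq_mulVec hy.2 (mem_extChartAt_source q') (s.ν x')
  have hc : InvSplit (coeff D.g q') B 0 ((A ∘ ψ) z) := by
    refine hg.invSplit ?_
    rw [Function.comp_apply, hψz]
    exact hAy
  have h3 : pull B (coeff D.g q') =ᶠ[nhds ((A ∘ ψ) z)] coeff D.g q := by
    rw [Function.comp_apply, hψz]
    exact (hg.toSmoothBilin.eventuallyEq hAy).symm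
  -- The ambient change `B` is removed by isometry invariance and `ψ` by tensoriality, in this
  -- order.
  rw [secondForm_eq, secondFormIn, normalAccel_congr h1, h2,
    normalAccel_comp_left (hg.localMetric q') hB hAψ hzV hc, normalAccel_congr_metric h3,
    normalAccel_comp_right hA hψ hzV (by rw [hψz]; exact s.bil_normalIn_tangent hy), hψz, pull,
    secondFormIn, Matrix.mul_neg, Matrix.neg_mul]

lemma meanCurvature_symm (hy : y ∈ repDom (n - 1) n s.F x q) :
    s.meanCurvature ((extChartAt (𝓡 (n - 1)) x).symm y) =
      traceOf (coeff s.inducedMetric x y) (s.secondFormIn x q y) := by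
  have hg := s.smoothMetric_inducedMetric
  have hc := center_symm_mem x hy.1
  rw [meanCurvature, s.secondForm_symm hy, coeff_eq_pull hg.toSmoothBilin hc,
    (hg.invSplit hc).traceOf_pull_eq, rep_center_symm x hy.1]

lemma normSqTraceless_symm (hy : y ∈ repDom (n - 1) n s.F x q) :
    s.normSqTraceless ((extChartAt (𝓡 (n - 1)) x).symm y) =
      normSqOf (coeff s.inducedMetric x y) (s.secondFormIn x q y -
        (traceOf (coeff s.inducedMetric x y) (s.secondFormIn x q y) / ((n : ℝ) - 1)) •
          coeff s.inducedMetric x y) := by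
  have hg := s.smoothMetric_inducedMetric
  have hc := center_symm_mem x hy.1
  -- The pull-back law for norms is purely pointwise, so the second fundamental form and the
  -- coefficient of the metric may be frozen at `y`.
  have h1 := (hg.invSplit hc).normSqOf_pull (T := fun w => s.secondFormIn x q y -
        (traceOf (coeff s.inducedMetric x y) (s.secondFormIn x q y) / ((n : ℝ) - 1)) •
          coeff s.inducedMetric x w)
  rw [rep_center_symm x hy.1] at h1
  rw [normSqTraceless, s.meanCurvature_symm hy, s.secondForm_symm hy,
    coeff_eq_pull hg.toSmoothBilin hc, ← h1]
  congr 1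
  simp only [pull, Matrix.mul_sub, Matrix.sub_mul, Matrix.mul_smul, Matrix.smul_mul]

lemma contDiffOn_secondFormIn (x : S) (q : M) (a b : Fin (n - 1)) :
    ContDiffOn ℝ ∞ (fun y => s.secondFormIn x q y a b) (repDom (n - 1) n s.F x q) :=
  (contDiffOn_normalAccel (D.smoothMetric_g.localMetric q) (s.localMap x q)
    (contDiffOn_vecCoord s.ν_smooth x q) a b).neg

lemma localMetric_repDom (x : S) (q : M) :
    LocalMetric (coeff s.inducedMetric x) (repDom (n - 1) n s.F x q) where
  isOpen := isOpen_repDom s.smooth.continuous x q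
  smooth := fun i j => (s.smoothMetric_inducedMetric.smooth x i j).mono Set.inter_subset_left
  posDef := fun y hy => (s.smoothMetric_inducedMetric.localMetric x).posDef y hy.1

lemma smoothFn_meanCurvature : SmoothFn (n - 1) s.meanCurvature := fun x =>
  contDiffOn_of_repDom s.smooth.continuous fun q =>
    (contDiffOn_traceOf (s.localMetric_repDom x q) (s.contDiffOn_secondFormIn x q)).congr
      fun _ hy => s.meanCurvature_symm hy

lemma smoothFn_normSqTraceless : SmoothFn (n - 1) s.normSqTraceless := fun x =>
  contDiffOn_of_repDom s.smooth.continuous fun q =>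
    (contDiffOn_normSqOf (s.localMetric_repDom x q) fun i j =>
      (s.contDiffOn_secondFormIn x q i j).sub
        (((contDiffOn_traceOf (s.localMetric_repDom x q) (s.contDiffOn_secondFormIn x q)).div_const
          _).mul ((s.localMetric_repDom x q).smooth i j))).congr
      fun _ hy => s.normSqTraceless_symm hy

lemma smoothCov_kNormal : SmoothCov s.kNormal where
  linear := by
    obtain ⟨B, hB⟩ := D.smoothBilin_k.linear
    exact ⟨fun x => ((B (s.F x)).flip (s.ν x)).comp (s.dF x).toLinearMap, fun x v => hB _ _ _⟩
  smooth := fun x a => contDiffOn_of_repDom s.smooth.continuous fun q =>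
    (contDiffOn_bil
      (fun i j => (D.smoothBilin_k.smooth q i j).comp (s.localMap x q).smooth (s.localMap x q).mapsTo)
      ((s.localMap x q).contDiffOn_tangent a) (contDiffOn_vecCoord s.ν_smooth x q)).congr
      fun _ hy => s.coeffCov_kNormal hy a

lemma smoothFn_P : SmoothFn (n - 1) s.P :=
  smoothFn_metricTrace s.smoothMetric_inducedMetric (s.smoothBilin_pullback D.smoothBilin_k)

lemma smoothFn_scal : SmoothFn (n - 1) s.scal :=
  smoothFn_scalarCurvature s.smoothMetric_inducedMetric

/-- The twice contracted Gauss equation. -/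
lemma gauss (hn : 2 ≤ n) (x : S) :
    s.scal x = scalarCurvature D.g (s.F x) - 2 * s.ricNormal x + s.meanCurvature x ^ 2
      - s.normSqTraceless x - s.meanCurvature x ^ 2 / ((n : ℝ) - 1) := by
  have hc := s.center_mem x
  have h1 := scalCoord_pull (D.smoothMetric_g.localMetric (s.F x)) (s.localMap x (s.F x))
    (s.localMetric_pull x (s.F x)) hc (s.invSplit (by omega) hc)
  have h2 : coeff s.inducedMetric x =ᶠ[nhds (center x)] pull (rep (n - 1) n s.F x (s.F x))
      (coeff D.g (s.F x)) := Filter.eventually_of_mem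
    ((isOpen_repDom s.smooth.continuous x (s.F x)).mem_nhds hc) fun y hy => s.coeff_inducedMetric hy
  have h3 : normalAccel (coeff D.g (s.F x)) (rep (n - 1) n s.F x (s.F x))
      (s.normalIn x (s.F x) (center x)) (center x) = - s.secondForm x := by
    rw [secondForm_eq, secondFormIn, neg_neg]
  have h4 : s.scal x = scalCoord (coeff s.inducedMetric x) (center x) := rfl
  have hloc := s.smoothMetric_inducedMetric.localMetric x
  -- Converts `|B|²` into `|B̊|²`. The sign relating `normalAccel` to the second fundamental form is
  -- harmless, as the Gauss equation is quadratic in it.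
  have h5 : s.normSqTraceless x = _ := normSqOf_sub_smul (hloc.symm (center_mem_target x))
    (hloc.isUnit_det (center_mem_target x)) (s.secondForm x)
    (s.meanCurvature x / ((n : ℝ) - 1))
  rw [h3, traceOf_neg, normSqOf_neg, ← s.coeff_inducedMetric hc, ← scalCoord_congr h2, ← h4,
    rep_center, s.normalIn_center] at h1
  have h6 : s.ricNormal x = bil (ricciCoord (coeff D.g (s.F x)) (extChartAt (𝓡 n) (s.F x) (s.F x)))
      (vecCoord (s.F x) _ (s.ν x)) (vecCoord (s.F x) _ (s.ν x)) := rfl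
  have h7 : scalarCurvature D.g (s.F x) =
      scalCoord (coeff D.g (s.F x)) (extChartAt (𝓡 n) (s.F x) (s.F x)) := rfl
  have h8 : s.meanCurvature x = traceOf (coeff s.inducedMetric x (center x)) (s.secondForm x) := rfl
  have hn1 : ((n : ℝ) - 1) ≠ 0 := by
    have : (2 : ℝ) ≤ n := by exact_mod_cast hn
    linarith
  have h9 : ((n - 1 : ℕ) : ℝ) = (n : ℝ) - 1 := by
    rw [Nat.cast_sub (by omega), Nat.cast_one]
  rw [← h8, h9] at h5
  rw [← h8, ← h6, ← h7] at h1
  rw [h1, h5]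
  field_simp
  ring

end Hypersurface

/-! ### Positivity of contractions and the bound on `k(·, ν)` -/

section Covectors

variable {m n : ℕ} {G : E n → Matrix (Fin n) (Fin n) ℝ} {L : E m → E n}

lemma bil_nonneg {A : Matrix (Fin n) (Fin n) ℝ} (hA : A.PosSemidef) (v : Fin n → ℝ) :
    0 ≤ bil A v v := by
  have := hA.dotProduct_mulVec_nonneg v
  rwa [star_trivial, ← bil_eq_dot] at this

lemma bil_smul_add_smul {A : Matrix (Fin n) (Fin n) ℝ} (hA : A.IsSymm) (a b : ℝ) (u v : Fin n → ℝ) :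
    bil A (a • u + b • v) (a • u + b • v) =
      a ^ 2 * bil A u u + 2 * a * b * bil A u v + b ^ 2 * bil A v v := by
  rw [show 2 * a * b * bil A u v = a * b * bil A u v + a * b * bil A v u by
    rw [bil_comm hA v u]; ring]
  simp only [bil_eq_dot, Matrix.mulVec_add, Matrix.mulVec_smul, dotProduct_add, add_dotProduct,
    smul_dotProduct, dotProduct_smul, smul_eq_mul]
  ring

/-- Write `A` as a sum of rank-one terms `v vᵀ`; each contributes `B(v, v) ≥ 0`. -/
lemma frob_nonneg {A B : Matrix (Fin n) (Fin n) ℝ} (hA : A.PosSemidef) (hB : B.PosSemidef) :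
    0 ≤ frob A B := by
  obtain ⟨l, v, rfl⟩ := Matrix.posSemidef_iff_eq_sum_vecMulVec.1 hA
  rw [frob_eq_trace, Finset.sum_mul, Matrix.trace_sum]
  refine Finset.sum_nonneg fun i _ => ?_
  rw [← frob_eq_trace, star_trivial, frob_vecMulVec]
  exact bil_nonneg hB _

/-- The form `K(·, ν)` on a hypersurface is bounded by `K`. -/
lemma InvSplit.coinner_le_normSqOf {ν : Fin n → ℝ} {y : E m} (h : InvSplit G L ν y)
    (hG : (G (L y)).PosDef) (hg : (pull L G y).PosDef) (K : Matrix (Fin n) (Fin n) ℝ) :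
    coinner (pull L G y) ((jac L y)ᵀ *ᵥ (K *ᵥ ν)) ((jac L y)ᵀ *ᵥ (K *ᵥ ν)) ≤
      normSqOf (G (L y)) K := by
  set Q := (G (L y))⁻¹ with hQ
  set R := jac L y * (pull L G y)⁻¹ * (jac L y)ᵀ with hR
  have hQpos : Q.PosDef := hG.inv
  have hQs : Qᵀ = Q := by
    have := hQpos.isHermitian
    rwa [Matrix.IsHermitian, Matrix.conjTranspose_eq_transpose_of_trivial] at this
  have hs : Q = R + Matrix.vecMulVec ν ν := h
  have hRpos : R.PosSemidef := by
    have := hg.inv.posSemidef.mul_mul_conjTranspose_same (jac L y)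
    rwa [Matrix.conjTranspose_eq_transpose_of_trivial] at this
  have h1 : coinner (pull L G y) ((jac L y)ᵀ *ᵥ (K *ᵥ ν)) ((jac L y)ᵀ *ᵥ (K *ᵥ ν)) =
      bil R (K *ᵥ ν) (K *ᵥ ν) := by rw [coinner_eq_bil, hR, bil_mul_transpose]
  have h2 : bil Q (K *ᵥ ν) (K *ᵥ ν) = bil R (K *ᵥ ν) (K *ᵥ ν) + (ν ⬝ᵥ (K *ᵥ ν)) ^ 2 := by
    rw [hs, bil_add_matrix, bil_vecMulVec, pow_two]
  -- Split only the second inverse metric in `|K|²` into tangential and normal parts; the normal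
  -- part gives the squared norm of `K ν`.
  have h3 : normSqOf (G (L y)) K = frob (Q * K * R) K + bil Q (K *ᵥ ν) (K *ᵥ ν) := by
    have e : frob (Q * K * Matrix.vecMulVec ν ν) K = bil Q (K *ᵥ ν) (K *ᵥ ν) := by
      rw [Matrix.mul_vecMulVec, frob_vecMulVec, bil_eq_dot, bil_eq_dot,
        ← Matrix.mulVec_mulVec, dotProduct_comm]
    rw [← e, ← frob_add_left, ← Matrix.mul_add, ← hs, normSqOf_eq_frob, ← hQ, hQs]
  have h4 : 0 ≤ frob (Q * K * R) K := by
    have hX : (Kᵀ * Q * K).PosSemidef := by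
      have := hQpos.posSemidef.conjTranspose_mul_mul_same K
      rwa [Matrix.conjTranspose_eq_transpose_of_trivial] at this
    -- Cyclicity of the trace exhibits the tangential part as a contraction of two positive
    -- semidefinite matrices.
    have e : frob (Q * K * R) K = frob R (Kᵀ * Q * K) := by
      rw [frob_eq_trace, frob_eq_trace, Matrix.transpose_mul, Matrix.transpose_mul,
        Matrix.transpose_transpose, hQs, Matrix.mul_assoc, Matrix.trace_mul_comm]
      simp only [Matrix.mul_assoc]
    rw [e]
    exact frob_nonneg hRpos hX
  rw [h1, h3]
  nlinarith [sq_nonneg (ν ⬝ᵥ (K *ᵥ ν))]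

end Covectors

/-! ### Differentials of products and reciprocals -/

section Functions

variable {m : ℕ} {N : Type*} [TopologicalSpace N] [ChartedSpace (E m) N] {u v : N → ℝ}

lemma SmoothFn.mul (hu : SmoothFn m u) (hv : SmoothFn m v) : SmoothFn m fun x => u x * v x :=
  fun p => (hu p).mul (hv p)

lemma SmoothFn.inv (hu : SmoothFn m u) (h0 : ∀ x, u x ≠ 0) : SmoothFn m fun x => (u x)⁻¹ :=
  fun p => (hu p).inv fun _ _ => h0 _

variable [IsManifold (𝓡 m) ∞ N] {g : BilinField m N} {α : CovectorField m N}

lemma metricCoinner_differential_mul (hu : SmoothFn m u) (hv : SmoothFn m v) (x : N) :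
    metricCoinner g (differential fun x => u x * v x) α x =
      u x * metricCoinner g (differential v) α x + v x * metricCoinner g (differential u) α x := by
  have hc := center_mem_target (m := m) x
  have h : ∀ i, coeffCov (differential fun x => u x * v x) x (center x : E m) i =
      u x * coeffCov (differential v) x (center x : E m) i +
        v x * coeffCov (differential u) x (center x : E m) i := fun i => by
    have hd : ∀ {w : N → ℝ}, SmoothFn m w → DifferentiableAt ℝ
        (fun y => w ((extChartAt (𝓡 m) x).symm y)) (center x : E m) := fun hw =>
      differentiableAt_of_contDiffOn (isOpen_extChartAt_target x) (hw x) hc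
    rw [coeffCov_differential (hu.mul hv) hc, coeffCov_differential hu hc,
      coeffCov_differential hv hc, pd_mul (hd hu) (hd hv), symm_center]
    ring
  simp only [metricCoinner, coinner, h, Finset.mul_sum, ← Finset.sum_add_distrib]
  exact Finset.sum_congr rfl fun i _ => Finset.sum_congr rfl fun j _ => by ring

/-- The product rule applied to `u · u⁻¹ = 1`. -/
lemma metricCoinner_differential_inv (hu : SmoothFn m u) (h0 : ∀ x, u x ≠ 0) (x : N) :
    metricCoinner g (differential fun x => (u x)⁻¹) α x =
      -(metricCoinner g (differential u) α x / u x ^ 2) := by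
  have h1 := metricCoinner_differential_mul (g := g) (α := α) hu (hu.inv h0) x
  have h2 : (fun x => u x * (u x)⁻¹) = fun _ : N => (1 : ℝ) :=
    funext fun x => mul_inv_cancel₀ (h0 x)
  have h3 : metricCoinner g (differential fun _ : N => (1 : ℝ)) α x = 0 := by
    have : coeffCov (differential fun _ : N => (1 : ℝ)) x (center x : E m) = 0 := by
      ext i
      rw [coeffCov_differential (fun p => contDiffOn_const) (center_mem_target x)]
      exact pd_const _
    simp [metricCoinner, this, coinner]
  rw [h2, h3] at h1
  have := h0 x
  field_simp at h1 ⊢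
  linarith

/-- This is `|aα + bβ|² ≥ 0`, kept expanded so that linear arithmetic can use the three terms
separately. -/
lemma SmoothMetric.metricCoinner_sq_nonneg (hg : SmoothMetric g) (α β : CovectorField m N) (a b : ℝ)
    (x : N) : 0 ≤ a ^ 2 * metricCoinner g α α x + 2 * a * b * metricCoinner g α β x
      + b ^ 2 * metricCoinner g β β x := by
  have hc := center_mem_target (m := m) x
  simp only [metricCoinner, coinner_eq_bil]
  rw [← bil_smul_add_smul ((hg.localMetric x).inv_symm hc)]
  exact bil_nonneg ((hg.localMetric x).posDef _ hc).inv.posSemidef _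

end Functions

/-- The surface measure of the unit sphere is the dimension times the volume of the unit ball. -/
lemma sphereVolume_pos {n : ℕ} (hn : 0 < n) : 0 < sphereVolume n := by
  rw [sphereVolume, MeasureTheory.Measure.toSphere_real_apply_univ]
  have h1 : 0 < Module.finrank ℝ (E n) := by simpa using hn
  refine mul_pos (by exact_mod_cast h1) ?_
  exact ENNReal.toReal_pos (Metric.measure_ball_pos _ _ one_pos).ne'
    MeasureTheory.measure_ball_lt_top.ne

/-! ### From the Euler-Lagrange equation to the integral inequality -/

namespace Hypersurface

variable {n : ℕ} {M : Type*} [TopologicalSpace M] [ChartedSpace (E n) M] [IsManifold (𝓡 n) ∞ M]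
  {D : InitialDataSet n M} {S : Type*} [TopologicalSpace S] [ChartedSpace (E (n - 1)) S]
  [IsManifold (𝓡 (n - 1)) ∞ S] (s : Hypersurface D S)

lemma metricCoinner_kNormal_le (hn : 2 ≤ n) (x : S) :
    metricCoinner s.inducedMetric s.kNormal s.kNormal x ≤ D.normSqK (s.F x) := by
  have hc := s.center_mem x
  have hmem := (s.localMap x (s.F x)).mapsTo hc
  have h := (s.invSplit (by omega) hc).coinner_le_normSqOf
    ((D.smoothMetric_g.localMetric (s.F x)).posDef _ hmem)
    ((s.localMetric_pull x (s.F x)).posDef _ hc)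
    (coeff D.k (s.F x) (rep (n - 1) n s.F x (s.F x) (center x)))
  have h1 : coeffCov s.kNormal x (center x) = (jac (rep (n - 1) n s.F x (s.F x)) (center x))ᵀ *ᵥ
      (coeff D.k (s.F x) (rep (n - 1) n s.F x (s.F x) (center x)) *ᵥ
        s.normalIn x (s.F x) (center x)) := by
    ext a
    rw [s.coeffCov_kNormal hc, bil_eq_dot]
    rfl
  rw [← h1, ← s.coeff_inducedMetric hc, rep_center] at h
  exact h

variable {lam : ℝ}

/-- The covector field `d(log H) - 2 (P/H) k(·, ν)`. -/
def hawkingField (s : Hypersurface D S) : CovectorField (n - 1) S := fun x w =>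
  (s.meanCurvature x)⁻¹ * differential s.meanCurvature x w
    + (-2 * (s.P x * (s.meanCurvature x)⁻¹)) * s.kNormal x w

lemma smoothFn_inv (hH : ∀ x, 0 < s.meanCurvature x) : SmoothFn (n - 1) fun x => (s.meanCurvature x)⁻¹ :=
  s.smoothFn_meanCurvature.inv fun x => (hH x).ne'

lemma smoothFn_ratio (hH : ∀ x, 0 < s.meanCurvature x) : SmoothFn (n - 1) fun x => -2 * (s.P x * (s.meanCurvature x)⁻¹) :=
  SmoothFn.mul (fun _ => contDiffOn_const) (s.smoothFn_P.mul (s.smoothFn_inv hH))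

lemma smoothCov_hawkingField (hH : ∀ x, 0 < s.meanCurvature x) : SmoothCov s.hawkingField :=
  ((smoothCov_differential s.smoothFn_meanCurvature).smul (s.smoothFn_inv hH)).add
    (s.smoothCov_kNormal.smul (s.smoothFn_ratio hH))

/-- Both derivatives of `1/H` matter: one gives `-|∇H|²/H²`, the other the cross term with `k(·, ν)`
that allows the square to be completed. -/
lemma divergence_hawkingField (hH : ∀ x, 0 < s.meanCurvature x) (x : S) :
    divergence s.inducedMetric s.hawkingField x =
      laplaceBeltrami s.inducedMetric s.meanCurvature x / s.meanCurvature x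
      - metricCoinner s.inducedMetric (differential s.meanCurvature)
          (differential s.meanCurvature) x / s.meanCurvature x ^ 2
      - 2 * (s.P x / s.meanCurvature x) * divergence s.inducedMetric s.kNormal x
      - 2 * s.kGradNormal s.P x / s.meanCurvature x
      + 2 * s.P x * metricCoinner s.inducedMetric (differential s.meanCurvature) s.kNormal x
          / s.meanCurvature x ^ 2 := by
  have hg := s.smoothMetric_inducedMetric
  have hHs := s.smoothFn_meanCurvature
  have h0 : ∀ x, s.meanCurvature x ≠ 0 := fun x => (hH x).ne'
  have hd := smoothCov_differential hHs
  have hinv := s.smoothFn_inv hH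
  have hk := s.smoothCov_kNormal
  have e1 := divergence_add hg (hd.smul hinv) (hk.smul (s.smoothFn_ratio hH)) x
  have e4 := metricCoinner_differential_mul (g := s.inducedMetric) (α := s.kNormal)
    (u := fun _ : S => (-2 : ℝ)) (fun _ => contDiffOn_const) (s.smoothFn_P.mul hinv) x
  have e5 : metricCoinner s.inducedMetric (differential fun _ : S => (-2 : ℝ)) s.kNormal x = 0 := by
    have : coeffCov (differential fun _ : S => (-2 : ℝ)) x (center x : E (n - 1)) = 0 := by
      ext i
      rw [coeffCov_differential (fun p => contDiffOn_const) (center_mem_target x)]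
      exact pd_const _
    simp [metricCoinner, this, coinner]
  change divergence s.inducedMetric s.hawkingField x = _ at e1
  rw [e1, divergence_smul hg hinv hd, divergence_smul hg (s.smoothFn_ratio hH) hk,
    metricCoinner_differential_inv hHs h0, e4, e5,
    metricCoinner_differential_mul s.smoothFn_P hinv, metricCoinner_differential_inv hHs h0,
    laplaceBeltrami, kGradNormal]
  have := h0 x
  field_simp
  ring

/-- The pointwise inequality behind the positivity of the Hawking energy. -/
lemma sq_sub_sq_le (hH : ∀ x, 0 < s.meanCurvature x) (hn : 3 ≤ n) (hD : D.DominantEnergyCondition) (hs : s.IsHawking lam) (x : S) :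
    (s.meanCurvature x ^ 2 - s.P x ^ 2) / (2 * ((n : ℝ) - 1)) ≤
      s.f x + s.scal x / 2 - lam - divergence s.inducedMetric s.hawkingField x := by
  have hn1 : (0 : ℝ) < (n : ℝ) - 1 := by
    have : (3 : ℝ) ≤ n := by exact_mod_cast hn
    linarith
  have hx := hH x
  have e1 := s.divergence_hawkingField hH x
  have e2 := hs x
  have e3 := s.gauss (by omega) x
  have e4 := hD (s.F x)
  have e5 := s.metricCoinner_kNormal_le (by omega) x
  -- The completed square `|d log H - (P/H) k(·, ν)|² ≥ 0`.
  have e6 := s.smoothMetric_inducedMetric.metricCoinner_sq_nonneg (differential s.meanCurvature)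
    s.kNormal (s.meanCurvature x)⁻¹ (-(s.P x / s.meanCurvature x)) x
  have e7 := mul_le_mul_of_nonneg_left e5 (sq_nonneg (s.P x / s.meanCurvature x))
  rw [InitialDataSet.energyDensity] at e4
  rw [e1, f]
  generalize s.meanCurvature x = H at *
  generalize s.P x = P at *
  generalize laplaceBeltrami s.inducedMetric s.meanCurvature x = LH at *
  generalize metricCoinner s.inducedMetric (differential s.meanCurvature)
    (differential s.meanCurvature) x = X at *
  generalize metricCoinner s.inducedMetric (differential s.meanCurvature) s.kNormal x = Y at *
  generalize metricCoinner s.inducedMetric s.kNormal s.kNormal x = Z at *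
  generalize divergence s.inducedMetric s.kNormal x = dk at *
  generalize s.kGradNormal s.P x = w at *
  generalize s.normalDerivTrK x - s.normalDerivK x = N at *
  generalize s.normSqTraceless x = B at *
  generalize s.ricNormal x = R at *
  generalize s.scal x = Sc at *
  generalize scalarCurvature D.g (s.F x) = SM at *
  generalize D.normSqK (s.F x) = K at *
  generalize D.trK (s.F x) = t at *
  generalize D.normJ (s.F x) = J at *
  -- The Euler-Lagrange equation divided by `H`, solved for the part of `div W` that contains second
  -- derivatives of `H` and derivatives of `P` and `k(·, ν)`.
  have e8 : LH / H - 2 * (P / H) * dk - 2 * w / H = -lam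
      + ((n : ℝ) - 3) / (2 * ((n : ℝ) - 1)) * H ^ 2 - B - R - P / H * N - P ^ 2 / 2 := by
    field_simp at e2 ⊢
    linear_combination -e2
  have e9 : H⁻¹ ^ 2 * X + 2 * H⁻¹ * -(P / H) * Y + (-(P / H)) ^ 2 * Z =
      X / H ^ 2 - 2 * P * Y / H ^ 2 + (P / H) ^ 2 * Z := by
    field_simp
    ring
  rw [e9] at e6
  -- Writing the coefficients with the common term `H²/(n-1)` makes the `H²` terms here and in the
  -- Gauss equation combine linearly.
  have e10 : ((n : ℝ) - 3) / (2 * ((n : ℝ) - 1)) * H ^ 2 =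
      H ^ 2 / 2 - H ^ 2 / ((n : ℝ) - 1) := by
    field_simp
    ring
  -- This accounts for the coefficient of `P²` in `f`: one half comes from the Euler-Lagrange
  -- equation, and the rest supplies `-P²` in `H² - P²`.
  have e11 : (n : ℝ) / (2 * ((n : ℝ) - 1)) * P ^ 2 =
      P ^ 2 / 2 + P ^ 2 / (2 * ((n : ℝ) - 1)) := by
    field_simp
    ring
  have e12 : H ^ 2 / ((n : ℝ) - 1) = 2 * (H ^ 2 / (2 * ((n : ℝ) - 1))) := by
    field_simp
  rw [sub_div, e11]
  rw [e10] at e8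
  rw [e12] at e8 e3
  linarith

/-- The normal derivatives of `tr k` and `k` occur in `f` only multiplied by `P/H`. The
Euler-Lagrange equation expresses this product through other quantities, and the Gauss equation
eliminates `Ric(ν, ν)`; everything left is already known to be continuous on `S`. -/
lemma continuous_f (hH : ∀ x, 0 < s.meanCurvature x) (hs : s.IsHawking lam) (hn : 3 ≤ n) : Continuous s.f := by
  have hF := s.smooth.continuous
  have hg := s.smoothMetric_inducedMetric
  have cH := s.smoothFn_meanCurvature.continuous
  have cP := s.smoothFn_P.continuous
  have cB := s.smoothFn_normSqTraceless.continuous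
  have cS := s.smoothFn_scal.continuous
  have cM := (smoothFn_scalarCurvature D.smoothMetric_g).continuous.comp hF
  have hT := smoothFn_metricTrace D.smoothMetric_g D.smoothBilin_k
  have ct : Continuous fun x => D.trK (s.F x) := hT.continuous.comp hF
  have cK : Continuous fun x => D.normSqK (s.F x) :=
    (smoothFn_metricNormSq D.smoothMetric_g D.smoothBilin_k).continuous.comp hF
  have cJ : Continuous fun x => D.normJ (s.F x) :=
    (Real.continuous_sqrt.comp (smoothFn_coinner_divTensor D.smoothMetric_g
      (D.smoothBilin_k.sub_smul D.smoothMetric_g.toSmoothBilin hT)).continuous).comp hF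
  have cL : Continuous (laplaceBeltrami s.inducedMetric s.meanCurvature) :=
    (smoothFn_divergence hg (smoothCov_differential s.smoothFn_meanCurvature)).continuous
  have cd := (smoothFn_divergence hg s.smoothCov_kNormal).continuous
  have cw : Continuous (s.kGradNormal s.P) :=
    (smoothFn_metricCoinner hg (smoothCov_differential s.smoothFn_P)
      s.smoothCov_kNormal).continuous
  have h0 : ∀ x, s.meanCurvature x ≠ 0 := fun x => (hH x).ne'
  have key : ∀ x, s.P x / s.meanCurvature x * (s.normalDerivTrK x - s.normalDerivK x) =
      -(lam + laplaceBeltrami s.inducedMetric s.meanCurvature x / s.meanCurvature x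
      - ((n : ℝ) - 3) / (2 * ((n : ℝ) - 1)) * s.meanCurvature x ^ 2
      + s.normSqTraceless x
      + (scalarCurvature D.g (s.F x) + s.meanCurvature x ^ 2 - s.normSqTraceless x
        - s.meanCurvature x ^ 2 / ((n : ℝ) - 1) - s.scal x) / 2
      - 2 * (s.P x / s.meanCurvature x) * divergence s.inducedMetric s.kNormal x
      + (1 / 2) * s.P x ^ 2
      - 2 * s.kGradNormal s.P x / s.meanCurvature x) := fun x => by
    have e2 := hs x
    have e3 := s.gauss (by omega) x
    have hx := hH x
    have e4 : (scalarCurvature D.g (s.F x) + s.meanCurvature x ^ 2 - s.normSqTraceless x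
        - s.meanCurvature x ^ 2 / ((n : ℝ) - 1) - s.scal x) / 2 = s.ricNormal x := by linarith
    rw [e4]
    have hn1 : (n : ℝ) - 1 ≠ 0 := by
      have : (3 : ℝ) ≤ n := by exact_mod_cast hn
      linarith
    field_simp at e2 ⊢
    linear_combination -e2
  have hf : s.f = fun x => (s.P x / s.meanCurvature x) ^ 2 * D.normSqK (s.F x)
    + (1 / 2) * D.trK (s.F x) ^ 2
    - (1 / 2) * D.normSqK (s.F x)
    - D.normJ (s.F x)
    - (n : ℝ) / (2 * ((n : ℝ) - 1)) * s.P x ^ 2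
    - (-(lam + laplaceBeltrami s.inducedMetric s.meanCurvature x / s.meanCurvature x
      - ((n : ℝ) - 3) / (2 * ((n : ℝ) - 1)) * s.meanCurvature x ^ 2
      + s.normSqTraceless x
      + (scalarCurvature D.g (s.F x) + s.meanCurvature x ^ 2 - s.normSqTraceless x
        - s.meanCurvature x ^ 2 / ((n : ℝ) - 1) - s.scal x) / 2
      - 2 * (s.P x / s.meanCurvature x) * divergence s.inducedMetric s.kNormal x
      + (1 / 2) * s.P x ^ 2
      - 2 * s.kGradNormal s.P x / s.meanCurvature x))
    - (1 / 2) * s.normSqTraceless x := funext fun x => by rw [f, key]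
  rw [hf]
  have cM' : Continuous fun x => scalarCurvature D.g (s.F x) := cM
  have cPH : Continuous fun x => s.P x / s.meanCurvature x := cP.div cH h0
  have cLH : Continuous fun x => laplaceBeltrami s.inducedMetric s.meanCurvature x /
    s.meanCurvature x := cL.div cH h0
  have cwH : Continuous fun x => 2 * s.kGradNormal s.P x / s.meanCurvature x :=
    (continuous_const.mul cw).div cH h0
  fun_prop

open MeasureTheory

variable [T2Space S] [CompactSpace S] [MeasurableSpace S] [BorelSpace S]

/-- The integrated inequality behind the positivity of the Hawking energy. -/
lemma integral_sq_sub_sq_le (hn : 3 ≤ n) (hD : D.DominantEnergyCondition) (hs : s.IsHawking lam)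
    (hH : ∀ x, 0 < s.meanCurvature x) :
    (∫ x, (s.meanCurvature x ^ 2 - s.P x ^ 2) ∂s.areaMeasure) / (2 * ((n : ℝ) - 1)) ≤
      ∫ x, s.f x ∂s.areaMeasure + (∫ x, s.scal x ∂s.areaMeasure) / 2 - lam * s.area := by
  have hg := s.smoothMetric_inducedMetric
  have : IsFiniteMeasure s.areaMeasure := hg.isFiniteMeasure
  have cH := s.smoothFn_meanCurvature.continuous
  have cP := s.smoothFn_P.continuous
  have hA := s.smoothCov_hawkingField hH
  have iF : Integrable s.f s.areaMeasure := hg.integrable (s.continuous_f hH hs hn)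
  have iS : Integrable (fun x => s.scal x / 2) s.areaMeasure :=
    (hg.integrable s.smoothFn_scal.continuous).div_const 2
  have iD : Integrable (divergence s.inducedMetric s.hawkingField) s.areaMeasure :=
    hg.integrable (smoothFn_divergence hg hA).continuous
  have iL : Integrable (fun _ : S => lam) s.areaMeasure := integrable_const _
  have i1 : Integrable (fun x => (s.meanCurvature x ^ 2 - s.P x ^ 2) / (2 * ((n : ℝ) - 1)))
      s.areaMeasure := hg.integrable (((cH.pow 2).sub (cP.pow 2)).div_const _)
  have h := integral_mono i1 (((iF.add iS).sub iL).sub iD)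
    fun x => s.sq_sub_sq_le hH hn hD hs x
  -- The hypersurface is closed, so the divergence integrates to zero.
  have h0 : ∫ x, divergence s.inducedMetric s.hawkingField x ∂s.areaMeasure = 0 :=
    hg.integral_divergence hA
  rw [integral_sub' ((iF.add iS).sub iL) iD, integral_sub' (iF.add iS) iL, integral_add' iF iS, h0,
    integral_const, integral_div, integral_div, smul_eq_mul, sub_zero, mul_comm _ lam] at h
  exact h

lemma area_pos [Nonempty S] : 0 < s.area := s.smoothMetric_inducedMetric.measure_univ_pos

end Hypersurface

end Hawking

end

/-! ### Signs of the two energies -/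

theorem mainTheorem10 (n : ℕ) (hn : 3 ≤ n)
    {M : Type*} [TopologicalSpace M] [ChartedSpace (Hawking.E n) M] [IsManifold (𝓡 n) ∞ M]
    (D : Hawking.InitialDataSet n M) (hD : D.DominantEnergyCondition)
    {S : Type*} [TopologicalSpace S] [ChartedSpace (Hawking.E (n - 1)) S]
    [IsManifold (𝓡 (n - 1)) ∞ S] [T2Space S] [CompactSpace S] [Nonempty S]
    [MeasurableSpace S] [BorelSpace S]
    (s : Hawking.Hypersurface D S) (lam : ℝ) (hs : s.IsHawking lam)
    (hH : ∀ x : S, 0 < s.meanCurvature x) :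
    (1 / s.area * (∫ x, (s.f x + ((n : ℝ) - 3) / (2 * ((n : ℝ) - 2)) * s.scal x) ∂s.areaMeasure) ≤ lam →
      0 ≤ s.energy₁) ∧
    (1 / s.area * (∫ x, (s.f x + ((n : ℝ) - 3) / (2 * ((n : ℝ) - 2)) * s.scal x) ∂s.areaMeasure) < lam →
      0 < s.energy₁) ∧
    (1 / s.area * (∫ x, (s.f x + s.scal x / 2) ∂s.areaMeasure)
        - ((n : ℝ) - 1) / 2 * (Hawking.sphereVolume n / s.area) ^ (2 / ((n : ℝ) - 1)) ≤ lam →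
      0 ≤ s.energy₂) ∧
    (1 / s.area * (∫ x, (s.f x + s.scal x / 2) ∂s.areaMeasure)
        - ((n : ℝ) - 1) / 2 * (Hawking.sphereVolume n / s.area) ^ (2 / ((n : ℝ) - 1)) < lam →
      0 < s.energy₂) := by
  have hn3 : (3 : ℝ) ≤ n := by exact_mod_cast hn
  have hn1 : (0 : ℝ) < (n : ℝ) - 1 := by linarith
  have hn2 : (0 : ℝ) < (n : ℝ) - 2 := by linarith
  have hg := s.smoothMetric_inducedMetric
  have hw : 0 < Hawking.sphereVolume n := Hawking.sphereVolume_pos (by omega)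
  have hA : 0 < s.area := s.area_pos
  have key := s.integral_sq_sub_sq_le hn hD hs hH
  have iF : MeasureTheory.Integrable s.f s.areaMeasure := hg.integrable (s.continuous_f hH hs hn)
  have iS : MeasureTheory.Integrable s.scal s.areaMeasure :=
    hg.integrable s.smoothFn_scal.continuous
  have iHP : MeasureTheory.Integrable (fun x => s.meanCurvature x ^ 2 - s.P x ^ 2) s.areaMeasure :=
    hg.integrable ((s.smoothFn_meanCurvature.continuous.pow 2).sub (s.smoothFn_P.continuous.pow 2))
  have h1 : ∀ c : ℝ, ∫ x, (s.f x + c * s.scal x) ∂s.areaMeasure =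
      ∫ x, s.f x ∂s.areaMeasure + c * ∫ x, s.scal x ∂s.areaMeasure := fun c => by
    rw [MeasureTheory.integral_add iF (iS.const_mul c), MeasureTheory.integral_const_mul]
  have h2 : ∫ x, (s.f x + s.scal x / 2) ∂s.areaMeasure =
      ∫ x, s.f x ∂s.areaMeasure + (∫ x, s.scal x ∂s.areaMeasure) / 2 := by
    rw [MeasureTheory.integral_add iF (iS.div_const 2), MeasureTheory.integral_div]
  have h3 : ∫ x, (s.scal x - ((n : ℝ) - 2) / ((n : ℝ) - 1) * (s.meanCurvature x ^ 2 - s.P x ^ 2))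
      ∂s.areaMeasure = ∫ x, s.scal x ∂s.areaMeasure - ((n : ℝ) - 2) / ((n : ℝ) - 1) *
        ∫ x, (s.meanCurvature x ^ 2 - s.P x ^ 2) ∂s.areaMeasure := by
    rw [MeasureTheory.integral_sub iS (iHP.const_mul _), MeasureTheory.integral_const_mul]
  rw [Hawking.Hypersurface.energy₁, Hawking.Hypersurface.energy₂, h1, h2, h3]
  generalize ∫ x, s.f x ∂s.areaMeasure = If at *
  generalize ∫ x, s.scal x ∂s.areaMeasure = Is at *
  generalize ∫ x, (s.meanCurvature x ^ 2 - s.P x ^ 2) ∂s.areaMeasure = I at *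
  generalize Hawking.sphereVolume n = w at *
  generalize s.area = A at *
  have c1 : 0 < 1 / (2 * ((n : ℝ) - 1) * ((n : ℝ) - 2) * w) * (A / w) ^ (1 / ((n : ℝ) - 1)) := by
    positivity
  have c2 : 0 < 1 / 2 * (A / w) ^ (((n : ℝ) - 2) / ((n : ℝ) - 1)) := by positivity
  -- Multiplying the integrated inequality by `2(n-2)` leaves `∫ Sc^Σ` with coefficient `1 - (n-2) =
  -- -(n-3)` after subtraction; this is the origin of `(n-3)/(2(n-2))` in the first threshold.
  have k1 : 2 * ((n : ℝ) - 2) * (lam * A - (If + ((n : ℝ) - 3) / (2 * ((n : ℝ) - 2)) * Is)) ≤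
      Is - ((n : ℝ) - 2) / ((n : ℝ) - 1) * I := by
    have e := mul_le_mul_of_nonneg_left key (by positivity : 0 ≤ 2 * ((n : ℝ) - 2))
    have e1 : 2 * ((n : ℝ) - 2) * (I / (2 * ((n : ℝ) - 1))) = ((n : ℝ) - 2) / ((n : ℝ) - 1) * I := by
      field_simp
    have e2 : 2 * ((n : ℝ) - 2) * (((n : ℝ) - 3) / (2 * ((n : ℝ) - 2)) * Is) = ((n : ℝ) - 3) * Is := by
      field_simp
    rw [e1] at e
    rw [mul_sub, mul_add, e2]
    linarith
  set r := (w / A) ^ (2 / ((n : ℝ) - 1)) with hr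
  set p := (w / A) ^ (((n : ℝ) - 3) / ((n : ℝ) - 1)) with hp
  have hp0 : 0 < p := by positivity
  -- The exponents `(n-3)/(n-1)` and `2/(n-1)` add up to `1`, so the correction in the second
  -- threshold exactly matches the normalisation of the second energy.
  have hpr : p * r = w / A := by
    rw [hp, hr, ← Real.rpow_add (by positivity), ← add_div,
      show (n : ℝ) - 3 + 2 = n - 1 by ring, div_self hn1.ne', Real.rpow_one]
  -- The value `(n-1)² A r` of `∫ (H² - P²)` is the one at which the bracket in the second energy
  -- vanishes.
  have k2 : 1 / (((n : ℝ) - 1) ^ 2 * w) * p * (((n : ℝ) - 1) ^ 2 * A * r) = 1 := by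
    rw [show 1 / (((n : ℝ) - 1) ^ 2 * w) * p * (((n : ℝ) - 1) ^ 2 * A * r) =
      1 / (((n : ℝ) - 1) ^ 2 * w) * (((n : ℝ) - 1) ^ 2 * A) * (p * r) by ring, hpr]
    field_simp
  -- The same bound as before, now isolating `∫ (H² - P²)`; the assumption on `λ` bounds its right
  -- side by `(n-1)² A r`.
  have k3 : I ≤ 2 * ((n : ℝ) - 1) * (If + Is / 2 - lam * A) := by
    rw [div_le_iff₀ (by positivity)] at key
    linarith
  have c3 : 0 < 1 / (((n : ℝ) - 1) ^ 2 * w) * p := by positivity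
  have k4 : 2 * ((n : ℝ) - 1) * (((n : ℝ) - 1) / 2 * r * A) = ((n : ℝ) - 1) ^ 2 * A * r := by ring
  have k5 : ∀ X : ℝ, 1 / A * X = X / A := fun X => by ring
  rw [k5, k5]
  refine ⟨fun h => mul_nonneg c1.le (le_trans ?_ k1), fun h => mul_pos c1 (lt_of_lt_of_le ?_ k1),
    fun h => mul_nonneg c2.le (sub_nonneg.2 ?_), fun h => mul_pos c2 (sub_pos.2 ?_)⟩
  · rw [div_le_iff₀ hA] at h
    exact mul_nonneg (by positivity) (by linarith)
  · rw [div_lt_iff₀ hA] at h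
    exact mul_pos (by positivity) (by linarith)
  · rw [sub_le_iff_le_add, div_le_iff₀ hA] at h
    refine (mul_le_mul_of_nonneg_left (k3.trans ?_) c3.le).trans_eq k2
    rw [← k4]
    exact mul_le_mul_of_nonneg_left (by linarith) (by positivity)
  · rw [sub_lt_iff_lt_add, div_lt_iff₀ hA] at h
    refine (mul_lt_mul_of_pos_left (k3.trans_lt ?_) c3).trans_eq k2
    rw [← k4]
    exact mul_lt_mul_of_pos_left (by linarith) (by positivity)
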